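/- Let $\mathcal T_B$ be the following classical first-order theory in all finite types over two base types, $0$ (natural numbers) and $X$ (an abstract space); write $1$ for $0\to 0$. **Language.** The only relation symbol is $=_0$. The constants are the combinators $\Pi,\Sigma$ in all types; zero, successor and Gödel's recursors $R_\rho$ for all types $\rho$; $0_X:X$, $+_X:X\to X\to X$, $-_X:X\to X$, $\cdot_X:1\to X\to X$, $\|\cdot\|:X\to 1$; and the ad hoc constants $v_0:X$, $C:X\to 0$, $b:0$, $U:X\to X$, $u:0\to X$. Write $x\in C$ for $C(x)=_0 0$, $u_n$ for $u(n)$ and $x-y$ for $x+_X(-_Xy)$. Every $\gamma$ of type $1$ represents a real number by signed digits: $\gamma(0)$ codes the integral part ($2z$ codes $z\ge 0$, and $2z-1$ codes $-z<0$), and the $i$-th digit after the binary point, $i\ge1$, is $\min(\gamma(i),2)-1\in\{-1,0,1\}$; $\gamma_{\mathbb R}$ denotes $\gamma$ with all $\gamma(i)$, $i\ge 1$, cut off at $2$. The operations on reals ($+$, $-$, $\cdot$, $|\cdot|$, $\max$, $\min$, $n\mapsto n$, $n\mapsto \frac1{n+1}$) are given by closed terms, $=_{\mathbb R}$ and $\le_{\mathbb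 R}$ are the corresponding $\Pi^0_1$-formulas, and $<_{\mathbb R}$ is the corresponding $\Sigma^0_1$-formula. Equality $x=_Xy$ means $\|x-y\|=_{\mathbb R}0$, and equality in higher types is defined pointwise. Put $\gamma_{[0,1]}:=\max(0,\min(1,\gamma))$. **Axioms and rules of $\mathcal T_B$.** Classical logic; $=_0$ is an equivalence relation; Spector's quantifier-free rule of extensionality (from a theorem $A_0\to s=_\rho t$ with $A_0$ quantifier-free infer $A_0\to r[s]=_\tau r[t]$); the defining equations of $\Pi,\Sigma,R_\rho$; the successor axioms; induction for all formulas; $\|x\|(n)=_0\|x\|_{\mathbb R}(n)$; the vector space axioms, with $=_X$ as equality; the universal norm axioms $\|x-x\|=0$, $\|x-y\|=\|y-x\|$, $\|x-z\|\le\|x-y\|+\|y-z\|$, $\|\alpha x-\alpha y\|=|\alpha|\,\|x-y\|$, $\|\alpha x-\beta x\|=|\alpha-\beta|\,\|x\|$, $\|(x+y)-(z+w)\|\le\|x-z\|+\|y-w\|$, $\|(-x)-(-y)\|=\|x-y\|$, $\big|\|x\|-\|y\|\big|\le\|x-y\|$; the parallelogram law; and the ad hoc axioms - $v_0\in C$;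 $\ \forall x,y\in C\,(\|x-y\|\le_{\mathbb R} b)$; $\ \forall x,y\in C\,\forall\gamma^1\,((1-\gamma_{[0,1]})x+\gamma_{[0,1]}y\in C)$; - $\forall x\in C\,(U(x)\in C)$; $\ \forall x^X,y^X\,(\|U(x)-U(y)\|\le_{\mathbb R}\|x-y\|)$; - $\forall n\,(u_n\in C)$; $\ \forall n\,\big((1-\tfrac1{n+1})U(u_n)+\tfrac1{n+1}v_0=_Xu_n\big)$. **The theory $\mathcal T_B^+$.** A quantification $\forall\gamma\in[0,1]\,A(\gamma)$ means $\forall\gamma^1A(\gamma_{[0,1]})$, and dually for $\exists$. Bounded formulas are built from atomic formulas by propositional connectives and the quantifiers $\forall k\le_0 t$, $\exists k\le_0t$, $\forall x\in C$, $\exists x\in C$, $\forall\gamma\in[0,1]$, $\exists\gamma\in[0,1]$; $\Sigma$-formulas have the form $\exists n^0B(n)$ with $B$ bounded. For $f$ of type $1$ put $\tilde f(n):=\max_{k\le n}f(k)$. $\mathcal T_B^+$ is $\mathcal T_B$ together with, for all $\Sigma$-formulas $A$ (possibly with parameters), bounded choice $\mathsf{bAC}$ $$\forall n^0\exists k^0A(n,k)\to\exists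 f^1\forall n\,\exists k\le\tilde f(n)\,A(n,k)$$ and bounded collection $\mathsf{bC}$ (the third scheme is a set-theoretically false Heine/Borel principle) $$\forall i\le_0m\,\exists n^0A(i,n)\to\exists n\,\forall i\le m\,\exists k\le n\,A(i,k),$$ $$\forall\gamma\in[0,1]\,\exists n^0A(\gamma,n)\to\exists n\,\forall\gamma\in[0,1]\,\exists k\le n\,A(\gamma,k),$$ $$\forall x\in C\,\exists n^0A(x,n)\to\exists n\,\forall x\in C\,\exists k\le n\,A(x,k).$$ **Theorem.** The theory $\mathcal T_B^+$ proves the Cauchy property of Browder's sequence: $$\mathcal T_B^+\vdash\ \forall k\,\exists n\,\forall m\,\forall i,j\in[n,m]\ \Big(\|u_i-u_j\|<_{\mathbb R}\frac1{k+1}\Big),$$ where $i\in[n,m]$ means $n\le_0i\wedge i\le_0m$. -/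

import Mathlib

/-!
The formal theory of finite-type (Peano) arithmetic with an abstract inner product space and
the ad hoc constants for Browder's theorem, presented as a many-sorted first-order theory with
well-typed de Bruijn terms and natural deduction.
-/

namespace Browder

/-! ### Types, constants, terms -/

/-- Finite types over the base types `nat` (the type 0) and `X` (the abstract space). -/
inductive Ty : Type
  | nat : Ty
  | X : Ty
  | arr : Ty → Ty → Ty
  deriving DecidableEq

infixr:60 " ⇒ " => Ty.arr

/-- The type 1, i.e. `0 → 0`; real numbers are represented by objects of this type. -/
abbrev Ty.one : Ty := Ty.nat ⇒ Ty.nat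

/-- A context: the types of the free variables, the most recently bound one first. -/
abbrev Ctx : Type := List Ty

/-- The constants of the language. -/
inductive Con : Ty → Type
  /-- The combinators. -/
  | K (σ τ : Ty) : Con (σ ⇒ τ ⇒ σ)
  | S (ρ σ τ : Ty) : Con ((ρ ⇒ σ ⇒ τ) ⇒ (ρ ⇒ σ) ⇒ ρ ⇒ τ)
  /-- Arithmetic: zero, successor, and the recursors in all finite types. -/
  | zero : Con .nat
  | succ : Con (.nat ⇒ .nat)
  | R (ρ : Ty) : Con (.nat ⇒ ρ ⇒ (ρ ⇒ .nat ⇒ ρ) ⇒ ρ)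
  /-- The normed space: zero, sum, symmetric, scalar multiplication, norm. -/
  | zeroX : Con .X
  | addX : Con (.X ⇒ .X ⇒ .X)
  | negX : Con (.X ⇒ .X)
  | smulX : Con (.one ⇒ .X ⇒ .X)
  | norm : Con (.X ⇒ .one)
  /-- The ad hoc constants: the point, the characteristic function of the convex set, the bound
  on its diameter, the nonexpansive map, and the sequence. -/
  | v₀ : Con .X
  | C : Con (.X ⇒ .nat)
  | b : Con .nat
  | U : Con (.X ⇒ .X)
  | u : Con (.nat ⇒ .X)

/-- `Var Γ τ`: the variables of type `τ` in the context `Γ` (typed de Bruijn indices). -/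
inductive Var : Ctx → Ty → Type
  | z {Γ : Ctx} {σ : Ty} : Var (σ :: Γ) σ
  | s {Γ : Ctx} {σ τ : Ty} : Var Γ τ → Var (σ :: Γ) τ

/-- Terms of type `τ` with free variables from `Γ`. -/
inductive Tm (Γ : Ctx) : Ty → Type
  | var {τ : Ty} : Var Γ τ → Tm Γ τ
  | con {τ : Ty} : Con τ → Tm Γ τ
  | app {σ τ : Ty} : Tm Γ (σ ⇒ τ) → Tm Γ σ → Tm Γ τ

infixl:80 " ⬝ " => Tm.app

/-- Renaming of variables. -/
def Tm.rename {Γ Δ : Ctx} (f : ∀ τ, Var Γ τ → Var Δ τ) : ∀ {τ : Ty}, Tm Γ τ → Tm Δ τ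
  | _, .var x => .var (f _ x)
  | _, .con c => .con c
  | _, .app t s => .app (t.rename f) (s.rename f)

/-- Simultaneous substitution. -/
def Tm.subst {Γ Δ : Ctx} (f : ∀ τ, Var Γ τ → Tm Δ τ) : ∀ {τ : Ty}, Tm Γ τ → Tm Δ τ
  | _, .var x => f _ x
  | _, .con c => .con c
  | _, .app t s => .app (t.subst f) (s.subst f)

/-- Weakening by one (fresh) variable. -/
def Tm.wk {Γ : Ctx} {σ τ : Ty} (t : Tm Γ τ) : Tm (σ :: Γ) τ := t.rename (fun _ x => .s x)

/-- A closed term, viewed in an arbitrary context. -/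
def Tm.cl {Γ : Ctx} {τ : Ty} (t : Tm [] τ) : Tm Γ τ := t.rename (fun _ x => by cases x)

/-- A renaming extended under a binder. -/
def Var.up {Γ Δ : Ctx} (f : ∀ τ, Var Γ τ → Var Δ τ) {σ : Ty} : ∀ τ, Var (σ :: Γ) τ → Var (σ :: Δ) τ
  | _, .z => .z
  | _, .s x => .s (f _ x)

/-- A substitution extended under a binder. -/
def Tm.up {Γ Δ : Ctx} (f : ∀ τ, Var Γ τ → Tm Δ τ) {σ : Ty} : ∀ τ, Var (σ :: Γ) τ → Tm (σ :: Δ) τ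
  | _, .z => .var .z
  | _, .s x => (f _ x).wk

/-- The substitution of `t` for the variable `0`; the other variables move down by one. -/
def Tm.single {Γ : Ctx} {σ : Ty} (t : Tm Γ σ) : ∀ τ, Var (σ :: Γ) τ → Tm Γ τ
  | _, .z => t
  | _, .s x => .var x

/-- The substitution of `t`, which may contain the variable `0`, for the variable `0`; the other
variables stay in place. -/
def Tm.replace {Γ : Ctx} {σ : Ty} (t : Tm (σ :: Γ) σ) : ∀ τ, Var (σ :: Γ) τ → Tm (σ :: Γ) τ
  | _, .z => t
  | _, .s x => .var (.s x)

section Variables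

variable {Γ : Ctx} {σ σ₁ σ₂ σ₃ σ₄ : Ty}

abbrev x0 : Tm (σ :: Γ) σ := .var .z
abbrev x1 : Tm (σ₁ :: σ :: Γ) σ := .var (.s .z)
abbrev x2 : Tm (σ₂ :: σ₁ :: σ :: Γ) σ := .var (.s (.s .z))
abbrev x3 : Tm (σ₃ :: σ₂ :: σ₁ :: σ :: Γ) σ := .var (.s (.s (.s .z)))
abbrev x4 : Tm (σ₄ :: σ₃ :: σ₂ :: σ₁ :: σ :: Γ) σ := .var (.s (.s (.s (.s .z))))

end Variables

/-- The usual definition of lambda abstraction (of the variable `0`) from the combinators. -/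
def lam {Γ : Ctx} {σ : Ty} : ∀ {τ : Ty}, Tm (σ :: Γ) τ → Tm Γ (σ ⇒ τ)
  | _, .var .z => .con (.S σ (σ ⇒ σ) σ) ⬝ .con (.K σ (σ ⇒ σ)) ⬝ .con (.K σ σ)
  | τ, .var (.s x) => .con (.K τ σ) ⬝ .var x
  | τ, .con c => .con (.K τ σ) ⬝ .con c
  | τ, .app (σ := ρ) t s => .con (.S σ ρ τ) ⬝ lam t ⬝ lam s

/-! ### Arithmetical terms -/

section Arithmetic

variable {Γ : Ctx}

def zero : Tm Γ .nat := .con .zero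

def succ (n : Tm Γ .nat) : Tm Γ .nat := .con .succ ⬝ n

/-- `recur n a f` is `a` for `n = 0`, and `f (recur m a f) m` for `n = m + 1`. -/
def recur {ρ : Ty} (n : Tm Γ .nat) (a : Tm Γ ρ) (f : Tm Γ (ρ ⇒ .nat ⇒ ρ)) : Tm Γ ρ :=
  .con (.R ρ) ⬝ n ⬝ a ⬝ f

/-- Numerals. -/
def num : ℕ → Tm Γ .nat
  | 0 => zero
  | n + 1 => succ (num n)

/-- Addition. In the step terms below, `x0` is the recursion variable and `x1` the value of the
previous step. -/
def addTm : Tm [] (.nat ⇒ .nat ⇒ .nat) := lam (lam (recur x0 x1 (lam (lam (succ x1)))))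

def add (s t : Tm Γ .nat) : Tm Γ .nat := addTm.cl ⬝ s ⬝ t

infixl:65 " ⊹ " => add

/-- Multiplication. -/
def mulTm : Tm [] (.nat ⇒ .nat ⇒ .nat) := lam (lam (recur x0 zero (lam (lam (x1 ⊹ x3)))))

def mul (s t : Tm Γ .nat) : Tm Γ .nat := mulTm.cl ⬝ s ⬝ t

infixl:70 " ⊠ " => mul

/-- Predecessor, with value `0` at `0`. -/
def predTm : Tm [] (.nat ⇒ .nat) := lam (recur x0 zero (lam (lam x0)))

def pred (s : Tm Γ .nat) : Tm Γ .nat := predTm.cl ⬝ s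

/-- Truncated subtraction. -/
def subTm : Tm [] (.nat ⇒ .nat ⇒ .nat) := lam (lam (recur x0 x1 (lam (lam (pred x1)))))

def sub (s t : Tm Γ .nat) : Tm Γ .nat := subTm.cl ⬝ s ⬝ t

infixl:65 " ∸ " => sub

/-- The minimum of two numbers. -/
def minN (s t : Tm Γ .nat) : Tm Γ .nat := s ∸ (s ∸ t)

/-- The maximum of two numbers. -/
def maxN (s t : Tm Γ .nat) : Tm Γ .nat := s ⊹ (t ∸ s)

/-- The powers `2 ^ n`. -/
def powTm : Tm [] (.nat ⇒ .nat) := lam (recur x0 (num 1) (lam (lam (x1 ⊹ x1))))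

def pow2 (s : Tm Γ .nat) : Tm Γ .nat := powTm.cl ⬝ s

/-- Integer quotient `⌊s / t⌋` (for `t > 0`), by recursion on `s`: the quotient of `k + 1` by `t`
is `q + 1` if `(q + 1) t ≤ k + 1`, and `q` otherwise, where `q` is the quotient of `k` by `t`. -/
def divTm : Tm [] (.nat ⇒ .nat ⇒ .nat) :=
  lam (lam (recur x1 zero (lam (lam (x1 ⊹ (num 1 ∸ (succ x1 ⊠ x2 ∸ succ x0)))))))

def quot (s t : Tm Γ .nat) : Tm Γ .nat := divTm.cl ⬝ s ⬝ t

/-- The functional `f ↦ f̃`, where `f̃ n = max_{k ≤ n} f k`. -/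
def majTm : Tm [] (.one ⇒ .one) :=
  lam (lam (recur x0 (x1 ⬝ zero) (lam (lam (maxN x1 (x3 ⬝ succ x0))))))

def maj (f : Tm Γ .one) : Tm Γ .one := majTm.cl ⬝ f

end Arithmetic

/-! ### Real numbers in the signed digit representation

A function `γ` of type 1 represents the real number `z + ∑_{i ≥ 1} (d i - 1) / 2 ^ i`, where `z` is
the integer with code `γ 0` (the code is `2 z` for `z ≥ 0` and `-2 z - 1` for `z < 0`), and where
`d i = min (γ i) 2`, so that the digits `d i - 1` are `-1`, `0` or `1`. In this way every function
represents a real number. The partial sum of this series up to `i = n`, multiplied by `2 ^ n`, is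
an integer; it is given as the difference `posPart γ n - negPart γ n` of two natural numbers. Its
distance to `2 ^ n` times the represented real number is at most one. -/

section Reals

variable {Γ : Ctx}

/-- `c` modulo 2. -/
def parity (c : Tm Γ .nat) : Tm Γ .nat := c ∸ num 2 ⊠ quot c (num 2)

/-- The normal form of a representation: all digits are cut off at `2`. This is `γ_ℝ`. -/
def normalizeTm : Tm [] (.one ⇒ .one) :=
  lam (lam (recur x0 (x1 ⬝ zero) (lam (lam (minN (x3 ⬝ succ x0) (num 2))))))

def normalize (γ : Tm Γ .one) : Tm Γ .one := normalizeTm.cl ⬝ γ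

def posPartTm : Tm [] (.one ⇒ .one) :=
  lam (lam (recur x0 ((num 1 ∸ parity (x1 ⬝ zero)) ⊠ quot (x1 ⬝ zero) (num 2))
    (lam (lam (num 2 ⊠ x1 ⊹ minN (x3 ⬝ succ x0) (num 2))))))

def posPart (γ : Tm Γ .one) (n : Tm Γ .nat) : Tm Γ .nat := posPartTm.cl ⬝ γ ⬝ n

def negPartTm : Tm [] (.one ⇒ .one) :=
  lam (lam (recur x0 (parity (x1 ⬝ zero) ⊠ succ (quot (x1 ⬝ zero) (num 2)))
    (lam (lam (num 2 ⊠ x1 ⊹ num 1)))))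

def negPart (γ : Tm Γ .one) (n : Tm Γ .nat) : Tm Γ .nat := negPartTm.cl ⬝ γ ⬝ n

/-- `⌊(p - m) / 32 + 1 / 2⌋ + m`. -/
def roundAux (p m : Tm Γ .nat) : Tm Γ .nat := quot (p ⊹ num 31 ⊠ m ⊹ num 16) (num 32)

/-- From dyadic approximations to signed digits. If `r` is a real number and
`|(p n - m n) / 2 ^ (n + 5) - r| ≤ 2 / 2 ^ (n + 5)` for all `n`, then `digits p m` represents `r`.
Indeed, with `N n = ⌊(p n - m n) / 32 + 1 / 2⌋` one has `|N n - 2 ^ n r| ≤ 9 / 16`, and so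
`N (n + 1) - 2 N n` is one of `-1, 0, 1`. These numbers are the digits, and `N 0` is the integral
part. -/
def digitsTm : Tm [] (.one ⇒ .one ⇒ .one) :=
  lam (lam (lam (recur x0
    (num 2 ⊠ (roundAux (x2 ⬝ zero) (x1 ⬝ zero) ∸ x1 ⬝ zero)
      ⊹ pred (num 2 ⊠ (x1 ⬝ zero ∸ roundAux (x2 ⬝ zero) (x1 ⬝ zero))))
    (lam (lam
      ((num 1 ⊹ roundAux (x4 ⬝ succ x0) (x3 ⬝ succ x0) ⊹ num 2 ⊠ x3 ⬝ x0)
        ∸ (x3 ⬝ succ x0 ⊹ num 2 ⊠ roundAux (x4 ⬝ x0) (x3 ⬝ x0))))))))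

def digits (p m : Tm Γ .one) : Tm Γ .one := digitsTm.cl ⬝ p ⬝ m

/-- The real number associated with a natural number. -/
def natRTm : Tm [] (.nat ⇒ .one) := lam (lam (recur x0 (num 2 ⊠ x1) (lam (lam (num 1)))))

def natR (n : Tm Γ .nat) : Tm Γ .one := natRTm.cl ⬝ n

/-- The real number `1 / (n + 1)`. -/
def invSuccTm : Tm [] (.nat ⇒ .one) :=
  lam (digits (lam (quot (pow2 (x0 ⊹ num 5)) (succ x1))) (lam zero))

def invSucc (n : Tm Γ .nat) : Tm Γ .one := invSuccTm.cl ⬝ n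

/-- Sum of real numbers. -/
def addRTm : Tm [] (.one ⇒ .one ⇒ .one) :=
  lam (lam (digits
    (lam (posPart x2 (x0 ⊹ num 5) ⊹ posPart x1 (x0 ⊹ num 5)))
    (lam (negPart x2 (x0 ⊹ num 5) ⊹ negPart x1 (x0 ⊹ num 5)))))

def addR (α β : Tm Γ .one) : Tm Γ .one := addRTm.cl ⬝ α ⬝ β

/-- Symmetric of a real number. -/
def negRTm : Tm [] (.one ⇒ .one) :=
  lam (digits (lam (negPart x1 (x0 ⊹ num 5))) (lam (posPart x1 (x0 ⊹ num 5))))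

def negR (α : Tm Γ .one) : Tm Γ .one := negRTm.cl ⬝ α

/-- Difference of real numbers. -/
def subR (α β : Tm Γ .one) : Tm Γ .one := addR α (negR β)

/-- Maximum of real numbers. -/
def maxRTm : Tm [] (.one ⇒ .one ⇒ .one) :=
  lam (lam (digits
    (lam (maxN (posPart x2 (x0 ⊹ num 5) ⊹ negPart x1 (x0 ⊹ num 5))
      (posPart x1 (x0 ⊹ num 5) ⊹ negPart x2 (x0 ⊹ num 5))))
    (lam (negPart x2 (x0 ⊹ num 5) ⊹ negPart x1 (x0 ⊹ num 5)))))

def maxR (α β : Tm Γ .one) : Tm Γ .one := maxRTm.cl ⬝ α ⬝ β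

/-- Minimum of real numbers. -/
def minRTm : Tm [] (.one ⇒ .one ⇒ .one) :=
  lam (lam (digits
    (lam (minN (posPart x2 (x0 ⊹ num 5) ⊹ negPart x1 (x0 ⊹ num 5))
      (posPart x1 (x0 ⊹ num 5) ⊹ negPart x2 (x0 ⊹ num 5))))
    (lam (negPart x2 (x0 ⊹ num 5) ⊹ negPart x1 (x0 ⊹ num 5)))))

def minR (α β : Tm Γ .one) : Tm Γ .one := minRTm.cl ⬝ α ⬝ β

/-- Absolute value of a real number. -/
def absR (α : Tm Γ .one) : Tm Γ .one := maxR α (negR α)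

/-- A number `K` with `|α| + |β| + 1 ≤ K`. -/
def mulBound (α β : Tm Γ .one) : Tm Γ .nat :=
  posPart α zero ⊹ negPart α zero ⊹ posPart β zero ⊹ negPart β zero ⊹ num 3

/-- The precision with which factors are evaluated in a product: `n + 5 + mulBound α β`. -/
def mulPrec (α β : Tm Γ .one) (n : Tm Γ .nat) : Tm Γ .nat := n ⊹ num 5 ⊹ mulBound α β

/-- Product of real numbers. The factors are evaluated with precision `N = mulPrec α β n`; the
product of the approximations is divided by `2 ^ (N + mulBound α β) = 2 ^ (2 N - (n + 5))`. -/
def mulRTm : Tm [] (.one ⇒ .one ⇒ .one) :=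
  lam (lam (digits
    (lam (quot
      (posPart x2 (mulPrec x2 x1 x0) ⊠ posPart x1 (mulPrec x2 x1 x0)
        ⊹ negPart x2 (mulPrec x2 x1 x0) ⊠ negPart x1 (mulPrec x2 x1 x0))
      (pow2 (mulPrec x2 x1 x0 ⊹ mulBound x2 x1))))
    (lam (quot
      (posPart x2 (mulPrec x2 x1 x0) ⊠ negPart x1 (mulPrec x2 x1 x0)
        ⊹ negPart x2 (mulPrec x2 x1 x0) ⊠ posPart x1 (mulPrec x2 x1 x0))
      (pow2 (mulPrec x2 x1 x0 ⊹ mulBound x2 x1))))))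

def mulR (α β : Tm Γ .one) : Tm Γ .one := mulRTm.cl ⬝ α ⬝ β

/-- `γ_{[0,1]} = max (0, min (1, γ))`. -/
def unit (γ : Tm Γ .one) : Tm Γ .one := maxR (natR zero) (minR (natR (num 1)) γ)

end Reals

/-! ### Terms of type `X` and ad hoc constants -/

section Space

variable {Γ : Ctx}

def zeroX : Tm Γ .X := .con .zeroX
def addX (x y : Tm Γ .X) : Tm Γ .X := .con .addX ⬝ x ⬝ y
def negX (x : Tm Γ .X) : Tm Γ .X := .con .negX ⬝ x
def subX (x y : Tm Γ .X) : Tm Γ .X := addX x (negX y)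
def smulX (γ : Tm Γ .one) (x : Tm Γ .X) : Tm Γ .X := .con .smulX ⬝ γ ⬝ x
def norm (x : Tm Γ .X) : Tm Γ .one := .con .norm ⬝ x
def v₀ : Tm Γ .X := .con .v₀
def b : Tm Γ .nat := .con .b
def U (x : Tm Γ .X) : Tm Γ .X := .con .U ⬝ x
def u (n : Tm Γ .nat) : Tm Γ .X := .con .u ⬝ n

/-- The distance `‖x - y‖`. -/
def dist (x y : Tm Γ .X) : Tm Γ .one := norm (subX x y)

/-- The square of the norm. -/
def normSq (x : Tm Γ .X) : Tm Γ .one := mulR (norm x) (norm x)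

/-- `(1 - γ) x + γ y`. -/
def segment (γ : Tm Γ .one) (x y : Tm Γ .X) : Tm Γ .X :=
  addX (smulX (subR (natR (num 1)) γ) x) (smulX γ y)

end Space

/-! ### Formulas -/

/-- Formulas with free variables from `Γ`. Equality of type 0 is the only relation symbol. -/
inductive Fm : Ctx → Type
  | eq {Γ : Ctx} : Tm Γ .nat → Tm Γ .nat → Fm Γ
  | bot {Γ : Ctx} : Fm Γ
  | and {Γ : Ctx} : Fm Γ → Fm Γ → Fm Γ
  | or {Γ : Ctx} : Fm Γ → Fm Γ → Fm Γ
  | imp {Γ : Ctx} : Fm Γ → Fm Γ → Fm Γ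
  | all {Γ : Ctx} (σ : Ty) : Fm (σ :: Γ) → Fm Γ
  | ex {Γ : Ctx} (σ : Ty) : Fm (σ :: Γ) → Fm Γ

infixr:25 " ⟶ᶠ " => Fm.imp
infixr:35 " ∧ᶠ " => Fm.and
infixr:30 " ∨ᶠ " => Fm.or

def Fm.rename : ∀ {Γ Δ : Ctx}, (∀ τ, Var Γ τ → Var Δ τ) → Fm Γ → Fm Δ
  | _, _, f, .eq s t => .eq (s.rename f) (t.rename f)
  | _, _, _, .bot => .bot
  | _, _, f, .and A B => .and (A.rename f) (B.rename f)
  | _, _, f, .or A B => .or (A.rename f) (B.rename f)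
  | _, _, f, .imp A B => .imp (A.rename f) (B.rename f)
  | _, _, f, .all σ A => .all σ (A.rename (Var.up f))
  | _, _, f, .ex σ A => .ex σ (A.rename (Var.up f))

def Fm.subst : ∀ {Γ Δ : Ctx}, (∀ τ, Var Γ τ → Tm Δ τ) → Fm Γ → Fm Δ
  | _, _, f, .eq s t => .eq (s.subst f) (t.subst f)
  | _, _, _, .bot => .bot
  | _, _, f, .and A B => .and (A.subst f) (B.subst f)
  | _, _, f, .or A B => .or (A.subst f) (B.subst f)
  | _, _, f, .imp A B => .imp (A.subst f) (B.subst f)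
  | _, _, f, .all σ A => .all σ (A.subst (Tm.up f))
  | _, _, f, .ex σ A => .ex σ (A.subst (Tm.up f))

/-- Weakening by one (fresh) variable. -/
def Fm.wk {Γ : Ctx} {σ : Ty} (A : Fm Γ) : Fm (σ :: Γ) := A.rename (fun _ x => .s x)

/-- `A[t / x0]`. -/
def Fm.inst {Γ : Ctx} {σ : Ty} (A : Fm (σ :: Γ)) (t : Tm Γ σ) : Fm Γ := A.subst t.single

section Abbreviations

variable {Γ : Ctx}

/-- `s ≤ t` for numbers. -/
def le (s t : Tm Γ .nat) : Fm Γ := .eq (s ∸ t) zero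

/-- `α ≤ β` for reals: `α_n ≤ β_n + 2 / 2 ^ n` for all `n`, where `α_n` and `β_n` are the partial
sums of the signed digit representations. -/
def leR (α β : Tm Γ .one) : Fm Γ :=
  .all .nat (le (posPart α.wk x0 ⊹ negPart β.wk x0) (posPart β.wk x0 ⊹ negPart α.wk x0 ⊹ num 2))

/-- `α < β` for reals: `α_n + 2 / 2 ^ n < β_n` for some `n`. -/
def ltR (α β : Tm Γ .one) : Fm Γ :=
  .ex .nat (le (succ (posPart α.wk x0 ⊹ negPart β.wk x0 ⊹ num 2))
    (posPart β.wk x0 ⊹ negPart α.wk x0))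

/-- `α = β` for reals: `|α_n - β_n| ≤ 2 / 2 ^ n` for all `n`. -/
def eqR (α β : Tm Γ .one) : Fm Γ :=
  .all .nat
    (le (posPart α.wk x0 ⊹ negPart β.wk x0) (posPart β.wk x0 ⊹ negPart α.wk x0 ⊹ num 2) ∧ᶠ
      le (posPart β.wk x0 ⊹ negPart α.wk x0) (posPart α.wk x0 ⊹ negPart β.wk x0 ⊹ num 2))

/-- `x = y` in the space: `‖x - y‖ = 0`. -/
def eqX (x y : Tm Γ .X) : Fm Γ := eqR (dist x y) (natR zero)

/-- Equality in all finite types, defined pointwise. -/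
def eqT : ∀ {Γ : Ctx} (τ : Ty), Tm Γ τ → Tm Γ τ → Fm Γ
  | _, .nat, s, t => .eq s t
  | _, .X, s, t => eqX s t
  | _, .arr σ τ, s, t => .all σ (eqT τ (s.wk ⬝ x0) (t.wk ⬝ x0))

/-- `x ∈ C`. -/
def memC (x : Tm Γ .X) : Fm Γ := .eq (.con .C ⬝ x) zero

/-- `∀ k ≤ t, A`. -/
def allLe (t : Tm Γ .nat) (A : Fm (.nat :: Γ)) : Fm Γ := .all .nat (le x0 t.wk ⟶ᶠ A)

/-- `∃ k ≤ t, A`. -/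
def exLe (t : Tm Γ .nat) (A : Fm (.nat :: Γ)) : Fm Γ := .ex .nat (le x0 t.wk ∧ᶠ A)

/-- `∀ x ∈ C, A`. -/
def allC (A : Fm (.X :: Γ)) : Fm Γ := .all .X (memC x0 ⟶ᶠ A)

/-- `∃ x ∈ C, A`. -/
def exC (A : Fm (.X :: Γ)) : Fm Γ := .ex .X (memC x0 ∧ᶠ A)

/-- `∀ γ ∈ [0,1], A`, that is, `∀ γ, A(γ_{[0,1]})`. -/
def allUnit (A : Fm (.one :: Γ)) : Fm Γ := .all .one (A.subst (unit x0).replace)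

/-- `∃ γ ∈ [0,1], A`, that is, `∃ γ, A(γ_{[0,1]})`. -/
def exUnit (A : Fm (.one :: Γ)) : Fm Γ := .ex .one (A.subst (unit x0).replace)

end Abbreviations

/-- Quantifier-free formulas. -/
inductive QF : ∀ {Γ : Ctx}, Fm Γ → Prop
  | eq {Γ : Ctx} (s t : Tm Γ .nat) : QF (.eq s t)
  | bot {Γ : Ctx} : QF (.bot : Fm Γ)
  | and {Γ : Ctx} {A B : Fm Γ} : QF A → QF B → QF (A ∧ᶠ B)
  | or {Γ : Ctx} {A B : Fm Γ} : QF A → QF B → QF (A ∨ᶠ B)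
  | imp {Γ : Ctx} {A B : Fm Γ} : QF A → QF B → QF (A ⟶ᶠ B)

/-- Bounded formulas. -/
inductive Bounded : ∀ {Γ : Ctx}, Fm Γ → Prop
  | eq {Γ : Ctx} (s t : Tm Γ .nat) : Bounded (.eq s t)
  | bot {Γ : Ctx} : Bounded (.bot : Fm Γ)
  | and {Γ : Ctx} {A B : Fm Γ} : Bounded A → Bounded B → Bounded (A ∧ᶠ B)
  | or {Γ : Ctx} {A B : Fm Γ} : Bounded A → Bounded B → Bounded (A ∨ᶠ B)
  | imp {Γ : Ctx} {A B : Fm Γ} : Bounded A → Bounded B → Bounded (A ⟶ᶠ B)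
  | allLe {Γ : Ctx} (t : Tm Γ .nat) {A : Fm (.nat :: Γ)} : Bounded A → Bounded (allLe t A)
  | exLe {Γ : Ctx} (t : Tm Γ .nat) {A : Fm (.nat :: Γ)} : Bounded A → Bounded (exLe t A)
  | allC {Γ : Ctx} {A : Fm (.X :: Γ)} : Bounded A → Bounded (allC A)
  | exC {Γ : Ctx} {A : Fm (.X :: Γ)} : Bounded A → Bounded (exC A)
  | allUnit {Γ : Ctx} {A : Fm (.one :: Γ)} : Bounded A → Bounded (allUnit A)
  | exUnit {Γ : Ctx} {A : Fm (.one :: Γ)} : Bounded A → Bounded (exUnit A)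

/-- `Σ`-formulas: `∃ n, B(n)` with `n` of type 0 and `B` bounded. -/
inductive Sigma1 : ∀ {Γ : Ctx}, Fm Γ → Prop
  | ex {Γ : Ctx} {B : Fm (.nat :: Γ)} : Bounded B → Sigma1 (.ex .nat B)

/-! ### Axioms

Universal axioms `∀ x, A(x)` are given by all their instances `A(t)`, in every context. (The
universal closures follow by generalization, and conversely.) -/

/-- The axioms of the theory `T_B`. -/
inductive AxTB : ∀ {Γ : Ctx}, Fm Γ → Prop
  -- Equality of type 0 is an equivalence relation.
  | eq_refl {Γ : Ctx} (r : Tm Γ .nat) : AxTB (.eq r r)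
  | eq_symm {Γ : Ctx} (r s : Tm Γ .nat) : AxTB (.eq r s ⟶ᶠ .eq s r)
  | eq_trans {Γ : Ctx} (r s t : Tm Γ .nat) : AxTB (.eq r s ⟶ᶠ .eq s t ⟶ᶠ .eq r t)
  -- Combinators and recursors.
  | comb_K {Γ : Ctx} (σ τ : Ty) (r : Tm Γ σ) (s : Tm Γ τ) :
      AxTB (eqT σ (.con (.K σ τ) ⬝ r ⬝ s) r)
  | comb_S {Γ : Ctx} (ρ σ τ : Ty) (r : Tm Γ (ρ ⇒ σ ⇒ τ)) (s : Tm Γ (ρ ⇒ σ)) (t : Tm Γ ρ) :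
      AxTB (eqT τ (.con (.S ρ σ τ) ⬝ r ⬝ s ⬝ t) (r ⬝ t ⬝ (s ⬝ t)))
  | rec_zero {Γ : Ctx} (ρ : Ty) (r : Tm Γ ρ) (s : Tm Γ (ρ ⇒ .nat ⇒ ρ)) :
      AxTB (eqT ρ (recur zero r s) r)
  | rec_succ {Γ : Ctx} (ρ : Ty) (n : Tm Γ .nat) (r : Tm Γ ρ) (s : Tm Γ (ρ ⇒ .nat ⇒ ρ)) :
      AxTB (eqT ρ (recur (succ n) r s) (s ⬝ recur n r s ⬝ n))
  -- Successor and unrestricted induction.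
  | succ_ne_zero {Γ : Ctx} (n : Tm Γ .nat) : AxTB (.eq (succ n) zero ⟶ᶠ .bot)
  | succ_inj {Γ : Ctx} (m n : Tm Γ .nat) : AxTB (.eq (succ m) (succ n) ⟶ᶠ .eq m n)
  | induction {Γ : Ctx} (A : Fm (.nat :: Γ)) :
      AxTB (A.inst zero ∧ᶠ .all .nat (A ⟶ᶠ A.subst (succ x0).replace) ⟶ᶠ .all .nat A)
  -- The norm of a vector is a real number in normal form.
  | norm_real {Γ : Ctx} (x : Tm Γ .X) (n : Tm Γ .nat) :
      AxTB (.eq (norm x ⬝ n) (normalize (norm x) ⬝ n))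
  -- Vector space axioms.
  | add_comm {Γ : Ctx} (x y : Tm Γ .X) : AxTB (eqX (addX x y) (addX y x))
  | add_assoc {Γ : Ctx} (x y z : Tm Γ .X) : AxTB (eqX (addX (addX x y) z) (addX x (addX y z)))
  | add_zero {Γ : Ctx} (x : Tm Γ .X) : AxTB (eqX (addX x zeroX) x)
  | add_neg {Γ : Ctx} (x : Tm Γ .X) : AxTB (eqX (addX x (negX x)) zeroX)
  | one_smul {Γ : Ctx} (x : Tm Γ .X) : AxTB (eqX (smulX (natR (num 1)) x) x)
  | mul_smul {Γ : Ctx} (α β : Tm Γ .one) (x : Tm Γ .X) :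
      AxTB (eqX (smulX (mulR α β) x) (smulX α (smulX β x)))
  | add_smul {Γ : Ctx} (α β : Tm Γ .one) (x : Tm Γ .X) :
      AxTB (eqX (smulX (addR α β) x) (addX (smulX α x) (smulX β x)))
  | smul_add {Γ : Ctx} (α : Tm Γ .one) (x y : Tm Γ .X) :
      AxTB (eqX (smulX α (addX x y)) (addX (smulX α x) (smulX α y)))
  -- Norm axioms.
  | dist_self {Γ : Ctx} (x : Tm Γ .X) : AxTB (eqR (dist x x) (natR zero))
  | dist_comm {Γ : Ctx} (x y : Tm Γ .X) : AxTB (eqR (dist x y) (dist y x))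
  | dist_triangle {Γ : Ctx} (x y z : Tm Γ .X) : AxTB (leR (dist x z) (addR (dist x y) (dist y z)))
  | dist_smul {Γ : Ctx} (α : Tm Γ .one) (x y : Tm Γ .X) :
      AxTB (eqR (dist (smulX α x) (smulX α y)) (mulR (absR α) (dist x y)))
  | dist_smul_smul {Γ : Ctx} (α β : Tm Γ .one) (x : Tm Γ .X) :
      AxTB (eqR (dist (smulX α x) (smulX β x)) (mulR (absR (subR α β)) (norm x)))
  | dist_add {Γ : Ctx} (x y z w : Tm Γ .X) :
      AxTB (leR (dist (addX x y) (addX z w)) (addR (dist x z) (dist y w)))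
  | dist_neg {Γ : Ctx} (x y : Tm Γ .X) : AxTB (eqR (dist (negX x) (negX y)) (dist x y))
  | norm_sub {Γ : Ctx} (x y : Tm Γ .X) :
      AxTB (leR (absR (subR (norm x) (norm y))) (dist x y))
  | parallelogram {Γ : Ctx} (x y : Tm Γ .X) :
      AxTB (eqR (addR (normSq (addX x y)) (normSq (subX x y)))
        (mulR (natR (num 2)) (addR (normSq x) (normSq y))))
  -- The convex set, its point and its bound.
  | v₀_mem {Γ : Ctx} : AxTB (memC (v₀ : Tm Γ .X))
  | diam {Γ : Ctx} (x y : Tm Γ .X) : AxTB (memC x ∧ᶠ memC y ⟶ᶠ leR (dist x y) (natR b))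
  | convex {Γ : Ctx} (γ : Tm Γ .one) (x y : Tm Γ .X) :
      AxTB (memC x ∧ᶠ memC y ⟶ᶠ memC (segment (unit γ) x y))
  -- The nonexpansive map.
  | U_mem {Γ : Ctx} (x : Tm Γ .X) : AxTB (memC x ⟶ᶠ memC (U x))
  | U_nonexpansive {Γ : Ctx} (x y : Tm Γ .X) : AxTB (leR (dist (U x) (U y)) (dist x y))
  -- The sequence of fixed points of `x ↦ (1 - 1 / (n + 1)) U x + (1 / (n + 1)) v₀`.
  | u_mem {Γ : Ctx} (n : Tm Γ .nat) : AxTB (memC (u n))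
  | u_fixed {Γ : Ctx} (n : Tm Γ .nat) :
      AxTB (eqX (segment (invSucc n) (U (u n)) v₀) (u n))

/-- The renaming that turns `A(y, k)` with parameters from `Γ` into the same formula with
parameters from `σ :: Γ`. -/
def skip {Γ : Ctx} {σ ρ : Ty} :
    ∀ τ, Var (.nat :: ρ :: Γ) τ → Var (.nat :: ρ :: σ :: Γ) τ :=
  Var.up (Var.up (fun _ x => .s x))

/-- The axioms of `T_B⁺`: those of `T_B`, bounded choice and bounded collection. -/
inductive AxTBPlus : ∀ {Γ : Ctx}, Fm Γ → Prop
  | base {Γ : Ctx} {A : Fm Γ} : AxTB A → AxTBPlus A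
  -- `∀ n ∃ k A(n, k) → ∃ f ∀ n ∃ k ≤ f̃(n) A(n, k)`
  | bAC {Γ : Ctx} {A : Fm (.nat :: .nat :: Γ)} : Sigma1 A →
      AxTBPlus (.all .nat (.ex .nat A) ⟶ᶠ
        .ex .one (.all .nat (exLe (maj x1 ⬝ x0) (A.rename skip))))
  -- `∀ i ≤ m ∃ n A(i, n) → ∃ n ∀ i ≤ m ∃ k ≤ n A(i, k)`
  | bC_nat {Γ : Ctx} (m : Tm Γ .nat) {A : Fm (.nat :: .nat :: Γ)} : Sigma1 A →
      AxTBPlus (allLe m (.ex .nat A) ⟶ᶠ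
        .ex .nat (allLe m.wk (exLe x1 (A.rename skip))))
  -- `∀ γ ∈ [0,1] ∃ n A(γ, n) → ∃ n ∀ γ ∈ [0,1] ∃ k ≤ n A(γ, k)`
  | bC_unit {Γ : Ctx} {A : Fm (.nat :: .one :: Γ)} : Sigma1 A →
      AxTBPlus (allUnit (.ex .nat A) ⟶ᶠ
        .ex .nat (allUnit (exLe x1 (A.rename skip))))
  -- `∀ x ∈ C ∃ n A(x, n) → ∃ n ∀ x ∈ C ∃ k ≤ n A(x, k)`
  | bC_C {Γ : Ctx} {A : Fm (.nat :: .X :: Γ)} : Sigma1 A →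
      AxTBPlus (allC (.ex .nat A) ⟶ᶠ
        .ex .nat (allC (exLe x1 (A.rename skip))))

/-! ### Derivations -/

/-- `Derives Ax H A`: the formula `A` is derivable from the hypotheses `H` in the theory with the
axioms `Ax`, by classical natural deduction and Spector's quantifier-free rule of extensionality.
The premise of the latter has to be a theorem, i.e. to be derived without hypotheses. -/
inductive Derives (Ax : ∀ {Γ : Ctx}, Fm Γ → Prop) : ∀ {Γ : Ctx}, List (Fm Γ) → Fm Γ → Prop
  | ax {Γ : Ctx} {H : List (Fm Γ)} {A : Fm Γ} : Ax A → Derives Ax H A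
  | hyp {Γ : Ctx} {H : List (Fm Γ)} {A : Fm Γ} : A ∈ H → Derives Ax H A
  | by_contra {Γ : Ctx} {H : List (Fm Γ)} {A : Fm Γ} :
      Derives Ax ((A ⟶ᶠ .bot) :: H) .bot → Derives Ax H A
  | and_intro {Γ : Ctx} {H : List (Fm Γ)} {A B : Fm Γ} :
      Derives Ax H A → Derives Ax H B → Derives Ax H (A ∧ᶠ B)
  | and_left {Γ : Ctx} {H : List (Fm Γ)} {A B : Fm Γ} : Derives Ax H (A ∧ᶠ B) → Derives Ax H A
  | and_right {Γ : Ctx} {H : List (Fm Γ)} {A B : Fm Γ} : Derives Ax H (A ∧ᶠ B) → Derives Ax H B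
  | or_left {Γ : Ctx} {H : List (Fm Γ)} {A B : Fm Γ} : Derives Ax H A → Derives Ax H (A ∨ᶠ B)
  | or_right {Γ : Ctx} {H : List (Fm Γ)} {A B : Fm Γ} : Derives Ax H B → Derives Ax H (A ∨ᶠ B)
  | or_elim {Γ : Ctx} {H : List (Fm Γ)} {A B D : Fm Γ} : Derives Ax H (A ∨ᶠ B) →
      Derives Ax (A :: H) D → Derives Ax (B :: H) D → Derives Ax H D
  | imp_intro {Γ : Ctx} {H : List (Fm Γ)} {A B : Fm Γ} :
      Derives Ax (A :: H) B → Derives Ax H (A ⟶ᶠ B)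
  | imp_elim {Γ : Ctx} {H : List (Fm Γ)} {A B : Fm Γ} :
      Derives Ax H (A ⟶ᶠ B) → Derives Ax H A → Derives Ax H B
  | all_intro {Γ : Ctx} {H : List (Fm Γ)} {σ : Ty} {A : Fm (σ :: Γ)} :
      Derives Ax (H.map Fm.wk) A → Derives Ax H (.all σ A)
  | all_elim {Γ : Ctx} {H : List (Fm Γ)} {σ : Ty} {A : Fm (σ :: Γ)} (t : Tm Γ σ) :
      Derives Ax H (.all σ A) → Derives Ax H (A.inst t)
  | ex_intro {Γ : Ctx} {H : List (Fm Γ)} {σ : Ty} {A : Fm (σ :: Γ)} (t : Tm Γ σ) :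
      Derives Ax H (A.inst t) → Derives Ax H (.ex σ A)
  | ex_elim {Γ : Ctx} {H : List (Fm Γ)} {σ : Ty} {A : Fm (σ :: Γ)} {B : Fm Γ} :
      Derives Ax H (.ex σ A) → Derives Ax (A :: H.map Fm.wk) B.wk → Derives Ax H B
  | qf_ext {Γ : Ctx} {H : List (Fm Γ)} {ρ τ : Ty} {A : Fm Γ} (s t : Tm Γ ρ) (r : Tm (ρ :: Γ) τ) :
      QF A → Derives Ax [] (A ⟶ᶠ eqT ρ s t) →
      Derives Ax H (A ⟶ᶠ eqT τ (r.subst s.single) (r.subst t.single))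

/-- The theory `T_B⁺` proves the sentence `A`. -/
def TBPlusProves (A : Fm []) : Prop := Derives AxTBPlus [] A

/-- The Cauchy property of `(u_n)`:
`∀ k ∃ n ∀ m ∀ i, j ∈ [n, m] (‖u_i - u_j‖ < 1 / (k + 1))`.
Under the five quantifiers, the variables `k, n, m, i, j` are `x4, x3, x2, x1, x0`. -/
def cauchy : Fm [] :=
  .all .nat (.ex .nat (.all .nat (.all .nat (.all .nat
    ((le x3 x1 ∧ᶠ le x1 x2) ∧ᶠ (le x3 x0 ∧ᶠ le x0 x2) ⟶ᶠ
      ltR (dist (u x1) (u x0)) (invSucc x4))))))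

end Browder

/-! The mathematics is Browder's convergence argument in Hilbert space. Put xₙ = uₙ - v₀. The fixed
point equation says (n + 1) xₙ = n (U uₙ - v₀), so U uₙ - v₀ = (1 + 1/n) xₙ for n ≥ 1. Inserting
this into ‖U uₙ - U uₘ‖² ≤ ‖xₙ - xₘ‖² and expanding the square by the parallelogram law gives ‖xₙ -
xₘ‖² ≤ ‖xₘ‖² - ‖xₙ‖² for 1 ≤ n ≤ m (`Model.nrm_seq_sub_seq_sq_le`). Hence ‖xₙ‖² is nondecreasing
from n = 1 on. It is bounded by b², so from some index on it grows by less than ε²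
(`Model.exists_nrm_seq_sq_lt`), and there all distances are below ε. No limit, weak compactness or
projection occurs, only induction; so T_B itself proves the sentence, and T_B⁺ does because it has
more axioms.

Derivability is reached semantically: by `derives_of_forall_model`, a sentence that holds in all
models of T_B is derivable. This is a Henkin construction followed by a term model. Terms are
identified when no context of type 0 separates them, and Spector's rule makes the equations of
combinators and recursors identities in this quotient, although full extensionality is not
available.

In an arbitrary model the numbers form a cancellative semiring, possibly nonstandard, with induction
for formulas only. Its ring of differences `Model.Z` is a discretely ordered ring; the signed digit
functions modulo equality of reals form a linearly ordered commutative ring `Model.R`; the space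
modulo equality is a module `Model.V` over it, with a norm that satisfies the parallelogram law.
There the argument above is carried out with denominators cleared, and yields `Model.sat_cauchy`. -/

namespace Browder

/-! ### The substitution calculus -/

/-- Simultaneous substitutions. -/
abbrev Subst (Γ Δ : Ctx) : Type := ∀ τ, Var Γ τ → Tm Δ τ

/-- Renamings are reduced to substitutions, so that a single family of composition laws suffices. -/
theorem Tm.rename_eq_subst {Γ Δ : Ctx} (f : ∀ τ, Var Γ τ → Var Δ τ) {τ : Ty} (t : Tm Γ τ) :
    t.rename f = t.subst fun τ x => .var (f τ x) := by
  induction t with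
  | var x => rfl
  | con c => rfl
  | app t s iht ihs => simp [Tm.rename, Tm.subst, iht, ihs]

theorem Tm.subst_var {Γ : Ctx} {τ : Ty} (t : Tm Γ τ) : t.subst (fun _ x => .var x) = t := by
  induction t with
  | var x => rfl
  | con c => rfl
  | app t s iht ihs => simp [Tm.subst, iht, ihs]

theorem Tm.subst_subst {Γ Δ Θ : Ctx} (f : Subst Γ Δ) (g : Subst Δ Θ) {τ : Ty} (t : Tm Γ τ) :
    (t.subst f).subst g = t.subst fun τ x => (f τ x).subst g := by
  induction t with
  | var x => rfl
  | con c => rfl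
  | app t s iht ihs => simp [Tm.subst, iht, ihs]

theorem Tm.wk_eq_subst {Γ : Ctx} {σ τ : Ty} (t : Tm Γ τ) :
    (t.wk : Tm (σ :: Γ) τ) = t.subst fun _ x => .var (.s x) :=
  t.rename_eq_subst _

theorem Tm.wk_subst {Γ Δ : Ctx} (f : Subst Γ Δ) {σ τ : Ty} (t : Tm Γ τ) :
    (t.wk : Tm (σ :: Γ) τ).subst (Tm.up f) = (t.subst f).wk := by
  simp only [Tm.wk_eq_subst, Tm.subst_subst]
  congr 1
  funext τ x
  simp [Tm.subst, Tm.up, Tm.wk_eq_subst]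

theorem Tm.wk_subst_single {Γ : Ctx} {σ τ : Ty} (t : Tm Γ τ) (s : Tm Γ σ) :
    t.wk.subst s.single = t := by
  rw [Tm.wk_eq_subst, Tm.subst_subst]
  exact t.subst_var

theorem Tm.cl_subst {Γ Δ : Ctx} (f : Subst Γ Δ) {τ : Ty} (t : Tm [] τ) :
    (t.cl : Tm Γ τ).subst f = t.cl := by
  simp only [Tm.cl, Tm.rename_eq_subst, Tm.subst_subst]
  congr 1
  funext τ x
  cases x

theorem Tm.up_subst_up {Γ Δ Θ : Ctx} (f : Subst Γ Δ) (g : Subst Δ Θ) {σ : Ty} :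
    (fun τ (x : Var (σ :: Γ) τ) => (Tm.up f τ x).subst (Tm.up g)) =
      Tm.up fun τ x => (f τ x).subst g := by
  funext τ x
  cases x with
  | z => rfl
  | s x => exact Tm.wk_subst g (f _ x)

theorem Tm.up_var {Γ Δ : Ctx} (f : ∀ τ, Var Γ τ → Var Δ τ) {σ : Ty} :
    Tm.up (σ := σ) (fun τ x => .var (f τ x)) = fun τ x => .var (Var.up f τ x) := by
  funext τ x
  cases x <;> rfl

theorem Fm.rename_eq_subst {Γ : Ctx} (A : Fm Γ) : ∀ {Δ : Ctx} (f : ∀ τ, Var Γ τ → Var Δ τ),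
    A.rename f = A.subst fun τ x => .var (f τ x) := by
  induction A with
  | eq s t => intro Δ f; simp [Fm.rename, Fm.subst, Tm.rename_eq_subst]
  | bot => intro Δ f; rfl
  | and A B ihA ihB => intro Δ f; simp [Fm.rename, Fm.subst, ihA, ihB]
  | or A B ihA ihB => intro Δ f; simp [Fm.rename, Fm.subst, ihA, ihB]
  | imp A B ihA ihB => intro Δ f; simp [Fm.rename, Fm.subst, ihA, ihB]
  | all σ A ih => intro Δ f; simp [Fm.rename, Fm.subst, ih, Tm.up_var]
  | ex σ A ih => intro Δ f; simp [Fm.rename, Fm.subst, ih, Tm.up_var]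

theorem Fm.subst_subst {Γ : Ctx} (A : Fm Γ) : ∀ {Δ Θ : Ctx} (f : Subst Γ Δ) (g : Subst Δ Θ),
    (A.subst f).subst g = A.subst fun τ x => (f τ x).subst g := by
  induction A with
  | eq s t => intro Δ Θ f g; simp [Fm.subst, Tm.subst_subst]
  | bot => intro Δ Θ f g; rfl
  | and A B ihA ihB => intro Δ Θ f g; simp [Fm.subst, ihA, ihB]
  | or A B ihA ihB => intro Δ Θ f g; simp [Fm.subst, ihA, ihB]
  | imp A B ihA ihB => intro Δ Θ f g; simp [Fm.subst, ihA, ihB]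
  | all σ A ih => intro Δ Θ f g; simp [Fm.subst, ih, Tm.up_subst_up]
  | ex σ A ih => intro Δ Θ f g; simp [Fm.subst, ih, Tm.up_subst_up]

theorem Fm.subst_var {Γ : Ctx} (A : Fm Γ) : A.subst (fun _ x => .var x) = A := by
  have h : ∀ (Γ : Ctx) (σ : Ty),
      Tm.up (σ := σ) (fun τ (x : Var Γ τ) => .var x) = fun _ x => .var x := by
    intro Γ σ
    funext τ x
    cases x <;> rfl
  induction A with
  | eq s t => simp [Fm.subst, Tm.subst_var]
  | bot => rfl
  | and A B ihA ihB => simp [Fm.subst, ihA, ihB]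
  | or A B ihA ihB => simp [Fm.subst, ihA, ihB]
  | imp A B ihA ihB => simp [Fm.subst, ihA, ihB]
  | all σ A ih => simp [Fm.subst, h, ih]
  | ex σ A ih => simp [Fm.subst, h, ih]

theorem Fm.wk_eq_subst {Γ : Ctx} {σ : Ty} (A : Fm Γ) :
    (A.wk : Fm (σ :: Γ)) = A.subst fun _ x => .var (.s x) :=
  A.rename_eq_subst _

theorem Fm.wk_subst {Γ Δ : Ctx} (f : Subst Γ Δ) {σ : Ty} (A : Fm Γ) :
    (A.wk : Fm (σ :: Γ)).subst (Tm.up f) = (A.subst f).wk := by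
  simp only [Fm.wk_eq_subst, Fm.subst_subst]
  congr 1
  funext τ x
  simp [Tm.subst, Tm.up, Tm.wk_eq_subst]

theorem Fm.wk_inst {Γ : Ctx} {σ : Ty} (A : Fm Γ) (s : Tm Γ σ) : A.wk.inst s = A := by
  rw [Fm.wk_eq_subst, Fm.inst, Fm.subst_subst]
  exact A.subst_var

/-- The substitution that sends the variable `0` to `t` and the others to their values under
`f`. -/
def Tm.cons {Γ Δ : Ctx} {σ : Ty} (t : Tm Δ σ) (f : Subst Γ Δ) : Subst (σ :: Γ) Δ
  | _, .z => t
  | _, .s x => f _ x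

theorem Tm.up_subst_single {Γ Δ : Ctx} {σ : Ty} (t : Tm Δ σ) (f : Subst Γ Δ) :
    (fun τ (x : Var (σ :: Γ) τ) => (Tm.up f τ x).subst t.single) = Tm.cons t f := by
  funext τ x
  cases x with
  | z => rfl
  | s x => exact Tm.wk_subst_single _ t

theorem Tm.single_subst {Γ Δ : Ctx} {σ : Ty} (t : Tm Γ σ) (f : Subst Γ Δ) :
    (fun τ (x : Var (σ :: Γ) τ) => (Tm.single t τ x).subst f) = Tm.cons (t.subst f) f := by
  funext τ x
  cases x <;> rfl

theorem Fm.up_inst {Γ Δ : Ctx} {σ : Ty} (A : Fm (σ :: Γ)) (t : Tm Δ σ) (f : Subst Γ Δ) :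
    (A.subst (Tm.up f)).inst t = A.subst (Tm.cons t f) := by
  rw [Fm.inst, Fm.subst_subst, Tm.up_subst_single]

theorem Fm.inst_subst {Γ Δ : Ctx} {σ : Ty} (A : Fm (σ :: Γ)) (t : Tm Γ σ) (f : Subst Γ Δ) :
    (A.inst t).subst f = (A.subst (Tm.up f)).inst (t.subst f) := by
  rw [Fm.up_inst, Fm.inst, Fm.subst_subst, Tm.single_subst]

theorem Tm.single_subst_up {Γ Δ : Ctx} {σ τ : Ty} (r : Tm (σ :: Γ) τ) (t : Tm Γ σ) (f : Subst Γ Δ) :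
    (r.subst t.single).subst f = (r.subst (Tm.up f)).subst (t.subst f).single := by
  rw [Tm.subst_subst, Tm.subst_subst, Tm.up_subst_single, Tm.single_subst]

/-- Needed for the induction axiom, whose step formula is formed with `Tm.replace`. -/
theorem Fm.replace_subst {Γ Δ : Ctx} {σ : Ty} (A : Fm (σ :: Γ)) (t : Tm (σ :: Γ) σ)
    (f : Subst Γ Δ) :
    (A.subst t.replace).subst (Tm.up f) =
      (A.subst (Tm.up f)).subst (t.subst (Tm.up f)).replace := by
  rw [Fm.subst_subst, Fm.subst_subst]
  congr 1
  funext τ x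
  cases x with
  | z => rfl
  | s x =>
    simp only [Tm.replace, Tm.subst, Tm.up, Tm.wk_eq_subst, Tm.subst_subst]

/-! ### Substitution in the abbreviations of the language -/

section

variable {Γ Δ : Ctx} (f : Subst Γ Δ)

theorem Tm.subst_app {σ τ : Ty} (t : Tm Γ (σ ⇒ τ)) (s : Tm Γ σ) :
    (t ⬝ s).subst f = t.subst f ⬝ s.subst f := rfl

theorem Tm.subst_con {τ : Ty} (c : Con τ) : (Tm.con c).subst f = .con c := rfl

theorem num_subst (n : ℕ) : (num n).subst f = num n := by
  induction n with
  | zero => rfl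
  | succ n ih => simp only [num, succ, Tm.subst, ih]

theorem QF.subst {A : Fm Γ} (h : QF A) {Δ : Ctx} (f : Subst Γ Δ) : QF (A.subst f) := by
  induction h with
  | eq s t => exact .eq _ _
  | bot => exact .bot
  | and _ _ ihA ihB => exact .and ihA ihB
  | or _ _ ihA ihB => exact .or ihA ihB
  | imp _ _ ihA ihB => exact .imp ihA ihB

theorem le_subst (s t : Tm Γ .nat) : (le s t).subst f = le (s.subst f) (t.subst f) := by
  simp [le, sub, zero, Fm.subst, Tm.subst, Tm.cl_subst]

theorem leR_subst (s t : Tm Γ .one) : (leR s t).subst f = leR (s.subst f) (t.subst f) := by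
  simp [leR, le_subst, posPart, negPart, add, num_subst, Fm.subst, Tm.subst, Tm.cl_subst, Tm.wk_subst,
    Tm.up]

theorem eqR_subst (s t : Tm Γ .one) : (eqR s t).subst f = eqR (s.subst f) (t.subst f) := by
  simp [eqR, le_subst, posPart, negPart, add, num_subst, Fm.subst, Tm.subst, Tm.cl_subst, Tm.wk_subst,
    Tm.up]

theorem dist_subst (s t : Tm Γ .X) : (dist s t).subst f = dist (s.subst f) (t.subst f) := rfl

theorem eqX_subst (s t : Tm Γ .X) : (eqX s t).subst f = eqX (s.subst f) (t.subst f) := by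
  simp [eqX, eqR_subst, dist_subst, natR, zero, Tm.subst, Tm.cl_subst]

end

theorem eqT_subst (τ : Ty) : ∀ {Γ Δ : Ctx} (f : Subst Γ Δ) (s t : Tm Γ τ),
    (eqT τ s t).subst f = eqT τ (s.subst f) (t.subst f) := by
  induction τ with
  | nat => intros; rfl
  | X => intros; exact eqX_subst _ _ _
  | arr σ τ _ ih =>
    intros
    simp [eqT, Fm.subst, ih, Tm.subst, Tm.wk_subst, Tm.up]

/-- True because universal axioms are given by all their instances in all contexts. It makes
derivations stable under substitution, hence under the change of context in the Henkin construction.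
-/
theorem AxTB.subst {Γ Δ : Ctx} {A : Fm Γ} (h : AxTB A) (f : Subst Γ Δ) : AxTB (A.subst f) := by
  cases h <;> simp only [Fm.subst, eqT_subst, eqX_subst, eqR_subst, leR_subst, dist_subst, memC,
    Tm.subst_app, Tm.subst_con,
    num_subst, recur, succ, zero, norm, normalize, addX, subX, negX, zeroX,
    smulX, normSq, mulR, addR, subR, negR, absR, maxR, minR, natR, invSucc, unit, segment, U, u, v₀, b,
    Tm.cl_subst, Fm.inst_subst, Fm.replace_subst]
  case eq_refl => exact .eq_refl _
  case eq_symm => exact .eq_symm _ _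
  case eq_trans => exact .eq_trans _ _ _
  case comb_K => exact .comb_K _ _ _ _
  case comb_S => exact .comb_S _ _ _ _ _ _
  case rec_zero => exact .rec_zero _ _ _
  case rec_succ => exact .rec_succ _ _ _ _
  case succ_ne_zero => exact .succ_ne_zero _
  case succ_inj => exact .succ_inj _ _
  case induction A => exact .induction (A.subst (Tm.up f))
  case norm_real => exact .norm_real _ _
  case add_comm => exact .add_comm _ _
  case add_assoc => exact .add_assoc _ _ _
  case add_zero => exact .add_zero _
  case add_neg => exact .add_neg _
  case one_smul => exact .one_smul _
  case mul_smul => exact .mul_smul _ _ _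
  case add_smul => exact .add_smul _ _ _
  case smul_add => exact .smul_add _ _ _
  case dist_self => exact .dist_self _
  case dist_comm => exact .dist_comm _ _
  case dist_triangle => exact .dist_triangle _ _ _
  case dist_smul => exact .dist_smul _ _ _
  case dist_smul_smul => exact .dist_smul_smul _ _ _
  case dist_add => exact .dist_add _ _ _ _
  case dist_neg => exact .dist_neg _ _
  case norm_sub => exact .norm_sub _ _
  case parallelogram => exact .parallelogram _ _
  case v₀_mem => exact .v₀_mem
  case diam => exact .diam _ _
  case convex => exact .convex _ _ _
  case U_mem => exact .U_mem _
  case U_nonexpansive => exact .U_nonexpansive _ _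
  case u_mem => exact .u_mem _
  case u_fixed => exact .u_fixed _

/-! ### Structural properties of derivations -/

theorem Derives.mono {Ax : ∀ {Γ : Ctx}, Fm Γ → Prop} {Γ : Ctx} {H : List (Fm Γ)} {A : Fm Γ}
    (h : Derives Ax H A) : ∀ {H' : List (Fm Γ)}, H ⊆ H' → Derives Ax H' A := by
  induction h with
  | ax h => intro H' hH; exact .ax h
  | hyp h => intro H' hH; exact .hyp (hH h)
  | by_contra _ ih => intro H' hH; exact .by_contra (ih (List.cons_subset_cons _ hH))
  | and_intro _ _ ihA ihB => intro H' hH; exact .and_intro (ihA hH) (ihB hH)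
  | and_left _ ih => intro H' hH; exact .and_left (ih hH)
  | and_right _ ih => intro H' hH; exact .and_right (ih hH)
  | or_left _ ih => intro H' hH; exact .or_left (ih hH)
  | or_right _ ih => intro H' hH; exact .or_right (ih hH)
  | or_elim _ _ _ ih ihA ihB =>
    intro H' hH
    exact .or_elim (ih hH) (ihA (List.cons_subset_cons _ hH)) (ihB (List.cons_subset_cons _ hH))
  | imp_intro _ ih => intro H' hH; exact .imp_intro (ih (List.cons_subset_cons _ hH))
  | imp_elim _ _ ih ih' => intro H' hH; exact .imp_elim (ih hH) (ih' hH)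
  | all_intro _ ih => intro H' hH; exact .all_intro (ih (List.map_subset _ hH))
  | all_elim t _ ih => intro H' hH; exact .all_elim t (ih hH)
  | ex_intro t _ ih => intro H' hH; exact .ex_intro t (ih hH)
  | ex_elim _ _ ih ih' =>
    intro H' hH
    exact .ex_elim (ih hH) (ih' (List.cons_subset_cons _ (List.map_subset _ hH)))
  | qf_ext s t r hA h _ => intro H' hH; exact .qf_ext s t r hA h

theorem Derives.mono_ax {Ax Ax' : ∀ {Γ : Ctx}, Fm Γ → Prop}
    (hAx : ∀ {Γ : Ctx} {A : Fm Γ}, Ax A → Ax' A) {Γ : Ctx} {H : List (Fm Γ)} {A : Fm Γ}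
    (h : Derives Ax H A) : Derives Ax' H A := by
  induction h with
  | ax h => exact .ax (hAx h)
  | hyp h => exact .hyp h
  | by_contra _ ih => exact .by_contra ih
  | and_intro _ _ ihA ihB => exact .and_intro ihA ihB
  | and_left _ ih => exact .and_left ih
  | and_right _ ih => exact .and_right ih
  | or_left _ ih => exact .or_left ih
  | or_right _ ih => exact .or_right ih
  | or_elim _ _ _ ih ihA ihB => exact .or_elim ih ihA ihB
  | imp_intro _ ih => exact .imp_intro ih
  | imp_elim _ _ ih ih' => exact .imp_elim ih ih'
  | all_intro _ ih => exact .all_intro ih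
  | all_elim t _ ih => exact .all_elim t ih
  | ex_intro t _ ih => exact .ex_intro t ih
  | ex_elim _ _ ih ih' => exact .ex_elim ih ih'
  | qf_ext s t r hA _ ih => exact .qf_ext s t r hA ih

theorem map_wk_map_subst {Γ Δ : Ctx} (f : Subst Γ Δ) {σ : Ty} (H : List (Fm Γ)) :
    (H.map Fm.wk).map (Fm.subst (Tm.up f)) = (H.map (Fm.subst f)).map (Fm.wk (σ := σ)) := by
  simp [List.map_map, Function.comp_def, Fm.wk_subst]

theorem Derives.subst {Ax : ∀ {Γ : Ctx}, Fm Γ → Prop}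
    (hAx : ∀ {Γ Δ : Ctx} {A : Fm Γ} (f : Subst Γ Δ), Ax A → Ax (A.subst f))
    {Γ : Ctx} {H : List (Fm Γ)} {A : Fm Γ} (h : Derives Ax H A) :
    ∀ {Δ : Ctx} (f : Subst Γ Δ), Derives Ax (H.map (Fm.subst f)) (A.subst f) := by
  induction h with
  | ax h => intro Δ f; exact .ax (hAx f h)
  | hyp h => intro Δ f; exact .hyp (List.mem_map_of_mem h)
  | by_contra _ ih => intro Δ f; exact .by_contra (ih f)
  | and_intro _ _ ihA ihB => intro Δ f; exact .and_intro (ihA f) (ihB f)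
  | and_left _ ih => intro Δ f; exact .and_left (ih f)
  | and_right _ ih => intro Δ f; exact .and_right (ih f)
  | or_left _ ih => intro Δ f; exact .or_left (ih f)
  | or_right _ ih => intro Δ f; exact .or_right (ih f)
  | or_elim _ _ _ ih ihA ihB => intro Δ f; exact .or_elim (ih f) (ihA f) (ihB f)
  | imp_intro _ ih => intro Δ f; exact .imp_intro (ih f)
  | imp_elim _ _ ih ih' => intro Δ f; exact .imp_elim (ih f) (ih' f)
  | all_intro _ ih =>
    intro Δ f
    have := ih (Tm.up f)
    rw [map_wk_map_subst] at this
    exact .all_intro this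
  | all_elim t _ ih =>
    intro Δ f
    rw [Fm.inst_subst]
    exact .all_elim _ (ih f)
  | ex_intro t _ ih =>
    intro Δ f
    have := ih f
    rw [Fm.inst_subst] at this
    exact .ex_intro _ this
  | ex_elim _ _ ih ih' =>
    intro Δ f
    have := ih' (Tm.up f)
    rw [List.map_cons, map_wk_map_subst, Fm.wk_subst] at this
    exact .ex_elim (ih f) this
  | qf_ext s t r hA _ ih =>
    intro Δ f
    have := ih f
    simp only [Fm.subst, eqT_subst, Tm.single_subst_up, List.map_nil] at this ⊢
    exact .qf_ext _ _ _ (hA.subst f) this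

/-! ### Countability of the language -/

def Ty.code : Ty → ℕ
  | .nat => Nat.pair 0 0
  | .X => Nat.pair 1 0
  | .arr σ τ => Nat.pair 2 (Nat.pair σ.code τ.code)

theorem Ty.code_injective : Function.Injective Ty.code := by
  intro σ
  induction σ with
  | nat => intro τ h; cases τ <;> simp_all [Ty.code, Nat.pair_eq_pair]
  | X => intro τ h; cases τ <;> simp_all [Ty.code, Nat.pair_eq_pair]
  | arr σ₁ σ₂ ih₁ ih₂ =>
    intro τ h
    cases τ with
    | arr τ₁ τ₂ =>
      simp only [Ty.code, Nat.pair_eq_pair] at h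
      rw [ih₁ h.2.1, ih₂ h.2.2]
    | nat => simp [Ty.code, Nat.pair_eq_pair] at h
    | X => simp [Ty.code, Nat.pair_eq_pair] at h

instance : Countable Ty := Ty.code_injective.countable

/-- An enumeration of the constants by their position in the list and up to three types. -/
def Con.ofCode (σ τ ρ : Ty) : ℕ → Σ τ, Con τ
  | 0 => ⟨_, .K σ τ⟩
  | 1 => ⟨_, .S σ τ ρ⟩
  | 2 => ⟨_, .zero⟩
  | 3 => ⟨_, .succ⟩
  | 4 => ⟨_, .R σ⟩
  | 5 => ⟨_, .zeroX⟩
  | 6 => ⟨_, .addX⟩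
  | 7 => ⟨_, .negX⟩
  | 8 => ⟨_, .smulX⟩
  | 9 => ⟨_, .norm⟩
  | 10 => ⟨_, .v₀⟩
  | 11 => ⟨_, .C⟩
  | 12 => ⟨_, .b⟩
  | 13 => ⟨_, .U⟩
  | _ => ⟨_, .u⟩

instance : Countable (Σ τ, Con τ) := by
  refine Function.Surjective.countable
    (f := fun p : (Ty × Ty × Ty) × ℕ => Con.ofCode p.1.1 p.1.2.1 p.1.2.2 p.2) ?_
  rintro ⟨_, c⟩
  cases c with
  | K σ τ => exact ⟨((σ, τ, τ), 0), rfl⟩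
  | S ρ σ τ => exact ⟨((ρ, σ, τ), 1), rfl⟩
  | zero => exact ⟨((.nat, .nat, .nat), 2), rfl⟩
  | succ => exact ⟨((.nat, .nat, .nat), 3), rfl⟩
  | R ρ => exact ⟨((ρ, ρ, ρ), 4), rfl⟩
  | zeroX => exact ⟨((.nat, .nat, .nat), 5), rfl⟩
  | addX => exact ⟨((.nat, .nat, .nat), 6), rfl⟩
  | negX => exact ⟨((.nat, .nat, .nat), 7), rfl⟩
  | smulX => exact ⟨((.nat, .nat, .nat), 8), rfl⟩
  | norm => exact ⟨((.nat, .nat, .nat), 9), rfl⟩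
  | v₀ => exact ⟨((.nat, .nat, .nat), 10), rfl⟩
  | C => exact ⟨((.nat, .nat, .nat), 11), rfl⟩
  | b => exact ⟨((.nat, .nat, .nat), 12), rfl⟩
  | U => exact ⟨((.nat, .nat, .nat), 13), rfl⟩
  | u => exact ⟨((.nat, .nat, .nat), 14), rfl⟩

noncomputable def Con.code {τ : Ty} (c : Con τ) : ℕ :=
  (exists_injective_nat (Σ τ, Con τ)).choose ⟨τ, c⟩

theorem Con.code_inj {σ τ : Ty} {c : Con σ} {d : Con τ} (h : c.code = d.code) :
    (⟨σ, c⟩ : Σ τ, Con τ) = ⟨τ, d⟩ :=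
  (exists_injective_nat (Σ τ, Con τ)).choose_spec h

def Var.code {Γ : Ctx} {τ : Ty} : Var Γ τ → ℕ
  | .z => 0
  | .s x => x.code + 1

theorem Var.code_inj {Γ : Ctx} {σ : Ty} (x : Var Γ σ) : ∀ {τ : Ty} (y : Var Γ τ),
    x.code = y.code → (⟨σ, x⟩ : Σ τ, Var Γ τ) = ⟨τ, y⟩ := by
  induction x with
  | z =>
    intro τ y h
    cases y with
    | z => rfl
    | s y => simp [Var.code] at h
  | s x ih =>
    intro τ y h
    cases y with
    | z => simp [Var.code] at h
    | s y =>
      have := ih y (by simpa [Var.code] using h)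
      cases this
      rfl

noncomputable def Tm.code {Γ : Ctx} : ∀ {τ : Ty}, Tm Γ τ → ℕ
  | _, .var x => Nat.pair 0 x.code
  | _, .con c => Nat.pair 1 c.code
  | _, .app t s => Nat.pair 2 (Nat.pair t.code s.code)

/-- Types are not part of the code: the head symbol determines them, and the argument type of an
application is recovered from the function. Therefore the conclusion is an equation of dependent
pairs. -/
theorem Tm.code_inj {Γ : Ctx} {σ : Ty} (t : Tm Γ σ) : ∀ {τ : Ty} (s : Tm Γ τ),
    t.code = s.code → (⟨σ, t⟩ : Σ τ, Tm Γ τ) = ⟨τ, s⟩ := by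
  induction t with
  | var x =>
    intro τ s h
    cases s with
    | var y => cases x.code_inj y (Nat.pair_eq_pair.1 h).2; rfl
    | con c => simp [Tm.code, Nat.pair_eq_pair] at h
    | app a b => simp [Tm.code, Nat.pair_eq_pair] at h
  | con c =>
    intro τ s h
    cases s with
    | var y => simp [Tm.code, Nat.pair_eq_pair] at h
    | con d => cases Con.code_inj (Nat.pair_eq_pair.1 h).2; rfl
    | app a b => simp [Tm.code, Nat.pair_eq_pair] at h
  | app a b iha ihb =>
    intro τ s h
    cases s with
    | var y => simp [Tm.code, Nat.pair_eq_pair] at h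
    | con d => simp [Tm.code, Nat.pair_eq_pair] at h
    | app c d =>
      simp only [Tm.code, Nat.pair_eq_pair, true_and] at h
      cases iha c h.1
      cases ihb d h.2
      rfl

noncomputable def Fm.code : ∀ {Γ : Ctx}, Fm Γ → ℕ
  | _, .eq s t => Nat.pair 0 (Nat.pair s.code t.code)
  | _, .bot => Nat.pair 1 0
  | _, .and A B => Nat.pair 2 (Nat.pair A.code B.code)
  | _, .or A B => Nat.pair 3 (Nat.pair A.code B.code)
  | _, .imp A B => Nat.pair 4 (Nat.pair A.code B.code)
  | _, .all σ A => Nat.pair 5 (Nat.pair σ.code A.code)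
  | _, .ex σ A => Nat.pair 6 (Nat.pair σ.code A.code)

theorem Fm.code_injective {Γ : Ctx} : Function.Injective (Fm.code : Fm Γ → ℕ) := by
  intro A
  induction A with
  | eq s t =>
    intro B h
    cases B <;> simp [Fm.code, Nat.pair_eq_pair] at h
    case eq s' t' =>
      cases s.code_inj s' h.1
      cases t.code_inj t' h.2
      rfl
  | bot => intro B h; cases B <;> simp_all [Fm.code, Nat.pair_eq_pair]
  | and A₁ A₂ ih₁ ih₂ =>
    intro B h
    cases B <;> simp [Fm.code, Nat.pair_eq_pair] at h
    rw [ih₁ h.1, ih₂ h.2]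
  | or A₁ A₂ ih₁ ih₂ =>
    intro B h
    cases B <;> simp [Fm.code, Nat.pair_eq_pair] at h
    rw [ih₁ h.1, ih₂ h.2]
  | imp A₁ A₂ ih₁ ih₂ =>
    intro B h
    cases B <;> simp [Fm.code, Nat.pair_eq_pair] at h
    rw [ih₁ h.1, ih₂ h.2]
  | all σ A ih =>
    intro B h
    cases B <;> simp [Fm.code, Nat.pair_eq_pair] at h
    cases Ty.code_injective h.1
    rw [ih h.2]
  | ex σ A ih =>
    intro B h
    cases B <;> simp [Fm.code, Nat.pair_eq_pair] at h
    cases Ty.code_injective h.1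
    rw [ih h.2]

/-- Countability allows all witness requirements to be met in one sequence of stages. -/
instance (Γ : Ctx) : Countable (Fm Γ) := Fm.code_injective.countable

/-! ### Interpretations -/

/-- An interpretation of the types and the constants. -/
structure Interp where
  D : Ty → Type
  app : ∀ {σ τ : Ty}, D (σ ⇒ τ) → D σ → D τ
  con : ∀ {τ : Ty}, Con τ → D τ

/-- Assignments of elements to the variables of a context. -/
abbrev Interp.Env (M : Interp) (Γ : Ctx) : Type := ∀ τ, Var Γ τ → M.D τ

def Interp.Env.cons {M : Interp} {Γ : Ctx} {σ : Ty} (d : M.D σ) (ρ : M.Env Γ) : M.Env (σ :: Γ)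
  | _, .z => d
  | _, .s x => ρ _ x

def Tm.eval {M : Interp} {Γ : Ctx} (ρ : M.Env Γ) : ∀ {τ : Ty}, Tm Γ τ → M.D τ
  | _, .var x => ρ _ x
  | _, .con c => M.con c
  | _, .app t s => M.app (t.eval ρ) (s.eval ρ)

/-- Satisfaction; equality of type 0 is interpreted by equality. -/
def Fm.Sat {M : Interp} : ∀ {Γ : Ctx}, M.Env Γ → Fm Γ → Prop
  | _, ρ, .eq s t => s.eval ρ = t.eval ρ
  | _, _, .bot => False
  | _, ρ, .and A B => A.Sat ρ ∧ B.Sat ρ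
  | _, ρ, .or A B => A.Sat ρ ∨ B.Sat ρ
  | _, ρ, .imp A B => A.Sat ρ → B.Sat ρ
  | _, ρ, .all σ A => ∀ d : M.D σ, A.Sat (.cons d ρ)
  | _, ρ, .ex σ A => ∃ d : M.D σ, A.Sat (.cons d ρ)

/-- The models of `T_B` in which the defining equations of the combinators and of the recursors
hold as equalities. -/
structure Interp.IsModel (M : Interp) : Prop where
  sat : ∀ {Γ : Ctx} {A : Fm Γ} (ρ : M.Env Γ), AxTB A → A.Sat ρ
  app_K : ∀ {σ τ : Ty} (r : M.D σ) (s : M.D τ), M.app (M.app (M.con (.K σ τ)) r) s = r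
  app_S : ∀ {ρ σ τ : Ty} (r : M.D (ρ ⇒ σ ⇒ τ)) (s : M.D (ρ ⇒ σ)) (t : M.D ρ),
    M.app (M.app (M.app (M.con (.S ρ σ τ)) r) s) t = M.app (M.app r t) (M.app s t)
  app_R_zero : ∀ {ρ : Ty} (r : M.D ρ) (s : M.D (ρ ⇒ .nat ⇒ ρ)),
    M.app (M.app (M.app (M.con (.R ρ)) (M.con .zero)) r) s = r
  app_R_succ : ∀ {ρ : Ty} (n : M.D .nat) (r : M.D ρ) (s : M.D (ρ ⇒ .nat ⇒ ρ)),
    M.app (M.app (M.app (M.con (.R ρ)) (M.app (M.con .succ) n)) r) s =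
      M.app (M.app s (M.app (M.app (M.app (M.con (.R ρ)) n) r) s)) n

/-! ### Completeness: the Henkin construction

The construction uses a fixed sequence of contexts, in which variables of each type are added
infinitely often, as witnesses of existential formulas. -/

noncomputable section

instance : Nonempty Ty := ⟨.nat⟩

/-- A stage is read as `pair i (pair j n)`: `i` indexes a type and `j` a formula with a variable of
that type to be witnessed. The entry `n` is padding; it makes the stage at least as late as the
context of the formula. -/
def sortAt (m : ℕ) : Ty := (exists_surjective_nat Ty).choose m.unpair.1

@[reducible] def ctx : ℕ → Ctx
  | 0 => []
  | n + 1 => sortAt n :: ctx n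

/-- The inclusion of contexts. -/
def lft {n m : ℕ} (h : n ≤ m) : Subst (ctx n) (ctx m) := fun τ x =>
  .var (Nat.leRec (motive := fun m _ => Var (ctx n) τ → Var (ctx m) τ) id
    (fun _ _ f x => .s (f x)) h x)

theorem lft_refl (n : ℕ) : lft (le_refl n) = fun _ x => .var x := by
  funext τ x
  simp only [lft, Nat.leRec_self, id]

theorem lft_succ {n m : ℕ} (h : n ≤ m) :
    lft (Nat.le_succ_of_le h) = fun τ x => (lft h τ x).wk := by
  funext τ x
  exact congrArg (fun f : Var (ctx n) τ → Var (ctx (m + 1)) τ => Tm.var (f x))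
    (Nat.leRec_succ (motive := fun m _ => Var (ctx n) τ → Var (ctx m) τ) id
      (fun _ _ f x => .s (f x)) h)

theorem lft_trans {n m k : ℕ} (h : n ≤ m) (h' : m ≤ k) :
    (fun τ x => (lft h τ x).subst (lft h')) = lft (h.trans h') := by
  induction h' with
  | refl => funext τ x; rw [lft_refl, Tm.subst_var]
  | step h' ih =>
    have e := lft_succ (h.trans h')
    simp only [Nat.succ_eq_add_one] at e ⊢
    rw [e, ← ih]
    funext τ x
    rw [lft_succ h', Tm.wk_eq_subst, Tm.subst_subst]
    simp only [Tm.wk_eq_subst]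

def Tm.lift {n m : ℕ} (h : n ≤ m) {τ : Ty} (t : Tm (ctx n) τ) : Tm (ctx m) τ := t.subst (lft h)

def Fm.lift {n m : ℕ} (h : n ≤ m) (A : Fm (ctx n)) : Fm (ctx m) := A.subst (lft h)

theorem Tm.lift_lift {n m k : ℕ} (h : n ≤ m) (h' : m ≤ k) {τ : Ty} (t : Tm (ctx n) τ) :
    (t.lift h).lift h' = t.lift (h.trans h') := by
  rw [Tm.lift, Tm.lift, Tm.subst_subst, lft_trans]; rfl

theorem Fm.lift_lift {n m k : ℕ} (h : n ≤ m) (h' : m ≤ k) (A : Fm (ctx n)) :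
    (A.lift h).lift h' = A.lift (h.trans h') := by
  rw [Fm.lift, Fm.lift, Fm.subst_subst, lft_trans]; rfl

theorem Tm.lift_refl {n : ℕ} {τ : Ty} (t : Tm (ctx n) τ) : t.lift le_rfl = t := by
  rw [Tm.lift, lft_refl, Tm.subst_var]

theorem Fm.lift_refl {n : ℕ} (A : Fm (ctx n)) : A.lift le_rfl = A := by
  rw [Fm.lift, lft_refl, Fm.subst_var]

theorem Fm.lift_succ {n m : ℕ} (h : n ≤ m) (A : Fm (ctx n)) :
    A.lift (Nat.le_succ_of_le h) = ((A.lift h).wk : Fm (sortAt m :: ctx m)) := by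
  rw [Fm.wk_eq_subst, Fm.lift, Fm.lift, Fm.subst_subst, lft_succ h]
  simp only [Tm.wk_eq_subst]

instance (σ : Ty) : Nonempty (Σ n, Fm (σ :: ctx n)) := ⟨⟨0, .bot⟩⟩

/-- The formula for which the variable added to `ctx m` is to be a witness. -/
def task (m : ℕ) : Fm (sortAt m :: ctx m) :=
  let p := (exists_surjective_nat (Σ n, Fm (sortAt m :: ctx n))).choose m.unpair.2.unpair.1
  if h : p.1 ≤ m then p.2.subst (Tm.up (lft h)) else .bot

theorem exists_task (n : ℕ) (σ : Ty) (A : Fm (σ :: ctx n)) : ∃ (m : ℕ) (h : n ≤ m),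
    (⟨σ, A.subst (Tm.up (lft h))⟩ : Σ σ, Fm (σ :: ctx m)) = ⟨sortAt m, task m⟩ := by
  obtain ⟨i, hi⟩ := (exists_surjective_nat Ty).choose_spec σ
  obtain ⟨j, hj⟩ := (exists_surjective_nat (Σ n, Fm (σ :: ctx n))).choose_spec ⟨n, A⟩
  have h : n ≤ Nat.pair i (Nat.pair j n) := (Nat.right_le_pair j n).trans (Nat.right_le_pair i _)
  refine ⟨Nat.pair i (Nat.pair j n), h, ?_⟩
  have hs : sortAt (Nat.pair i (Nat.pair j n)) = σ := by simp [sortAt, hi]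
  clear hi
  subst hs
  have e : (exists_surjective_nat
      (Σ k, Fm (sortAt (Nat.pair i (Nat.pair j n)) :: ctx k))).choose
        (Nat.pair i (Nat.pair j n)).unpair.2.unpair.1 = ⟨n, A⟩ := by simpa using hj
  have : task (Nat.pair i (Nat.pair j n)) = A.subst (Tm.up (lft h)) := by
    have key : ∀ p : Σ k, Fm (sortAt (Nat.pair i (Nat.pair j n)) :: ctx k), p = ⟨n, A⟩ →
        (if h : p.1 ≤ Nat.pair i (Nat.pair j n) then p.2.subst (Tm.up (lft h)) else .bot) =
          A.subst (Tm.up (lft h)) := by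
      rintro _ rfl
      exact dif_pos h
    exact key _ e
  rw [this]

/-- A closed term of each type. -/
def Ty.closedTm : ∀ σ : Ty, Tm [] σ
  | .nat => zero
  | .X => zeroX
  | .arr σ τ => .con (.K τ σ) ⬝ τ.closedTm

theorem Derives.exfalso {Γ : Ctx} {H : List (Fm Γ)} {A : Fm Γ} (h : Derives AxTB H .bot) :
    Derives AxTB H A :=
  .by_contra (h.mono (List.subset_cons_self _ _))

section Henkin

variable (H₀ : List (Fm []))

open Classical in
/-- The hypotheses at stage `n`. -/
def hyps : ∀ n : ℕ, List (Fm (ctx n))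
  | 0 => H₀
  | n + 1 =>
    if Derives AxTB (task n :: (hyps n).map Fm.wk) .bot then (hyps n).map Fm.wk
    else task n :: (hyps n).map Fm.wk

/-- Membership in the limit theory: derivability at some later stage. Each stage adds its witness
formula if this is consistent, and otherwise only a fresh variable. -/
def Holds (n : ℕ) (A : Fm (ctx n)) : Prop :=
  ∃ (m : ℕ) (h : n ≤ m), Derives AxTB (hyps H₀ m) (A.lift h)

variable {H₀}

theorem map_wk_subset_hyps (n : ℕ) : (hyps H₀ n).map Fm.wk ⊆ hyps H₀ (n + 1) := by
  simp only [hyps]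
  split_ifs
  · exact List.Subset.refl _
  · exact List.subset_cons_self _ _

theorem Derives.wk {Γ : Ctx} {σ : Ty} {H : List (Fm Γ)} {A : Fm Γ} (h : Derives AxTB H A) :
    Derives AxTB (H.map Fm.wk) (A.wk : Fm (σ :: Γ)) := by
  have := h.subst (fun f h => h.subst f) (fun _ x => .var (.s (σ := σ) x))
  rw [Fm.wk_eq_subst]
  convert this using 2
  exact funext Fm.wk_eq_subst

theorem Derives.lift {n m : ℕ} (h : n ≤ m) {A : Fm (ctx n)} (hA : Derives AxTB (hyps H₀ n) A) :
    Derives AxTB (hyps H₀ m) (A.lift h) := by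
  induction h with
  | refl => rwa [Fm.lift_refl]
  | step h ih =>
    have := ih.wk.mono (map_wk_subset_hyps (H₀ := H₀) _)
    rwa [← Fm.lift_succ h] at this

theorem Holds.of_derives {n : ℕ} {A : Fm (ctx n)} (h : Derives AxTB (hyps H₀ n) A) :
    Holds H₀ n A :=
  ⟨n, le_rfl, h.lift le_rfl⟩

theorem holds_lift {n m : ℕ} (h : n ≤ m) {A : Fm (ctx n)} :
    Holds H₀ m (A.lift h) ↔ Holds H₀ n A := by
  constructor
  · rintro ⟨k, hk, hA⟩
    exact ⟨k, h.trans hk, by rwa [Fm.lift_lift] at hA⟩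
  · rintro ⟨k, hk, hA⟩
    refine ⟨max k m, le_max_right _ _, ?_⟩
    rw [Fm.lift_lift]
    have := hA.lift (le_max_left k m)
    rwa [Fm.lift_lift] at this

theorem Holds.map {n : ℕ} {A B : Fm (ctx n)}
    (h : ∀ {m : ℕ} (h : n ≤ m), Derives AxTB (hyps H₀ m) (A.lift h) →
      Derives AxTB (hyps H₀ m) (B.lift h)) (hA : Holds H₀ n A) : Holds H₀ n B := by
  obtain ⟨m, hm, hA⟩ := hA
  exact ⟨m, hm, h hm hA⟩

theorem Holds.map₂ {n : ℕ} {A B D : Fm (ctx n)}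
    (h : ∀ {m : ℕ} (h : n ≤ m), Derives AxTB (hyps H₀ m) (A.lift h) →
      Derives AxTB (hyps H₀ m) (B.lift h) → Derives AxTB (hyps H₀ m) (D.lift h))
    (hA : Holds H₀ n A) (hB : Holds H₀ n B) : Holds H₀ n D := by
  obtain ⟨m, hm, hA⟩ := hA
  obtain ⟨k, hk, hB⟩ := hB
  refine ⟨max m k, hm.trans (le_max_left _ _), h _ ?_ ?_⟩
  · simpa only [Fm.lift_lift] using hA.lift (le_max_left m k)
  · simpa only [Fm.lift_lift] using hB.lift (le_max_right m k)

theorem Holds.mp {n : ℕ} {A B : Fm (ctx n)} (h : Holds H₀ n (A ⟶ᶠ B)) (hA : Holds H₀ n A) :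
    Holds H₀ n B :=
  Holds.map₂ (A := A ⟶ᶠ B) (B := A) (D := B) (fun _ h h' => .imp_elim h h') h hA

variable (hc : ¬ Derives AxTB H₀ .bot)

include hc

theorem hyps_consistent : ∀ n, ¬ Derives AxTB (hyps H₀ n) .bot
  | 0 => hc
  | n + 1 => by
    intro h
    simp only [hyps] at h
    split_ifs at h with h'
    -- Nothing was added here except an unused variable. It is generalized and then instantiated by
    -- a closed term, which exists in every type.
    · exact hyps_consistent n (.all_elim (σ := sortAt n) (Ty.closedTm _).cl (.all_intro h))
    · exact h' h

theorem not_holds_bot {n : ℕ} : ¬ Holds H₀ n .bot := fun ⟨m, _, h⟩ => hyps_consistent hc m h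

-- The stage whose task is `A` decides. If `A` of the fresh variable was refutable, existential
-- elimination refutes `∃ A`; otherwise `A` was added and the fresh variable is a witness.
omit hc in
theorem exists_witness_or (n : ℕ) {σ : Ty} (A : Fm (σ :: ctx n)) :
    (∃ (m : ℕ) (h : n ≤ m) (t : Tm (ctx m) σ),
      Derives AxTB (hyps H₀ m) ((A.subst (Tm.up (lft h))).inst t)) ∨
    Holds H₀ n (.ex σ A ⟶ᶠ .bot) := by
  obtain ⟨m, h, e⟩ := exists_task n σ A
  by_cases hd : Derives AxTB (task m :: (hyps H₀ m).map Fm.wk) .bot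
  · right
    refine ⟨m, h, ?_⟩
    rw [Sigma.mk.inj_iff] at e
    obtain ⟨rfl, e⟩ := e
    rw [← eq_of_heq e] at hd
    refine .imp_intro (.ex_elim (.hyp (List.mem_cons_self ..)) (hd.mono ?_))
    exact List.cons_subset_cons _ (List.map_subset _ (List.subset_cons_self _ _))
  · left
    rw [Sigma.mk.inj_iff] at e
    obtain ⟨rfl, e⟩ := e
    refine ⟨m + 1, Nat.le_succ_of_le h, (.var .z : Tm (sortAt m :: ctx m) _), ?_⟩
    rw [Fm.up_inst, lft_succ h]
    have e' : (Tm.cons (.var .z) (fun τ x => (lft h τ x).wk) :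
        Subst (sortAt m :: ctx n) (sortAt m :: ctx m)) = Tm.up (lft h) := by
      funext τ x
      cases x <;> rfl
    refine .hyp ?_
    simp only [hyps, hd, if_false]
    rw [← eq_of_heq e]
    exact List.mem_cons.2 (.inl (congrArg (fun f => Fm.subst f A) e'))

-- Completeness of the limit theory needs no second enumeration: the alternative of
-- `exists_witness_or` is applied to a vacuous quantifier.
omit hc in
theorem holds_or_holds_not {n : ℕ} (A : Fm (ctx n)) :
    Holds H₀ n A ∨ Holds H₀ n (A ⟶ᶠ .bot) := by
  rcases exists_witness_or (H₀ := H₀) n (A.wk : Fm (.nat :: ctx n)) with ⟨m, h, t, hA⟩ | hA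
  · left
    rw [Fm.wk_subst, Fm.wk_inst] at hA
    exact ⟨m, h, hA⟩
  · right
    refine hA.map fun {m} h hd => .imp_intro (.imp_elim (hd.mono (List.subset_cons_self _ _)) ?_)
    refine .ex_intro zero ?_
    rw [Fm.wk_subst, Fm.wk_inst]
    exact .hyp (List.mem_cons_self ..)

omit hc in
theorem holds_and {n : ℕ} {A B : Fm (ctx n)} :
    Holds H₀ n (A ∧ᶠ B) ↔ Holds H₀ n A ∧ Holds H₀ n B :=
  ⟨fun h => ⟨h.map (A := A ∧ᶠ B) (B := A) fun _ h => .and_left h,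
    h.map (A := A ∧ᶠ B) (B := B) fun _ h => .and_right h⟩,
    fun h => Holds.map₂ (fun _ h h' => .and_intro h h') h.1 h.2⟩

omit hc in
theorem holds_imp {n : ℕ} {A B : Fm (ctx n)} :
    Holds H₀ n (A ⟶ᶠ B) ↔ (Holds H₀ n A → Holds H₀ n B) := by
  refine ⟨Holds.mp, fun h => ?_⟩
  rcases holds_or_holds_not (H₀ := H₀) A with hA | hA
  · exact (h hA).map fun _ h => .imp_intro (h.mono (List.subset_cons_self _ _))
  · exact hA.map fun _ h => .imp_intro
      (Derives.exfalso (.imp_elim (h.mono (List.subset_cons_self _ _))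
        (.hyp (List.mem_cons_self ..))))

theorem holds_not {n : ℕ} {A : Fm (ctx n)} : Holds H₀ n (A ⟶ᶠ .bot) ↔ ¬ Holds H₀ n A :=
  holds_imp.trans ⟨fun h h' => not_holds_bot hc (h h'), fun h h' => (h h').elim⟩

omit hc in
theorem holds_or {n : ℕ} {A B : Fm (ctx n)} :
    Holds H₀ n (A ∨ᶠ B) ↔ Holds H₀ n A ∨ Holds H₀ n B := by
  constructor
  · intro h
    rcases holds_or_holds_not (H₀ := H₀) A with hA | hA
    · exact .inl hA
    · refine .inr (Holds.map₂ (fun _ h hA => ?_) h hA)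
      exact .or_elim h (.exfalso (.imp_elim (hA.mono (List.subset_cons_self _ _))
        (.hyp (List.mem_cons_self ..)))) (.hyp (List.mem_cons_self ..))
  · rintro (h | h)
    · exact h.map fun _ h => .or_left h
    · exact h.map fun _ h => .or_right h

theorem holds_ex {n : ℕ} {σ : Ty} {A : Fm (σ :: ctx n)} :
    Holds H₀ n (.ex σ A) ↔ ∃ (m : ℕ) (h : n ≤ m) (t : Tm (ctx m) σ),
      Holds H₀ m (A.subst (Tm.cons t (lft h))) := by
  constructor
  · intro hA
    rcases exists_witness_or (H₀ := H₀) n A with ⟨m, h, t, ht⟩ | h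
    · rw [Fm.up_inst] at ht
      exact ⟨m, h, t, .of_derives ht⟩
    · exact ((holds_not hc).1 h hA).elim
  · rintro ⟨m, h, t, ht⟩
    rw [← Fm.up_inst] at ht
    rw [← holds_lift h]
    refine ht.map fun h' ht => ?_
    rw [Fm.lift, Fm.inst_subst] at ht
    exact .ex_intro _ ht

/-- If `∀ A` fails, its negation holds; classically `∃ ¬A` holds then, and has a witness by
`holds_ex`. -/
theorem holds_all {n : ℕ} {σ : Ty} {A : Fm (σ :: ctx n)} :
    Holds H₀ n (.all σ A) ↔ ∀ (m : ℕ) (h : n ≤ m) (t : Tm (ctx m) σ),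
      Holds H₀ m (A.subst (Tm.cons t (lft h))) := by
  constructor
  · intro hA m h t
    rw [← holds_lift h] at hA
    rw [← Fm.up_inst]
    refine hA.map fun h' hA => ?_
    rw [Fm.lift, Fm.inst_subst]
    exact .all_elim _ hA
  · intro h
    by_contra hA
    rw [← holds_not hc] at hA
    have : Holds H₀ n (.ex σ (A ⟶ᶠ .bot)) := by
      refine hA.map fun h' hA => .by_contra ?_
      refine .imp_elim (hA.mono (List.subset_cons_self _ _)) (.all_intro (.by_contra ?_))
      refine .imp_elim (A := (Fm.ex σ ((A ⟶ᶠ .bot).subst (Tm.up (lft h')))).wk)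
        (.hyp (by simp [Fm.lift, Fm.subst, Fm.wk, Fm.rename])) (.ex_intro x0 ?_)
      rw [Fm.rename_eq_subst, ← Tm.up_var, Fm.up_inst, Fm.subst_subst]
      refine .hyp (List.mem_cons.2 (.inl ?_))
      have e : (fun τ (x : Var (σ :: ctx n) τ) => (Tm.up (lft h') τ x).subst
          (Tm.cons (x0 : Tm (σ :: ctx _) σ) fun τ x => .var (.s x))) = Tm.up (lft h') := by
        funext τ x
        cases x with
        | z => rfl
        | s x => simp only [Tm.up, Tm.wk_eq_subst, Tm.subst_subst]; rfl
      rw [e]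
      rfl
    obtain ⟨m, h', t, ht⟩ := (holds_ex hc).1 this
    exact (holds_not hc).1 ht (h m h' t)

end Henkin

end

/-! ### Completeness: the term model -/

noncomputable section

section TermModel

variable (H₀ : List (Fm []))

abbrev RawTm (τ : Ty) : Type := Σ n, Tm (ctx n) τ

/-- Observational equality: no term of type 0 with a hole distinguishes the two terms. -/
def RawTm.Eqv {τ : Ty} (a b : RawTm τ) : Prop :=
  ∀ (k : ℕ) (ha : a.1 ≤ k) (hb : b.1 ≤ k) (r : Tm (τ :: ctx k) .nat),
    Holds H₀ k (.eq (r.subst (a.2.lift ha).single) (r.subst (b.2.lift hb).single))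

variable {H₀}

theorem holds_eq_refl {n : ℕ} (s : Tm (ctx n) .nat) : Holds H₀ n (.eq s s) :=
  .of_derives (.ax (.eq_refl _))

theorem holds_eq_symm {n : ℕ} {s t : Tm (ctx n) .nat} (h : Holds H₀ n (.eq s t)) :
    Holds H₀ n (.eq t s) :=
  Holds.mp (.of_derives (.ax (.eq_symm _ _))) h

theorem holds_eq_trans {n : ℕ} {r s t : Tm (ctx n) .nat} (h : Holds H₀ n (.eq r s))
    (h' : Holds H₀ n (.eq s t)) : Holds H₀ n (.eq r t) :=
  Holds.mp (Holds.mp (.of_derives (.ax (.eq_trans _ _ _))) h) h'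

theorem RawTm.eqv_equivalence (τ : Ty) : Equivalence (RawTm.Eqv H₀ (τ := τ)) where
  refl a k ha hb r := holds_eq_refl _
  symm h k ha hb r := holds_eq_symm (h k hb ha r)
  trans {a b c} h h' k ha hc r := by
    -- The middle term may belong to a later stage than `k`. The comparison is made at a stage that
    -- contains all three terms and is brought back by `holds_lift`.
    have hk := le_max_left k b.1
    rw [← holds_lift hk]
    have h₁ := h (max k b.1) (ha.trans hk) (le_max_right _ _) (r.subst (Tm.up (lft hk)))
    have h₂ := h' (max k b.1) (le_max_right _ _) (hc.trans hk) (r.subst (Tm.up (lft hk)))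
    simp only [Fm.lift, Fm.subst, Tm.single_subst_up]
    have e := holds_eq_trans h₁ h₂
    rw [← Tm.lift_lift ha hk, ← Tm.lift_lift hc hk] at e
    exact e

variable (H₀) in
def TermD (τ : Ty) : Type := Quotient ⟨RawTm.Eqv H₀, RawTm.eqv_equivalence τ⟩

variable (H₀) in
def cls {τ : Ty} (n : ℕ) (t : Tm (ctx n) τ) : TermD H₀ τ := Quotient.mk _ ⟨n, t⟩

theorem cls_eq {τ : Ty} {n m : ℕ} {s : Tm (ctx n) τ} {t : Tm (ctx m) τ} :
    cls H₀ n s = cls H₀ m t ↔ RawTm.Eqv H₀ ⟨n, s⟩ ⟨m, t⟩ :=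
  Quotient.eq

theorem cls_lift {τ : Ty} {n m : ℕ} (h : n ≤ m) (t : Tm (ctx n) τ) :
    cls H₀ m (t.lift h) = cls H₀ n t := by
  rw [cls_eq]
  intro k ha hb r
  simp only [Tm.lift_lift]
  exact holds_eq_refl _

/-- A context around an application is also a context around its function part. With the companion
for the argument, this shows that application respects observational equality. -/
theorem subst_hole_left {Γ : Ctx} {σ τ : Ty} (r : Tm (τ :: Γ) .nat) (f : Tm Γ (σ ⇒ τ))
    (s : Tm Γ σ) : r.subst (f ⬝ s).single =
      (r.subst (Tm.cons ((x0 : Tm ((σ ⇒ τ) :: Γ) _) ⬝ s.wk) fun _ x => .var (.s x))).subst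
        f.single := by
  rw [Tm.subst_subst]
  congr 1
  funext τ x
  cases x with
  | z => simp [Tm.cons, Tm.subst, Tm.single, Tm.wk_subst_single]
  | s x => rfl

theorem subst_hole_right {Γ : Ctx} {σ τ : Ty} (r : Tm (τ :: Γ) .nat) (f : Tm Γ (σ ⇒ τ))
    (s : Tm Γ σ) : r.subst (f ⬝ s).single =
      (r.subst (Tm.cons (f.wk ⬝ (x0 : Tm (σ :: Γ) _)) fun _ x => .var (.s x))).subst
        s.single := by
  rw [Tm.subst_subst]
  congr 1
  funext τ x
  cases x with
  | z => simp [Tm.cons, Tm.subst, Tm.single, Tm.wk_subst_single]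
  | s x => rfl

def TermD.app {σ τ : Ty} : TermD H₀ (σ ⇒ τ) → TermD H₀ σ → TermD H₀ τ :=
  Quotient.map₂ (fun f a => (⟨max f.1 a.1,
      f.2.lift (le_max_left _ _) ⬝ a.2.lift (le_max_right _ _)⟩ : RawTm τ)) <| by
    intro f g hfg a b hab
    -- At a common stage one argument is exchanged at a time: `f a`, then `g a`, then `g b`.
    have key : ∀ (k : ℕ) (f g : Tm (ctx k) (σ ⇒ τ)) (a b : Tm (ctx k) σ),
        RawTm.Eqv H₀ ⟨k, f⟩ ⟨k, g⟩ → RawTm.Eqv H₀ ⟨k, a⟩ ⟨k, b⟩ →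
        RawTm.Eqv H₀ ⟨k, f ⬝ a⟩ ⟨k, g ⬝ b⟩ := by
      intro k f g a b hf ha l h₁ h₂ r
      have e₁ := hf l h₁ h₁ (r.subst (Tm.cons (x0 ⬝ (a.lift h₁).wk) fun _ x => .var (.s x)))
      have e₂ := ha l h₁ h₁ (r.subst (Tm.cons ((g.lift h₁).wk ⬝ x0) fun _ x => .var (.s x)))
      rw [← subst_hole_left, ← subst_hole_left] at e₁
      rw [← subst_hole_right, ← subst_hole_right] at e₂
      exact holds_eq_trans e₁ e₂
    have reEqv : ∀ {ρ : Ty} (x y : RawTm ρ) (k : ℕ) (hx : x.1 ≤ k) (hy : y.1 ≤ k),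
        RawTm.Eqv H₀ x y → RawTm.Eqv H₀ ⟨k, x.2.lift hx⟩ ⟨k, y.2.lift hy⟩ := by
      intro ρ x y k hx hy h
      rw [← cls_eq, cls_lift, cls_lift, cls_eq]
      exact h
    have hk₁ : max f.1 a.1 ≤ max (max f.1 a.1) (max g.1 b.1) := le_max_left _ _
    have hk₂ : max g.1 b.1 ≤ max (max f.1 a.1) (max g.1 b.1) := le_max_right _ _
    have h := key _ _ _ _ _
      (reEqv f g _ ((le_max_left _ _).trans hk₁) ((le_max_left _ _).trans hk₂) hfg)
      (reEqv a b _ ((le_max_right _ _).trans hk₁) ((le_max_right _ _).trans hk₂) hab)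
    simp only [← Tm.lift_lift (le_max_left f.1 a.1) hk₁, ← Tm.lift_lift (le_max_left g.1 b.1) hk₂,
      ← Tm.lift_lift (le_max_right f.1 a.1) hk₁, ← Tm.lift_lift (le_max_right g.1 b.1) hk₂] at h
    rw [← cls_eq] at h
    refine Quotient.exact ?_
    refine Eq.trans ?_ (h.trans ?_)
    · exact (cls_lift hk₁ (f.2.lift (le_max_left _ _) ⬝ a.2.lift (le_max_right _ _))).symm
    · exact cls_lift hk₂ (g.2.lift (le_max_left _ _) ⬝ b.2.lift (le_max_right _ _))

theorem cls_app {σ τ : Ty} {n : ℕ} (f : Tm (ctx n) (σ ⇒ τ)) (a : Tm (ctx n) σ) :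
    TermD.app (cls H₀ n f) (cls H₀ n a) = cls H₀ n (f ⬝ a) := by
  rw [← cls_lift (le_max_left n n) (f ⬝ a)]
  rfl

variable (H₀) in
def termModel : Interp where
  D := TermD H₀
  app := TermD.app
  con c := cls H₀ 0 (.con c)

theorem exists_cls {τ : Ty} (d : TermD H₀ τ) : ∃ n t, d = cls H₀ n t := by
  obtain ⟨⟨n, t⟩, rfl⟩ := Quotient.exists_rep d
  exact ⟨n, t, rfl⟩

def Subst.nil {Δ : Ctx} : Subst [] Δ := fun _ x => by cases x

variable (H₀) in
/-- The assignment given by terms of stage `n`. -/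
def clsEnv {Γ : Ctx} (n : ℕ) (f : Subst Γ (ctx n)) : (termModel H₀).Env Γ :=
  fun τ x => cls H₀ n (f τ x)

theorem clsEnv_cons {Γ : Ctx} {σ : Ty} {n : ℕ} (f : Subst Γ (ctx n)) {m : ℕ} (h : n ≤ m)
    (t : Tm (ctx m) σ) : (Interp.Env.cons (cls H₀ m t) (clsEnv H₀ n f) : (termModel H₀).Env _) =
      clsEnv H₀ m (Tm.cons t fun τ x => (f τ x).lift h) := by
  funext τ x
  cases x with
  | z => rfl
  | s x => exact (cls_lift h _).symm

theorem exists_clsEnv : ∀ {Γ : Ctx} (ρ : (termModel H₀).Env Γ), ∃ n f, ρ = clsEnv H₀ n f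
  | [], ρ => ⟨0, Subst.nil, by funext τ x; cases x⟩
  | σ :: Γ, ρ => by
    obtain ⟨n, f, hf⟩ := exists_clsEnv fun τ x => ρ τ (.s x)
    obtain ⟨m, t, ht⟩ := exists_cls (ρ σ .z)
    refine ⟨max n m, Tm.cons (t.lift (le_max_right _ _)) fun τ x => (f τ x).lift (le_max_left _ _),
      ?_⟩
    rw [← clsEnv_cons, ← hf, cls_lift, ← ht]
    funext τ x
    cases x <;> rfl

theorem eval_clsEnv {Γ : Ctx} {n : ℕ} (f : Subst Γ (ctx n)) {τ : Ty} (t : Tm Γ τ) :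
    t.eval (clsEnv H₀ n f) = cls H₀ n (t.subst f) := by
  induction t with
  | var x => rfl
  | con c => exact (cls_lift (Nat.zero_le n) (.con c)).symm
  | app s t ihs iht =>
    simp only [Tm.eval, ihs, iht]
    exact cls_app _ _

/-- The premise of the extensionality rule must be a theorem, so the equation has to be derivable
without the Henkin hypotheses. This is the case for the defining equations of combinators and
recursors. -/
theorem cls_eq_of_derives {τ : Ty} {n : ℕ} {s t : Tm (ctx n) τ}
    (h : Derives AxTB [] (eqT τ s t)) : cls H₀ n s = cls H₀ n t := by
  rw [cls_eq]
  intro k ha hb r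
  -- The equation `0 = 0` plays the part of the quantifier-free antecedent of the rule.
  refine .of_derives (.imp_elim (A := .eq zero zero) ?_ (.ax (.eq_refl _)))
  refine Derives.qf_ext (τ := .nat) _ _ r (.eq _ _) (.imp_intro ?_)
  have := h.subst (fun f h => h.subst f) (lft ha)
  rw [eqT_subst] at this
  exact this.mono (List.nil_subset _)

/-- At type 0 the equation is itself quantifier-free and can be the antecedent of the rule, with the
theorem `s = t → s = t` as premise. So even an equation that depends on the hypotheses is preserved
by all contexts. -/
theorem cls_nat_eq {n : ℕ} {s t : Tm (ctx n) .nat} :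
    cls H₀ n s = cls H₀ n t ↔ Holds H₀ n (.eq s t) := by
  rw [cls_eq]
  constructor
  · intro h
    have := h n le_rfl le_rfl x0
    simpa [Tm.subst, Tm.single, Tm.lift_refl] using this
  · intro h k ha hb r
    rw [← holds_lift ha] at h
    exact Holds.mp (A := (Fm.eq s t).lift ha) (.of_derives
      (Derives.qf_ext (ρ := .nat) (τ := .nat) _ _ r (.eq _ _)
      (.imp_intro (.hyp (List.mem_cons_self ..))))) h

/-- The truth lemma. Elements of the model are classes of terms of arbitrary stages, which is
exactly the range of the quantifiers in `holds_all` and `holds_ex`. -/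
theorem sat_clsEnv (hc : ¬ Derives AxTB H₀ .bot) {Γ : Ctx} (A : Fm Γ) :
    ∀ {n : ℕ} (f : Subst Γ (ctx n)), A.Sat (clsEnv H₀ n f) ↔ Holds H₀ n (A.subst f) := by
  have hcons : ∀ {Γ : Ctx} {σ : Ty} {n m : ℕ} (h : n ≤ m) (f : Subst Γ (ctx n)) (t : Tm (ctx m) σ)
      (A : Fm (σ :: Γ)), (A.subst (Tm.up f)).subst (Tm.cons t (lft h)) =
        A.subst (Tm.cons t fun τ x => (f τ x).lift h) := by
    intro Γ σ n m h f t A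
    rw [Fm.subst_subst]
    congr 1
    funext τ x
    cases x with
    | z => rfl
    | s x => simp only [Tm.up, Tm.wk_eq_subst, Tm.subst_subst]; rfl
  induction A with
  | eq s t =>
    intro n f
    simp only [Fm.Sat, eval_clsEnv]
    exact cls_nat_eq
  | bot => intro n f; exact ⟨False.elim, not_holds_bot hc⟩
  | and A B ihA ihB => intro n f; exact (and_congr (ihA f) (ihB f)).trans holds_and.symm
  | or A B ihA ihB => intro n f; exact (or_congr (ihA f) (ihB f)).trans holds_or.symm
  | imp A B ihA ihB => intro n f; exact (imp_congr (ihA f) (ihB f)).trans holds_imp.symm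
  | all σ A ih =>
    intro n f
    simp only [Fm.subst]
    rw [holds_all hc]
    simp only [hcons]
    constructor
    · intro h m hm t
      rw [← ih, ← clsEnv_cons]
      exact h _
    · intro h d
      obtain ⟨m, t, rfl⟩ := exists_cls d
      rw [← cls_lift (le_max_right n m), clsEnv_cons f (le_max_left n m), ih]
      exact h _ _ _
  | ex σ A ih =>
    intro n f
    simp only [Fm.subst]
    rw [holds_ex hc]
    simp only [hcons]
    constructor
    · rintro ⟨d, h⟩
      obtain ⟨m, t, rfl⟩ := exists_cls d
      rw [← cls_lift (le_max_right n m), clsEnv_cons f (le_max_left n m), ih] at h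
      exact ⟨max n m, le_max_left n m, t.lift (le_max_right n m), h⟩
    · rintro ⟨m, hm, t, h⟩
      rw [← ih, ← clsEnv_cons] at h
      exact ⟨_, h⟩

theorem eval_eq_of_ax {Γ : Ctx} {τ : Ty} {s t : Tm Γ τ} (h : AxTB (eqT τ s t))
    (ρ : (termModel H₀).Env Γ) : s.eval ρ = t.eval ρ := by
  obtain ⟨n, f, rfl⟩ := exists_clsEnv ρ
  rw [eval_clsEnv, eval_clsEnv]
  have := h.subst f
  rw [eqT_subst] at this
  exact cls_eq_of_derives (.ax this)

def Interp.Env.nil {M : Interp} : M.Env [] := fun _ x => by cases x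

theorem termModel_isModel (hc : ¬ Derives AxTB H₀ .bot) : (termModel H₀).IsModel where
  sat ρ h := by
    obtain ⟨n, f, rfl⟩ := exists_clsEnv ρ
    rw [sat_clsEnv hc]
    exact .of_derives (.ax (h.subst f))
  app_K {σ τ} r s :=
    eval_eq_of_ax (Γ := [σ, τ]) (.comb_K σ τ x0 x1) (.cons r (.cons s .nil))
  app_S {ρ σ τ} r s t :=
    eval_eq_of_ax (Γ := [ρ ⇒ σ ⇒ τ, ρ ⇒ σ, ρ]) (.comb_S ρ σ τ x0 x1 x2)
      (.cons r (.cons s (.cons t .nil)))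
  app_R_zero {ρ} r s :=
    eval_eq_of_ax (Γ := [ρ, ρ ⇒ .nat ⇒ ρ]) (.rec_zero ρ x0 x1) (.cons r (.cons s .nil))
  app_R_succ {ρ} n r s :=
    eval_eq_of_ax (Γ := [.nat, ρ, ρ ⇒ .nat ⇒ ρ]) (.rec_succ ρ x0 x1 x2)
      (.cons n (.cons r (.cons s .nil)))

end TermModel

/-- Completeness of `T_B` for its models. -/
theorem derives_of_forall_model (A : Fm [])
    (h : ∀ M : Interp, M.IsModel → A.Sat (.nil : M.Env [])) : Derives AxTB [] A := by
  by_contra hA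
  have hc : ¬ Derives AxTB [A ⟶ᶠ .bot] .bot := fun hd => hA (.by_contra hd)
  have hs := h _ (termModel_isModel hc)
  have e : (Interp.Env.nil : (termModel [A ⟶ᶠ .bot]).Env []) =
      clsEnv [A ⟶ᶠ .bot] 0 fun _ x => .var x := by
    funext τ x
    cases x
  rw [e, sat_clsEnv hc, Fm.subst_var] at hs
  exact (holds_not hc).1 (.of_derives (.hyp (List.mem_cons_self ..))) hs

end

/-! ### Evaluation of terms and formulas -/

section Evaluation

variable {M : Interp} {Γ Δ : Ctx}

@[simp] theorem Tm.eval_var {τ : Ty} (ρ : M.Env Γ) (x : Var Γ τ) :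
    (Tm.var x).eval ρ = ρ τ x := rfl

@[simp] theorem Tm.eval_app {σ τ : Ty} (ρ : M.Env Γ) (t : Tm Γ (σ ⇒ τ)) (s : Tm Γ σ) :
    (t ⬝ s).eval ρ = M.app (t.eval ρ) (s.eval ρ) := rfl

@[simp] theorem Interp.Env.cons_z {σ : Ty} (d : M.D σ) (ρ : M.Env Γ) :
    Interp.Env.cons d ρ σ .z = d := rfl

@[simp] theorem Interp.Env.cons_s {σ τ : Ty} (d : M.D σ) (ρ : M.Env Γ) (x : Var Γ τ) :
    Interp.Env.cons d ρ τ (.s x) = ρ τ x := rfl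

theorem Tm.eval_subst (f : Subst Γ Δ) (ρ : M.Env Δ) {τ : Ty} (t : Tm Γ τ) :
    (t.subst f).eval ρ = t.eval fun τ x => (f τ x).eval ρ := by
  induction t with
  | var x => rfl
  | con c => rfl
  | app s t ihs iht => simp [Tm.subst, ihs, iht]

@[simp] theorem Tm.eval_wk {σ τ : Ty} (d : M.D σ) (ρ : M.Env Γ) (t : Tm Γ τ) :
    t.wk.eval (.cons d ρ) = t.eval ρ := by
  rw [Tm.wk_eq_subst, Tm.eval_subst]
  rfl

@[simp] theorem Tm.eval_cl {τ : Ty} (ρ : M.Env Γ) (t : Tm [] τ) : t.cl.eval ρ = t.eval .nil := by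
  rw [Tm.cl, Tm.rename_eq_subst, Tm.eval_subst]
  congr 1
  funext τ x
  cases x

theorem Interp.Env.cons_up {σ : Ty} (f : Subst Γ Δ) (ρ : M.Env Δ) (d : M.D σ) :
    (fun τ (x : Var (σ :: Γ) τ) => (Tm.up f τ x).eval (Interp.Env.cons d ρ)) =
      Interp.Env.cons d fun τ x => (f τ x).eval ρ := by
  funext τ x
  cases x with
  | z => rfl
  | s x => exact Tm.eval_wk d ρ _

theorem Fm.sat_subst (A : Fm Γ) : ∀ {Δ : Ctx} (f : Subst Γ Δ) (ρ : M.Env Δ),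
    (A.subst f).Sat ρ ↔ A.Sat fun τ x => (f τ x).eval ρ := by
  induction A with
  | eq s t => intro Δ f ρ; simp [Fm.subst, Fm.Sat, Tm.eval_subst]
  | bot => intro Δ f ρ; rfl
  | and A B ihA ihB => intro Δ f ρ; exact and_congr (ihA f ρ) (ihB f ρ)
  | or A B ihA ihB => intro Δ f ρ; exact or_congr (ihA f ρ) (ihB f ρ)
  | imp A B ihA ihB => intro Δ f ρ; exact imp_congr (ihA f ρ) (ihB f ρ)
  | all σ A ih =>
    intro Δ f ρ
    simp only [Fm.subst, Fm.Sat, ih, Interp.Env.cons_up]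
  | ex σ A ih =>
    intro Δ f ρ
    simp only [Fm.subst, Fm.Sat, ih, Interp.Env.cons_up]

@[simp] theorem Fm.sat_eq (ρ : M.Env Γ) (s t : Tm Γ .nat) :
    (Fm.eq s t).Sat ρ ↔ s.eval ρ = t.eval ρ := Iff.rfl

@[simp] theorem Fm.sat_and (ρ : M.Env Γ) (A B : Fm Γ) :
    (A ∧ᶠ B).Sat ρ ↔ A.Sat ρ ∧ B.Sat ρ := Iff.rfl

@[simp] theorem Fm.sat_or (ρ : M.Env Γ) (A B : Fm Γ) :
    (A ∨ᶠ B).Sat ρ ↔ A.Sat ρ ∨ B.Sat ρ := Iff.rfl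

@[simp] theorem Fm.sat_imp (ρ : M.Env Γ) (A B : Fm Γ) :
    (A ⟶ᶠ B).Sat ρ ↔ (A.Sat ρ → B.Sat ρ) := Iff.rfl

@[simp] theorem Fm.sat_all {σ : Ty} (ρ : M.Env Γ) (A : Fm (σ :: Γ)) :
    (Fm.all σ A).Sat ρ ↔ ∀ d : M.D σ, A.Sat (.cons d ρ) := Iff.rfl

@[simp] theorem Fm.sat_ex {σ : Ty} (ρ : M.Env Γ) (A : Fm (σ :: Γ)) :
    (Fm.ex σ A).Sat ρ ↔ ∃ d : M.D σ, A.Sat (.cons d ρ) := Iff.rfl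

end Evaluation

/-- A model of `T_B`. -/
structure Model extends Interp where
  isModel : toInterp.IsModel

namespace Model

variable {M : Model} {Γ : Ctx}

-- Beta conversion is an identity of elements, as the combinator equations hold in a model as
-- equalities at all types. Every closed term of the language can thus be computed in the model.
@[simp] theorem app_lam {σ τ : Ty} (ρ : M.Env Γ) (t : Tm (σ :: Γ) τ) (d : M.D σ) :
    M.app ((lam t).eval ρ) d = t.eval (.cons d ρ) := by
  induction t with
  | var x =>
    cases x with
    | z => exact (M.isModel.app_S _ _ _).trans (M.isModel.app_K _ _)
    | s x => exact M.isModel.app_K _ _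
  | con c => exact M.isModel.app_K _ _
  | app s t ihs iht =>
    simp only [lam, Tm.eval_app]
    refine (M.isModel.app_S _ _ _).trans ?_
    rw [ihs, iht]

/-! ### Natural numbers of the model -/

def S (n : M.D .nat) : M.D .nat := M.app (M.con .succ) n

instance : Zero (M.D .nat) := ⟨M.con .zero⟩
instance : One (M.D .nat) := ⟨S 0⟩
instance : Add (M.D .nat) := ⟨fun m n => M.app (M.app (addTm.eval .nil) m) n⟩
instance : Mul (M.D .nat) := ⟨fun m n => M.app (M.app (mulTm.eval .nil) m) n⟩
instance : Sub (M.D .nat) := ⟨fun m n => M.app (M.app (subTm.eval .nil) m) n⟩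

def pre (n : M.D .nat) : M.D .nat := M.app (predTm.eval .nil) n
def pow (n : M.D .nat) : M.D .nat := M.app (powTm.eval .nil) n
def quo (m n : M.D .nat) : M.D .nat := M.app (M.app (divTm.eval .nil) m) n
def recN {ρ : Ty} (n : M.D .nat) (a : M.D ρ) (f : M.D (ρ ⇒ .nat ⇒ ρ)) : M.D ρ :=
  M.app (M.app (M.app (M.con (.R ρ)) n) a) f

section

variable (ρ : M.Env Γ)

@[simp] theorem eval_zero : zero.eval ρ = 0 := rfl
@[simp] theorem eval_succ (n : Tm Γ .nat) : (succ n).eval ρ = S (n.eval ρ) := rfl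
@[simp] theorem eval_add (m n : Tm Γ .nat) : (m ⊹ n).eval ρ = m.eval ρ + n.eval ρ := by
  simp only [add, Tm.eval_app, Tm.eval_cl]; rfl
@[simp] theorem eval_mul (m n : Tm Γ .nat) : (m ⊠ n).eval ρ = m.eval ρ * n.eval ρ := by
  simp only [mul, Tm.eval_app, Tm.eval_cl]; rfl
@[simp] theorem eval_sub (m n : Tm Γ .nat) : (m ∸ n).eval ρ = m.eval ρ - n.eval ρ := by
  simp only [sub, Tm.eval_app, Tm.eval_cl]; rfl
@[simp] theorem eval_pred (m : Tm Γ .nat) : (pred m).eval ρ = pre (m.eval ρ) := by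
  simp only [pred, Tm.eval_app, Tm.eval_cl]; rfl
@[simp] theorem eval_pow2 (m : Tm Γ .nat) : (pow2 m).eval ρ = pow (m.eval ρ) := by
  simp only [pow2, Tm.eval_app, Tm.eval_cl]; rfl
@[simp] theorem eval_quot (m n : Tm Γ .nat) : (quot m n).eval ρ = quo (m.eval ρ) (n.eval ρ) := by
  simp only [quot, Tm.eval_app, Tm.eval_cl]; rfl
@[simp] theorem eval_recur {σ : Ty} (n : Tm Γ .nat) (a : Tm Γ σ) (f : Tm Γ (σ ⇒ .nat ⇒ σ)) :
    (recur n a f).eval ρ = recN (n.eval ρ) (a.eval ρ) (f.eval ρ) := rfl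

@[simp] theorem recN_zero {σ : Ty} (a : M.D σ) (f : M.D (σ ⇒ .nat ⇒ σ)) : recN 0 a f = a :=
  M.isModel.app_R_zero _ _

@[simp] theorem recN_S {σ : Ty} (n : M.D .nat) (a : M.D σ) (f : M.D (σ ⇒ .nat ⇒ σ)) :
    recN (S n) a f = M.app (M.app f (recN n a f)) n :=
  M.isModel.app_R_succ _ _ _

end

/-- The numbers of the model may be nonstandard, so every property proved by induction has to be
written as a formula, with its parameters in the assignment. This explains the formulas at the head
of the later induction proofs. -/
theorem induction (A : Fm (.nat :: Γ)) (ρ : M.Env Γ) (h₀ : A.Sat (.cons 0 ρ))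
    (hs : ∀ n : M.D .nat, A.Sat (.cons n ρ) → A.Sat (.cons (S n) ρ)) (n : M.D .nat) :
    A.Sat (.cons n ρ) := by
  refine M.isModel.sat ρ (.induction A) ⟨?_, fun n hn => ?_⟩ n
  · rw [Fm.inst, Fm.sat_subst]
    convert h₀ using 1
    funext τ x
    cases x <;> rfl
  · rw [Fm.sat_subst]
    convert hs n hn using 1
    funext τ x
    cases x <;> rfl

/-- Models are not assumed extensional. This compares two recursions through the values of their
step functions, as is needed when one step term is evaluated in two assignments. -/
theorem recN_congr {a : M.D .nat} {f g : M.D (.nat ⇒ .nat ⇒ .nat)}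
    (h : ∀ x k : M.D .nat, M.app (M.app f x) k = M.app (M.app g x) k) (n : M.D .nat) :
    recN n a f = recN n a g := by
  have := induction (.eq (recur x0 x1 x2) (recur x0 x1 x3)) (.cons a (.cons f (.cons g .nil)))
  simp at this
  exact this (fun n hn => by rw [hn, h]) n

theorem S_ne_zero (n : M.D .nat) : S n ≠ 0 := fun h =>
  M.isModel.sat (Γ := [.nat]) (.cons n .nil) (.succ_ne_zero x0) h

theorem S_inj {m n : M.D .nat} (h : S m = S n) : m = n :=
  M.isModel.sat (Γ := [.nat, .nat]) (.cons m (.cons n .nil)) (.succ_inj x0 x1) h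

theorem add_def (m n : M.D .nat) : m + n = M.app (M.app (addTm.eval .nil) m) n := rfl
theorem mul_def (m n : M.D .nat) : m * n = M.app (M.app (mulTm.eval .nil) m) n := rfl
theorem sub_def (m n : M.D .nat) : m - n = M.app (M.app (subTm.eval .nil) m) n := rfl

protected theorem add_zero (m : M.D .nat) : m + 0 = m := by simp [add_def, addTm]
theorem add_S (m n : M.D .nat) : m + S n = S (m + n) := by
  simp [add_def, addTm]
  exact congrArg S (recN_congr (by simp) n)
protected theorem mul_zero (m : M.D .nat) : m * 0 = 0 := by simp [mul_def, mulTm]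
theorem mul_S (m n : M.D .nat) : m * S n = m * n + m := by
  simp [mul_def, mulTm]
  exact congrArg (· + m) (recN_congr (by simp) n)
theorem pre_zero : pre (0 : M.D .nat) = 0 := by simp [pre, predTm]
theorem pre_S (m : M.D .nat) : pre (S m) = m := by simp [pre, predTm]
protected theorem sub_zero (m : M.D .nat) : m - 0 = m := by simp [sub_def, subTm]
theorem sub_S (m n : M.D .nat) : m - S n = pre (m - n) := by
  simp [sub_def, subTm]
  exact congrArg pre (recN_congr (by simp) n)

protected theorem zero_add (n : M.D .nat) : 0 + n = n := by
  have := induction (M := M) (.eq (zero ⊹ x0) x0) .nil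
  simp only [Fm.sat_eq, eval_add, eval_zero, Tm.eval_var, Interp.Env.cons_z] at this
  exact this (Model.add_zero 0) (fun n hn => by rw [add_S, hn]) n

theorem S_add (m n : M.D .nat) : S m + n = S (m + n) := by
  have := induction (.eq (succ x1 ⊹ x0) (succ (x1 ⊹ x0))) (.cons m .nil)
  simp at this
  exact this (by simp [Model.add_zero]) (fun n hn => by rw [add_S, hn, add_S]) n

protected theorem add_comm (m n : M.D .nat) : m + n = n + m := by
  have := induction (.eq (x1 ⊹ x0) (x0 ⊹ x1)) (.cons m .nil)
  simp at this
  exact this (by simp [Model.add_zero, Model.zero_add]) (fun n hn => by rw [add_S, hn, S_add]) n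

protected theorem add_assoc (m n k : M.D .nat) : m + n + k = m + (n + k) := by
  have := induction (.eq (x1 ⊹ x2 ⊹ x0) (x1 ⊹ (x2 ⊹ x0))) (.cons m (.cons n .nil))
  simp at this
  exact this (by simp [Model.add_zero]) (fun k hk => by simp only [add_S, hk]) k

protected theorem zero_mul (n : M.D .nat) : 0 * n = 0 := by
  have := induction (M := M) (.eq (zero ⊠ x0) zero) .nil
  simp at this
  exact this (Model.mul_zero 0) (fun n hn => by rw [mul_S, hn, Model.add_zero]) n

instance : AddCommMonoid (M.D .nat) where
  add_assoc := Model.add_assoc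
  zero_add := Model.zero_add
  add_zero := Model.add_zero
  add_comm := Model.add_comm
  nsmul := nsmulRec

theorem S_mul (m n : M.D .nat) : S m * n = m * n + n := by
  have := induction (.eq (succ x1 ⊠ x0) (x1 ⊠ x0 ⊹ x0)) (.cons m .nil)
  simp at this
  refine this (by simp [Model.mul_zero]) (fun n hn => ?_) n
  rw [mul_S, hn, mul_S, add_S, add_S, add_right_comm]

protected theorem mul_comm (m n : M.D .nat) : m * n = n * m := by
  have := induction (.eq (x1 ⊠ x0) (x0 ⊠ x1)) (.cons m .nil)
  simp at this
  exact this (by simp [Model.mul_zero, Model.zero_mul]) (fun n hn => by rw [mul_S, hn, S_mul]) n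

protected theorem mul_add (m n k : M.D .nat) : m * (n + k) = m * n + m * k := by
  have := induction (.eq (x1 ⊠ (x2 ⊹ x0)) (x1 ⊠ x2 ⊹ x1 ⊠ x0)) (.cons m (.cons n .nil))
  simp at this
  exact this (by simp [Model.mul_zero])
    (fun k hk => by rw [add_S, mul_S, hk, mul_S, add_assoc]) k

protected theorem mul_assoc (m n k : M.D .nat) : m * n * k = m * (n * k) := by
  have := induction (.eq (x1 ⊠ x2 ⊠ x0) (x1 ⊠ (x2 ⊠ x0))) (.cons m (.cons n .nil))
  simp at this
  exact this (by simp [Model.mul_zero]) (fun k hk => by rw [mul_S, hk, mul_S, Model.mul_add]) k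

theorem S_eq (n : M.D .nat) : S n = n + 1 := by
  rw [show (1 : M.D .nat) = S 0 from rfl, add_S, add_zero]

instance : CommSemiring (M.D .nat) where
  mul_assoc := Model.mul_assoc
  one_mul n := by rw [show (1 : M.D .nat) = S 0 from rfl, S_mul, Model.zero_mul, zero_add]
  mul_one n := by rw [show (1 : M.D .nat) = S 0 from rfl, mul_S, Model.mul_zero, zero_add]
  mul_comm := Model.mul_comm
  left_distrib := Model.mul_add
  right_distrib m n k := by
    rw [Model.mul_comm, Model.mul_add, Model.mul_comm k m, Model.mul_comm k n]
  zero_mul := Model.zero_mul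
  mul_zero := Model.mul_zero

instance : IsLeftCancelAdd (M.D .nat) where
  add_left_cancel m n k := by
    have := induction (.eq (x0 ⊹ x1) (x0 ⊹ x2) ⟶ᶠ .eq x1 x2) (.cons n (.cons k .nil))
    simp at this
    exact this (fun m hm h => hm (S_inj (by rwa [S_add, S_add] at h))) m

instance : IsCancelAdd (M.D .nat) := AddCommMagma.IsLeftCancelAdd.toIsCancelAdd _

theorem eq_zero_or_S (n : M.D .nat) : n = 0 ∨ ∃ m, n = S m := by
  have := induction (M := M) (.eq x0 zero ∨ᶠ .ex .nat (.eq x1 (succ x0))) .nil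
  simp only [Fm.sat_or, Fm.sat_eq, Fm.sat_ex, eval_zero, eval_succ, Tm.eval_var,
    Interp.Env.cons_z, Interp.Env.cons_s] at this
  exact this (Or.inl trivial) (fun n _ => Or.inr ⟨n, rfl⟩) n

theorem eq_zero_of_add {m n : M.D .nat} (h : m + n = 0) : m = 0 := by
  rcases eq_zero_or_S m with h' | ⟨k, rfl⟩
  · exact h'
  · rw [S_add] at h
    exact (S_ne_zero _ h).elim

theorem exists_add_or (m n : M.D .nat) : (∃ k, m + k = n) ∨ ∃ k, n + k = m := by
  have := induction (.ex .nat (.eq (x2 ⊹ x0) x1) ∨ᶠ .ex .nat (.eq (x1 ⊹ x0) x2)) (.cons m .nil)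
  simp at this
  refine this (fun n hn => ?_) n
  rcases hn with ⟨k, rfl⟩ | ⟨k, rfl⟩
  · exact Or.inl ⟨S k, add_S _ _⟩
  · rcases eq_zero_or_S k with rfl | ⟨k, rfl⟩
    · exact Or.inl ⟨1, by rw [add_zero, S_eq]⟩
    · exact Or.inr ⟨k, by rw [add_S, S_add]⟩

theorem add_sub_cancel' (m n : M.D .nat) : m + n - n = m := by
  have h : ∀ m n : M.D .nat, S m - S n = m - n := by
    intro m n
    have := induction (.eq (succ x1 ∸ succ x0) (x1 ∸ x0)) (.cons m .nil)
    simp at this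
    exact this (by rw [sub_S, Model.sub_zero, Model.sub_zero, pre_S])
      (fun n hn => by rw [sub_S, hn, sub_S]) n
  have := induction (.eq (x1 ⊹ x0 ∸ x0) x1) (.cons m .nil)
  simp at this
  exact this (by rw [Model.sub_zero]) (fun n hn => by rw [add_S, h, hn]) n

theorem sub_add_self (m n : M.D .nat) : m - (m + n) = 0 := by
  have := induction (.eq (x1 ∸ (x1 ⊹ x0)) zero) (.cons m .nil)
  simp at this
  refine this ?_ (fun n hn => by rw [add_S, sub_S, hn, pre_zero]) n
  have := add_sub_cancel' 0 m
  rwa [zero_add] at this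

end Model

/-! ### The ring of differences of a cancellative commutative semiring -/

section DiffRing

variable (N : Type*) [CommSemiring N] [IsCancelAdd N]

def diffSetoid : Setoid (N × N) where
  r p q := p.1 + q.2 = q.1 + p.2
  iseqv :=
    { refl := fun _ => rfl
      symm := fun h => h.symm
      trans := by
        rintro ⟨a, b⟩ ⟨c, d⟩ ⟨e, f⟩ h h'
        simp only at h h' ⊢
        refine add_right_cancel (b := c + d) ?_
        calc a + f + (c + d) = (a + d) + (c + f) := by ring
          _ = e + b + (c + d) := by rw [h, h']; ring }

/-- The partial sums of a real number are differences of two numbers of the model. In this ring they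
can be treated by ring and linear arithmetic. -/
def DiffRing : Type _ := Quotient (diffSetoid N)

namespace DiffRing

variable {N}

def mk (a b : N) : DiffRing N := Quotient.mk (diffSetoid N) (a, b)

theorem mk_eq {a b c d : N} : mk a b = mk c d ↔ a + d = c + b := Quotient.eq

theorem ind {P : DiffRing N → Prop} (h : ∀ a b, P (mk a b)) (x : DiffRing N) : P x :=
  Quotient.ind (fun p => h p.1 p.2) x

instance : Zero (DiffRing N) := ⟨mk 0 0⟩
instance : One (DiffRing N) := ⟨mk 1 0⟩

instance : Add (DiffRing N) :=
  ⟨Quotient.map₂ (fun p q => (p.1 + q.1, p.2 + q.2)) <| by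
    rintro ⟨a, b⟩ ⟨a', b'⟩ h ⟨c, d⟩ ⟨c', d'⟩ h'
    change a + b' = a' + b at h
    change c + d' = c' + d at h'
    change a + c + (b' + d') = a' + c' + (b + d)
    calc a + c + (b' + d') = (a + b') + (c + d') := by ring
      _ = a' + c' + (b + d) := by rw [h, h']; ring⟩

instance : Neg (DiffRing N) :=
  ⟨Quotient.map (fun p => (p.2, p.1)) <| by
    rintro ⟨a, b⟩ ⟨a', b'⟩ h
    change a + b' = a' + b at h
    change b + a' = b' + a
    rw [add_comm b, ← h, add_comm]⟩

instance : Mul (DiffRing N) :=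
  ⟨Quotient.map₂ (fun p q => (p.1 * q.1 + p.2 * q.2, p.1 * q.2 + p.2 * q.1)) <| by
    rintro ⟨a, b⟩ ⟨a', b'⟩ h ⟨c, d⟩ ⟨c', d'⟩ h'
    change a + b' = a' + b at h
    change c + d' = c' + d at h'
    change a * c + b * d + (a' * d' + b' * c') = a' * c' + b' * d' + (a * d + b * c)
    -- With this summand, cancelled at the end, both equations can be applied as they stand.
    refine add_right_cancel (b := b' * c + a' * d) ?_
    calc a * c + b * d + (a' * d' + b' * c') + (b' * c + a' * d)
        = (a + b') * c + (a' + b) * d + a' * d' + b' * c' := by ring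
      _ = (a' + b) * c + (a + b') * d + a' * d' + b' * c' := by rw [h]
      _ = a' * (c + d') + b' * (c' + d) + (a * d + b * c) := by ring
      _ = a' * (c' + d) + b' * (c + d') + (a * d + b * c) := by rw [h']
      _ = _ := by ring⟩

theorem mk_add (a b c d : N) : mk a b + mk c d = mk (a + c) (b + d) := rfl
theorem mk_mul (a b c d : N) : mk a b * mk c d = mk (a * c + b * d) (a * d + b * c) := rfl
theorem neg_mk (a b : N) : -mk a b = mk b a := rfl
theorem zero_def : (0 : DiffRing N) = mk 0 0 := rfl
theorem one_def : (1 : DiffRing N) = mk 1 0 := rfl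

instance : CommRing (DiffRing N) where
  add_assoc x y z := by
    induction x using ind; induction y using ind; induction z using ind
    simp only [mk_add, mk_eq]; ring
  zero_add x := by
    induction x using ind
    simp only [mk_add, mk_eq, zero_def]; ring
  add_zero x := by
    induction x using ind
    simp only [mk_add, mk_eq, zero_def]; ring
  add_comm x y := by
    induction x using ind; induction y using ind
    simp only [mk_add, mk_eq]; ring
  neg_add_cancel x := by
    induction x using ind
    simp only [mk_add, neg_mk, mk_eq, zero_def]; ring
  mul_assoc x y z := by
    induction x using ind; induction y using ind; induction z using ind
    simp only [mk_mul, mk_eq]; ring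
  one_mul x := by
    induction x using ind
    simp only [mk_mul, mk_eq, one_def]; ring
  mul_one x := by
    induction x using ind
    simp only [mk_mul, mk_eq, one_def]; ring
  mul_comm x y := by
    induction x using ind; induction y using ind
    simp only [mk_mul, mk_eq]; ring
  left_distrib x y z := by
    induction x using ind; induction y using ind; induction z using ind
    simp only [mk_mul, mk_add, mk_eq]; ring
  right_distrib x y z := by
    induction x using ind; induction y using ind; induction z using ind
    simp only [mk_mul, mk_add, mk_eq]; ring
  zero_mul x := by
    induction x using ind
    simp only [mk_mul, mk_eq, zero_def]; ring
  mul_zero x := by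
    induction x using ind
    simp only [mk_mul, mk_eq, zero_def]; ring
  nsmul := nsmulRec
  zsmul := zsmulRec

/-- The embedding of the semiring. -/
def of : N →+* DiffRing N where
  toFun n := mk n 0
  map_one' := rfl
  map_zero' := rfl
  map_add' m n := by rw [mk_add, add_zero]
  map_mul' m n := by rw [mk_mul]; simp

theorem of_injective : Function.Injective (of : N → DiffRing N) := fun m n h => by
  have h : m + 0 = n + 0 := mk_eq.1 h
  simpa using h

theorem mk_eq_sub (a b : N) : mk a b = of a - of b := by
  rw [sub_eq_add_neg]
  change _ = mk a 0 + -mk b 0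
  rw [neg_mk, mk_add, add_zero, zero_add]

end DiffRing

end DiffRing

namespace Model

variable {M : Model} {Γ : Ctx}

/-! ### The ordered ring of integers of the model -/

variable (M) in
abbrev Z : Type := DiffRing (M.D .nat)

/-- The embedding of the natural numbers into the integers. -/
def toZ : M.D .nat →+* M.Z := DiffRing.of

theorem toZ_injective : Function.Injective (toZ : M.D .nat → M.Z) := DiffRing.of_injective

theorem toZ_S (n : M.D .nat) : toZ (S n) = toZ n + 1 := by rw [S_eq, map_add, map_one]

instance : LE M.Z := ⟨fun x y => ∃ k, y = x + toZ k⟩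

theorem Z_le_def {x y : M.Z} : x ≤ y ↔ ∃ k, y = x + toZ k := Iff.rfl

noncomputable instance : LinearOrder M.Z where
  le_refl x := ⟨0, by simp⟩
  le_trans x y z := by
    rintro ⟨k, rfl⟩ ⟨l, rfl⟩
    exact ⟨k + l, by rw [map_add]; ring⟩
  le_antisymm x y := by
    rintro ⟨k, rfl⟩ ⟨l, h⟩
    have h' : toZ (k + l) = toZ 0 := by
      rw [map_zero, map_add]
      linear_combination -h
    rw [eq_zero_of_add (toZ_injective h'), map_zero, add_zero]
  le_total x y := by
    have key : ∀ z : M.Z, (∃ k, z = toZ k) ∨ ∃ k, z = -toZ k := by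
      intro z
      induction z using DiffRing.ind with
      | h a b =>
        rw [DiffRing.mk_eq_sub]
        change (∃ k, toZ a - toZ b = toZ k) ∨ ∃ k, toZ a - toZ b = -toZ k
        rcases exists_add_or a b with ⟨k, rfl⟩ | ⟨k, rfl⟩
        · exact .inr ⟨k, by rw [map_add]; ring⟩
        · exact .inl ⟨k, by rw [map_add]; ring⟩
    rcases key (y - x) with ⟨k, h⟩ | ⟨k, h⟩
    · exact .inl ⟨k, by rw [← h]; ring⟩
    · exact .inr ⟨k, by linear_combination -h⟩
  toDecidableLE := Classical.decRel _

instance : IsOrderedAddMonoid M.Z where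
  add_le_add_left := by
    rintro x y ⟨k, rfl⟩ z
    exact ⟨k, by ring⟩

theorem toZ_nonneg (n : M.D .nat) : 0 ≤ toZ n := ⟨n, by simp⟩

instance : ZeroLEOneClass M.Z := ⟨by rw [← map_one toZ]; exact toZ_nonneg _⟩

theorem one_ne_zero' : (1 : M.D .nat) ≠ 0 := S_ne_zero 0

instance : Nontrivial M.Z := ⟨0, 1, fun h => one_ne_zero' (toZ_injective (by simpa using h.symm))⟩

theorem exists_eq_add_S {x y : M.Z} (h : x < y) : ∃ k, y = x + toZ (S k) := by
  obtain ⟨k, rfl⟩ := h.le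
  rcases eq_zero_or_S k with rfl | ⟨k, rfl⟩
  · simp at h
  · exact ⟨k, rfl⟩

theorem add_one_le_of_lt {x y : M.Z} (h : x < y) : x + 1 ≤ y := by
  obtain ⟨k, rfl⟩ := exists_eq_add_S h
  exact ⟨k, by rw [toZ_S]; ring⟩

/-- Discreteness of the order. It turns the estimates for rounding and for digits into exact integer
bounds. -/
theorem le_of_lt_add_one {x y : M.Z} (h : x < y + 1) : x ≤ y := by
  have := add_one_le_of_lt h
  simpa using this

instance : IsStrictOrderedRing M.Z := .of_mul_pos fun x y hx hy => by
  obtain ⟨k, rfl⟩ := exists_eq_add_S hx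
  obtain ⟨l, rfl⟩ := exists_eq_add_S hy
  rw [zero_add, zero_add, ← map_mul, mul_S, add_S]
  refine lt_of_le_of_ne (toZ_nonneg _) fun h => S_ne_zero _ (toZ_injective (h.symm.trans ?_))
  rw [map_zero]

theorem toZ_le_iff {m n : M.D .nat} : toZ m ≤ toZ n ↔ ∃ k, m + k = n := by
  rw [Z_le_def]
  simp only [← map_add, toZ_injective.eq_iff]
  exact ⟨fun ⟨k, h⟩ => ⟨k, h.symm⟩, fun ⟨k, h⟩ => ⟨k, h.symm⟩⟩

theorem sub_eq_zero_of_le {m n : M.D .nat} (h : toZ m ≤ toZ n) : m - n = 0 := by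
  obtain ⟨k, rfl⟩ := toZ_le_iff.1 h
  exact sub_add_self m k

theorem toZ_sub_of_le {m n : M.D .nat} (h : toZ n ≤ toZ m) : toZ (m - n) = toZ m - toZ n := by
  obtain ⟨k, rfl⟩ := toZ_le_iff.1 h
  rw [add_comm n k, add_sub_cancel', map_add]
  ring

theorem toZ_sub (m n : M.D .nat) : toZ (m - n) = max (toZ m - toZ n) 0 := by
  rcases le_total (toZ m) (toZ n) with h | h
  · rw [sub_eq_zero_of_le h, map_zero, max_eq_right (sub_nonpos.2 h)]
  · rw [toZ_sub_of_le h, max_eq_left (sub_nonneg.2 h)]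

theorem sub_eq_zero_iff {m n : M.D .nat} : m - n = 0 ↔ toZ m ≤ toZ n := by
  refine ⟨fun h => ?_, sub_eq_zero_of_le⟩
  have := toZ_sub m n
  rw [h, map_zero] at this
  have := le_max_left (toZ m - toZ n) 0
  linarith

@[simp] theorem sat_le (ρ : M.Env Γ) (s t : Tm Γ .nat) :
    (le s t).Sat ρ ↔ toZ (s.eval ρ) ≤ toZ (t.eval ρ) := by
  simp [le, sub_eq_zero_iff]

@[simp] theorem eval_num (ρ : M.Env Γ) (n : ℕ) : (num n).eval ρ = (n : M.D .nat) := by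
  induction n with
  | zero => simp [num]
  | succ n ih => simp [num, ih, S_eq]

theorem toZ_minN (m n : M.D .nat) : toZ (m - (m - n)) = min (toZ m) (toZ n) := by
  have := toZ_nonneg n
  rw [toZ_sub, toZ_sub]
  rcases le_total (toZ m) (toZ n) with h | h
  · rw [max_eq_right (sub_nonpos.2 h), min_eq_left h, sub_zero, max_eq_left (toZ_nonneg m)]
  · rw [max_eq_left (sub_nonneg.2 h), min_eq_right h, max_eq_left (by linarith)]
    ring

theorem toZ_maxN (m n : M.D .nat) : toZ (m + (n - m)) = max (toZ m) (toZ n) := by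
  rw [map_add, toZ_sub]
  rcases le_total (toZ m) (toZ n) with h | h
  · rw [max_eq_left (sub_nonneg.2 h), max_eq_right h]
    ring
  · rw [max_eq_right (sub_nonpos.2 h), max_eq_left h, add_zero]

/-! ### Powers of two and integer quotients in the model. -/

theorem pow_zero' : pow (0 : M.D .nat) = 1 := by simp [pow, powTm]

theorem pow_S (n : M.D .nat) : pow (S n) = pow n + pow n := by
  simp [pow, powTm]
  congr 1

theorem pow_add' (m n : M.D .nat) : pow (m + n) = pow m * pow n := by
  have := induction (.eq (pow2 (x1 ⊹ x0)) (pow2 x1 ⊠ pow2 x0)) (.cons m .nil)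
  simp at this
  exact this (by rw [pow_zero', mul_one]) (fun n hn => by rw [add_S, pow_S, hn, pow_S, mul_add]) n

/-- The powers of two, as integers. -/
def two (n : M.D .nat) : M.Z := toZ (pow n)

theorem two_zero : two (0 : M.D .nat) = 1 := by rw [two, pow_zero', map_one]
theorem two_S (n : M.D .nat) : two (S n) = 2 * two n := by
  rw [two, pow_S, map_add, two]; ring
theorem two_add (m n : M.D .nat) : two (m + n) = two m * two n := by
  rw [two, pow_add', map_mul]; rfl

theorem one_le_two (n : M.D .nat) : 1 ≤ two n := by
  have := induction (M := M) (le (num 1) (pow2 x0)) .nil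
  simp at this
  refine this (by rw [pow_zero', map_one]) (fun n hn => ?_) n
  rw [pow_S, map_add]
  linarith

theorem two_pos (n : M.D .nat) : 0 < two n := lt_of_lt_of_le zero_lt_one (one_le_two n)

theorem toZ_lt_two (n : M.D .nat) : toZ n < two n := by
  have := induction (M := M) (le (succ x0) (pow2 x0)) .nil
  simp at this
  have h := this (by simp [pow_zero', S_eq]) (fun n hn => by
    rw [pow_S, map_add, toZ_S]
    have := one_le_two n
    rw [two] at this
    linarith) n
  rw [toZ_S] at h
  rw [two]
  linarith

theorem quo_zero (t : M.D .nat) : quo 0 t = 0 := by simp [quo, divTm]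

theorem quo_S (s t : M.D .nat) :
    quo (S s) t = quo s t + (1 - (S (quo s t) * t - S s)) := by
  simp [quo, divTm]
  -- The two step functions come from one term, in assignments that differ only at a variable which
  -- the term does not contain.
  have h := recN_congr (M := M) (a := 0)
    (f := Tm.eval (Interp.Env.cons t (Interp.Env.cons (S s) Interp.Env.nil))
      (lam (lam (x1 ⊹ (num 1 ∸ (succ x1 ⊠ x2 ∸ succ x0))))))
    (g := Tm.eval (Interp.Env.cons t (Interp.Env.cons s Interp.Env.nil))
      (lam (lam (x1 ⊹ (num 1 ∸ (succ x1 ⊠ x2 ∸ succ x0)))))) (by simp) s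
  simp only [h]

theorem quo_spec (s t : M.D .nat) (ht : 1 ≤ toZ t) :
    toZ (quo s t) * toZ t ≤ toZ s ∧ toZ s < (toZ (quo s t) + 1) * toZ t := by
  have := induction (le (quot x0 x1 ⊠ x1) x0 ∧ᶠ le (succ x0) (succ (quot x0 x1) ⊠ x1))
    (.cons t .nil)
  simp [toZ_S] at this
  have h := this (by simp [quo_zero]) (by simpa [quo_zero] using ht) (fun s h₁ h₂ => by
    rw [quo_S, map_add, toZ_sub, toZ_sub, map_mul, toZ_S, toZ_S, map_one]
    rcases le_or_gt ((toZ (quo s t) + 1) * toZ t) (toZ s + 1) with h | h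
    · rw [max_eq_right (sub_nonpos.2 h), sub_zero, max_eq_left zero_le_one]
      refine ⟨h, ?_⟩
      nlinarith
    · have h' := add_one_le_of_lt h
      rw [max_eq_left (sub_nonneg.2 h.le), max_eq_right (by linarith), add_zero]
      exact ⟨by linarith, by linarith⟩) s
  exact ⟨h.1, by linarith [h.2]⟩

/-! ### Approximations of real numbers -/

def pos (γ : M.D .one) (n : M.D .nat) : M.D .nat := M.app (M.app (posPartTm.eval .nil) γ) n
def neg (γ : M.D .one) (n : M.D .nat) : M.D .nat := M.app (M.app (negPartTm.eval .nil) γ) n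

@[simp] theorem eval_posPart (ρ : M.Env Γ) (γ : Tm Γ .one) (n : Tm Γ .nat) :
    (posPart γ n).eval ρ = pos (γ.eval ρ) (n.eval ρ) := by
  simp only [posPart, Tm.eval_app, Tm.eval_cl]; rfl

@[simp] theorem eval_negPart (ρ : M.Env Γ) (γ : Tm Γ .one) (n : Tm Γ .nat) :
    (negPart γ n).eval ρ = neg (γ.eval ρ) (n.eval ρ) := by
  simp only [negPart, Tm.eval_app, Tm.eval_cl]; rfl

@[simp] theorem eval_parity (ρ : M.Env Γ) (n : Tm Γ .nat) :
    (parity n).eval ρ = n.eval ρ - 2 * quo (n.eval ρ) 2 := by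
  simp [parity]

@[simp] theorem eval_minN (ρ : M.Env Γ) (m n : Tm Γ .nat) :
    (minN m n).eval ρ = m.eval ρ - (m.eval ρ - n.eval ρ) := by
  simp [minN]

@[simp] theorem eval_maxN (ρ : M.Env Γ) (m n : Tm Γ .nat) :
    (maxN m n).eval ρ = m.eval ρ + (n.eval ρ - m.eval ρ) := by
  simp [maxN]

theorem pos_zero (γ : M.D .one) :
    pos γ 0 = (1 - (M.app γ 0 - 2 * quo (M.app γ 0) 2)) * quo (M.app γ 0) 2 := by
  simp [pos, posPartTm]

theorem neg_zero (γ : M.D .one) :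
    neg γ 0 = (M.app γ 0 - 2 * quo (M.app γ 0) 2) * S (quo (M.app γ 0) 2) := by
  simp [neg, negPartTm]

theorem mul_congr_right {a x y : M.D .nat} (h : x = y) : a * x = a * y := by rw [h]

theorem pos_S (γ : M.D .one) (n : M.D .nat) :
    pos γ (S n) = 2 * pos γ n + (M.app γ (S n) - (M.app γ (S n) - 2)) := by
  simp [pos, posPartTm]
  exact mul_congr_right (recN_congr (by simp) n)

theorem neg_S (γ : M.D .one) (n : M.D .nat) : neg γ (S n) = 2 * neg γ n + 1 := by
  simp [neg, negPartTm]
  exact mul_congr_right (recN_congr (by simp) n)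

/-- The partial sum of the signed digit representation, multiplied by a power of two. -/
def approx (γ : M.D .one) (n : M.D .nat) : M.Z := toZ (pos γ n) - toZ (neg γ n)

theorem toZ_ofNat (n : ℕ) [n.AtLeastTwo] : toZ (OfNat.ofNat n : M.D .nat) = OfNat.ofNat n :=
  map_ofNat toZ n

theorem approx_S (γ : M.D .one) (n : M.D .nat) :
    approx γ (S n) = 2 * approx γ n + (min (toZ (M.app γ (S n))) 2 - 1) := by
  rw [approx, pos_S, neg_S, map_add, map_add, map_mul, map_mul, toZ_minN, toZ_ofNat, map_one,
    approx]
  ring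

theorem abs_approx_S (γ : M.D .one) (n : M.D .nat) :
    |approx γ (S n) - 2 * approx γ n| ≤ 1 := by
  have h := toZ_nonneg (M.app γ (S n))
  rw [approx_S, abs_le]
  have h₁ := min_le_right (toZ (M.app γ (S n))) 2
  have h₂ : 0 ≤ min (toZ (M.app γ (S n))) 2 := le_min h (by norm_num)
  constructor <;> linarith

theorem quo_unique {s t q : M.D .nat} (h₁ : toZ q * toZ t ≤ toZ s)
    (h₂ : toZ s < (toZ q + 1) * toZ t) : quo s t = q := by
  have h0 := toZ_nonneg t
  have ht : 1 ≤ toZ t := by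
    rcases h0.lt_or_eq with h | h
    · simpa using add_one_le_of_lt h
    · rw [← h] at h₁ h₂
      linarith
  obtain ⟨h₃, h₄⟩ := quo_spec s t ht
  apply toZ_injective
  apply le_antisymm
  · apply le_of_lt_add_one
    by_contra h
    have := mul_le_mul_of_nonneg_right (not_lt.1 h) h0
    linarith
  · apply le_of_lt_add_one
    by_contra h
    have := mul_le_mul_of_nonneg_right (not_lt.1 h) h0
    linarith

/-- A function whose value at `0` codes the integer `r - m` represents a number with this integral
part. -/
theorem approx_zero_of_code (γ : M.D .one) (r m : M.D .nat)
    (h : M.app γ 0 = 2 * (r - m) + pre (2 * (m - r))) : approx γ 0 = toZ r - toZ m := by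
  rcases le_or_gt (toZ m) (toZ r) with hle | hlt
  · rw [sub_eq_zero_of_le hle, mul_zero, pre_zero, add_zero] at h
    have hq : quo (M.app γ 0) 2 = r - m := by
      apply quo_unique <;> rw [h, map_mul, toZ_ofNat] <;> linarith
    rw [approx, pos_zero, neg_zero, hq, h, sub_eq_zero_of_le le_rfl, Model.sub_zero, one_mul,
      zero_mul, map_zero, toZ_sub_of_le hle, sub_zero]
  · obtain ⟨k, hk⟩ : ∃ k, m - r = S k := by
      rcases eq_zero_or_S (m - r) with h0 | h0
      · exact absurd (sub_eq_zero_iff.1 h0) (not_le.2 hlt)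
      · exact h0
    have hk' := toZ_sub_of_le hlt.le
    rw [hk, toZ_S] at hk'
    -- Here `r - m = -(k + 1)`, whose code is `2 k + 1`.
    rw [sub_eq_zero_of_le hlt.le, mul_zero, zero_add, hk,
      show 2 * S k = S (2 * k + 1) by simp only [S_eq]; ring, pre_S] at h
    have hq : quo (M.app γ 0) 2 = k := by
      apply quo_unique <;> rw [h, map_add, map_mul, toZ_ofNat, map_one] <;> linarith
    have h1 : M.app γ 0 - 2 * k = 1 := by rw [h, add_comm, add_sub_cancel']
    rw [approx, pos_zero, neg_zero, hq, h1, sub_eq_zero_of_le le_rfl, zero_mul, one_mul,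
      map_zero, toZ_S, hk']
    ring

/-! ### From approximations to digits -/

def dig (p m : M.D .one) : M.D .one := M.app (M.app (digitsTm.eval .nil) p) m

@[simp] theorem eval_digits (ρ : M.Env Γ) (p m : Tm Γ .one) :
    (digits p m).eval ρ = dig (p.eval ρ) (m.eval ρ) := by
  simp only [digits, Tm.eval_app, Tm.eval_cl]; rfl

/-- The rounded quotient of the definition of `digits`. -/
def rnd (p m : M.D .one) (n : M.D .nat) : M.D .nat :=
  quo (M.app p n + 31 * M.app m n + 16) 32

@[simp] theorem eval_roundAux (ρ : M.Env Γ) (p m : Tm Γ .nat) :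
    (roundAux p m).eval ρ = quo (p.eval ρ + 31 * m.eval ρ + 16) 32 := by
  simp [roundAux]

theorem dig_zero (p m : M.D .one) : M.app (dig p m) 0 =
    2 * (rnd p m 0 - M.app m 0) + pre (2 * (M.app m 0 - rnd p m 0)) := by
  simp [dig, digitsTm, rnd]

theorem dig_S (p m : M.D .one) (n : M.D .nat) : M.app (dig p m) (S n) =
    1 + rnd p m (S n) + 2 * M.app m n - (M.app m (S n) + 2 * rnd p m n) := by
  simp [dig, digitsTm, rnd]

/-- The value of the sequence of differences of `p` and `m`. -/
def diff (p m : M.D .one) (n : M.D .nat) : M.Z := toZ (M.app p n) - toZ (M.app m n)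

theorem rnd_spec (p m : M.D .one) (n : M.D .nat) :
    |32 * (toZ (rnd p m n) - toZ (M.app m n)) - diff p m n| ≤ 16 := by
  have := quo_spec (M.app p n + 31 * M.app m n + 16) 32 (by rw [toZ_ofNat]; norm_num)
  rw [map_add, map_add, map_mul, toZ_ofNat, toZ_ofNat, toZ_ofNat] at this
  rw [rnd, diff, abs_le]
  constructor <;> linarith [this.1, this.2]

/-- Let N be the rounded value and d the difference of `p` and `m`, so |32 N - d| ≤ 16 at every
place. The bound 15 gives 32 |N(n+1) - 2 N(n)| ≤ 16 + 32 + 15 < 64. Hence N(n+1) - 2 N(n) is one of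
-1, 0, 1, and neither the truncated subtraction nor the cut-off at 2 changes it. -/
theorem approx_dig_eq (p m : M.D .one)
    (h : ∀ n, |diff p m (S n) - 2 * diff p m n| ≤ 15) (n : M.D .nat) :
    approx (dig p m) n = toZ (rnd p m n) - toZ (M.app m n) := by
  -- The equation of integers is written with sums of numbers, so that it becomes a formula; `key`
  -- translates between the two forms.
  have := induction (.eq (posPart x1 x0 ⊹ x3 ⬝ x0)
    (roundAux (x2 ⬝ x0) (x3 ⬝ x0) ⊹ negPart x1 x0))
    (.cons (dig p m) (.cons p (.cons m .nil)))
  simp only [Fm.sat_eq, eval_add, eval_posPart, eval_negPart, eval_roundAux, Tm.eval_app,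
    Tm.eval_var, Interp.Env.cons_z, Interp.Env.cons_s] at this
  have key : ∀ n : M.D .nat, pos (dig p m) n + M.app m n = rnd p m n + neg (dig p m) n ↔
      approx (dig p m) n = toZ (rnd p m n) - toZ (M.app m n) := by
    intro n
    rw [← toZ_injective.eq_iff, map_add, map_add, approx]
    constructor <;> intro h <;> linear_combination h
  rw [← key]
  refine this ((key 0).2 (approx_zero_of_code _ _ _ (dig_zero p m))) (fun n hn => ?_) n
  refine (key _).2 ?_
  replace hn := (key n).1 hn
  have h₀ := rnd_spec p m n
  have h₁ := rnd_spec p m (S n)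
  have h₂ := h n
  rw [abs_le] at h₀ h₁ h₂
  have hd := toZ_sub (1 + rnd p m (S n) + 2 * M.app m n) (M.app m (S n) + 2 * rnd p m n)
  rw [← dig_S] at hd
  simp only [map_add, map_mul, map_ofNat, map_one] at hd
  have hlo : -1 ≤ toZ (rnd p m (S n)) - toZ (M.app m (S n)) -
      2 * (toZ (rnd p m n) - toZ (M.app m n)) := by
    by_contra hlt
    have := add_one_le_of_lt (not_le.1 hlt)
    linarith
  have hhi : toZ (rnd p m (S n)) - toZ (M.app m (S n)) -
      2 * (toZ (rnd p m n) - toZ (M.app m n)) ≤ 1 := by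
    by_contra hlt
    have := add_one_le_of_lt (not_le.1 hlt)
    linarith
  rw [max_eq_left (by linarith)] at hd
  rw [approx_S, hd, hn, min_eq_left (by linarith)]
  ring

theorem abs_approx_dig (p m : M.D .one)
    (h : ∀ n, |diff p m (S n) - 2 * diff p m n| ≤ 15) (n : M.D .nat) :
    |32 * approx (dig p m) n - diff p m n| ≤ 16 := by
  rw [approx_dig_eq p m h]
  exact rnd_spec p m n

/-! ### Comparison of approximations -/

/-- The next `k` digits contribute at most 2^(k-1) + ... + 1 = 2^k - 1. -/
theorem abs_approx_add (γ : M.D .one) (n k : M.D .nat) :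
    |approx γ (n + k) - two k * approx γ n| ≤ two k - 1 := by
  have := induction
    (le (posPart x1 (x2 ⊹ x0) ⊹ pow2 x0 ⊠ negPart x1 x2 ⊹ num 1)
      (pow2 x0 ⊠ posPart x1 x2 ⊹ negPart x1 (x2 ⊹ x0) ⊹ pow2 x0) ∧ᶠ
    le (pow2 x0 ⊠ posPart x1 x2 ⊹ negPart x1 (x2 ⊹ x0) ⊹ num 1)
      (posPart x1 (x2 ⊹ x0) ⊹ pow2 x0 ⊠ negPart x1 x2 ⊹ pow2 x0))
    (.cons γ (.cons n .nil))
  simp only [Fm.sat_and, sat_le, eval_add, eval_mul, eval_posPart, eval_negPart, eval_pow2,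
    Tm.eval_var, Interp.Env.cons_z, Interp.Env.cons_s, eval_num, map_add, map_mul, Nat.cast_one,
    map_one] at this
  have key : ∀ k, ((toZ (pos γ (n + k)) + toZ (pow k) * toZ (neg γ n) + 1 ≤
      toZ (pow k) * toZ (pos γ n) + toZ (neg γ (n + k)) + toZ (pow k)) ∧
      (toZ (pow k) * toZ (pos γ n) + toZ (neg γ (n + k)) + 1 ≤
      toZ (pos γ (n + k)) + toZ (pow k) * toZ (neg γ n) + toZ (pow k))) ↔
      |approx γ (n + k) - two k * approx γ n| ≤ two k - 1 := by
    intro k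
    rw [abs_le, approx, approx, two]
    constructor
    · rintro ⟨h₁, h₂⟩
      constructor <;> linarith
    · rintro ⟨h₁, h₂⟩
      constructor <;> linarith
  rw [← key]
  refine this ((key 0).2 (by simp [two_zero])) (fun k hk => ?_) k
  refine (key _).2 ?_
  replace hk := (key k).1 hk
  rw [add_S, two_S]
  have h := abs_approx_S γ (n + k)
  rw [abs_le] at h hk ⊢
  constructor <;> linarith [h.1, h.2, hk.1, hk.2]

theorem exists_lt_two (z : M.Z) : ∃ k, z < two k := by
  obtain ⟨k, hk⟩ := abs_nonneg z
  refine ⟨k, ?_⟩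
  have := toZ_lt_two k
  have := le_abs_self z
  linarith

/-- Any bounded error improves to 2. An excess of at least 3 at place `n` becomes at least 3·2^k -
2(2^k - 1) = 2^k + 2 at place `n + k`, which exceeds `c` for large `k`. Real arithmetic can
therefore be checked up to arbitrary constants. -/
theorem approx_le_of_bounded {α β : M.D .one} {c : M.Z}
    (h : ∀ n, approx α n ≤ approx β n + c) (n : M.D .nat) : approx α n ≤ approx β n + 2 := by
  apply le_of_lt_add_one
  by_contra hn
  have hn := not_lt.1 hn
  obtain ⟨k, hk⟩ := exists_lt_two c
  have h₁ := abs_approx_add α n k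
  have h₂ := abs_approx_add β n k
  have h₃ := h (n + k)
  have h₄ := mul_le_mul_of_nonneg_left hn (two_pos k).le
  rw [abs_le] at h₁ h₂
  linarith [h₁.1, h₂.2]

/-- If `α` exceeds `β` at some place, it does so everywhere. -/
theorem approx_le_of_lt {α β : M.D .one} {n : M.D .nat} (hn : approx β n + 2 < approx α n)
    (m : M.D .nat) : approx β m ≤ approx α m + 2 := by
  have hn' := add_one_le_of_lt hn
  rcases exists_add_or n m with ⟨k, rfl⟩ | ⟨k, rfl⟩
  · have h₁ := abs_approx_add α n k
    have h₂ := abs_approx_add β n k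
    have h₄ := mul_le_mul_of_nonneg_left hn' (two_pos k).le
    have := two_pos k
    rw [abs_le] at h₁ h₂
    linarith [h₁.1, h₂.2]
  · apply le_of_lt_add_one
    by_contra hm
    have hm := not_lt.1 hm
    have h₁ := abs_approx_add α m k
    have h₂ := abs_approx_add β m k
    have h₄ := mul_le_mul_of_nonneg_left hm (two_pos k).le
    have := two_pos k
    rw [abs_le] at h₁ h₂
    linarith [h₁.2, h₂.1]

theorem abs_approx_le (α : M.D .one) (n : M.D .nat) :
    |approx α n| ≤ two n * (|approx α 0| + 1) - 1 := by
  have h := abs_approx_add α 0 n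
  rw [zero_add] at h
  have h₁ := abs_sub_abs_le_abs_sub (approx α n) (two n * approx α 0)
  rw [abs_mul, abs_of_pos (two_pos n)] at h₁
  linarith

theorem sat_leR (ρ : M.Env Γ) (s t : Tm Γ .one) :
    (leR s t).Sat ρ ↔ ∀ n, approx (s.eval ρ) n ≤ approx (t.eval ρ) n + 2 := by
  simp only [leR, Fm.sat_all, sat_le, eval_add, eval_posPart, eval_negPart, Tm.eval_wk,
    Tm.eval_var, Interp.Env.cons_z, eval_num, map_add, approx, Nat.cast_ofNat, map_ofNat]
  refine forall_congr' fun n => ?_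
  constructor <;> intro h <;> linarith

theorem sat_ltR (ρ : M.Env Γ) (s t : Tm Γ .one) :
    (ltR s t).Sat ρ ↔ ∃ n, approx (s.eval ρ) n + 2 < approx (t.eval ρ) n := by
  simp only [ltR, Fm.sat_ex, sat_le, eval_add, eval_succ, eval_posPart, eval_negPart, Tm.eval_wk,
    Tm.eval_var, Interp.Env.cons_z, eval_num, map_add, approx, Nat.cast_ofNat, map_ofNat, toZ_S]
  refine exists_congr fun n => ?_
  constructor
  · intro h
    linarith
  · intro h
    linarith [add_one_le_of_lt h]

theorem sat_eqR (ρ : M.Env Γ) (s t : Tm Γ .one) :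
    (eqR s t).Sat ρ ↔ ∀ n, |approx (s.eval ρ) n - approx (t.eval ρ) n| ≤ 2 := by
  simp only [eqR, Fm.sat_all, Fm.sat_and, sat_le, eval_add, eval_posPart, eval_negPart, Tm.eval_wk,
    Tm.eval_var, Interp.Env.cons_z, eval_num, map_add, approx, Nat.cast_ofNat, map_ofNat]
  refine forall_congr' fun n => ?_
  rw [abs_le]
  constructor <;> rintro ⟨h₁, h₂⟩ <;> constructor <;> linarith

/-! ### The operations on real numbers -/

def rAdd (α β : M.D .one) : M.D .one := M.app (M.app (addRTm.eval .nil) α) β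
def rNeg (α : M.D .one) : M.D .one := M.app (negRTm.eval .nil) α
def rMax (α β : M.D .one) : M.D .one := M.app (M.app (maxRTm.eval .nil) α) β
def rMul (α β : M.D .one) : M.D .one := M.app (M.app (mulRTm.eval .nil) α) β
def rNat (n : M.D .nat) : M.D .one := M.app (natRTm.eval .nil) n
def rInv (n : M.D .nat) : M.D .one := M.app (invSuccTm.eval .nil) n

section

variable (ρ : M.Env Γ)

@[simp] theorem eval_addR (α β : Tm Γ .one) :
    (addR α β).eval ρ = rAdd (α.eval ρ) (β.eval ρ) := by
  simp only [addR, Tm.eval_app, Tm.eval_cl]; rfl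

@[simp] theorem eval_negR (α : Tm Γ .one) : (negR α).eval ρ = rNeg (α.eval ρ) := by
  simp only [negR, Tm.eval_app, Tm.eval_cl]; rfl

@[simp] theorem eval_subR (α β : Tm Γ .one) :
    (subR α β).eval ρ = rAdd (α.eval ρ) (rNeg (β.eval ρ)) := by
  simp only [subR, eval_addR, eval_negR]

@[simp] theorem eval_maxR (α β : Tm Γ .one) :
    (maxR α β).eval ρ = rMax (α.eval ρ) (β.eval ρ) := by
  simp only [maxR, Tm.eval_app, Tm.eval_cl]; rfl

@[simp] theorem eval_absR (α : Tm Γ .one) :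
    (absR α).eval ρ = rMax (α.eval ρ) (rNeg (α.eval ρ)) := by
  simp only [absR, eval_maxR, eval_negR]

@[simp] theorem eval_mulR (α β : Tm Γ .one) :
    (mulR α β).eval ρ = rMul (α.eval ρ) (β.eval ρ) := by
  simp only [mulR, Tm.eval_app, Tm.eval_cl]; rfl

@[simp] theorem eval_natR (n : Tm Γ .nat) : (natR n).eval ρ = rNat (n.eval ρ) := by
  simp only [natR, Tm.eval_app, Tm.eval_cl]; rfl

@[simp] theorem eval_invSucc (n : Tm Γ .nat) : (invSucc n).eval ρ = rInv (n.eval ρ) := by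
  simp only [invSucc, Tm.eval_app, Tm.eval_cl]; rfl

end

theorem two_five : two (5 : M.D .nat) = 32 := by
  have h : (5 : M.D .nat) = S (S (S (S (S 0)))) := by simp only [S_eq]; norm_num
  rw [h, two_S, two_S, two_S, two_S, two_S, two_zero]
  norm_num

theorem abs_approx_add_five (α : M.D .one) (n : M.D .nat) :
    |approx α (n + 5) - 32 * approx α n| ≤ 31 := by
  have := abs_approx_add α n 5
  rw [two_five] at this
  exact this.trans (by norm_num)

theorem abs_approx_S_add_five (α : M.D .one) (n : M.D .nat) :
    |approx α (S n + 5) - 2 * approx α (n + 5)| ≤ 1 := by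
  rw [S_add]
  exact abs_approx_S α _

/-- In units of 1/32, the rounding costs 16 and each summand, read five places later, costs 31; the
sum 78 is below 3·32. -/
theorem approx_rAdd (α β : M.D .one) (n : M.D .nat) :
    |approx (rAdd α β) n - (approx α n + approx β n)| ≤ 3 := by
  obtain ⟨p, m, h, hd⟩ : ∃ p m, rAdd α β = dig p m ∧
      ∀ n, diff p m n = approx α (n + 5) + approx β (n + 5) := by
    refine ⟨_, _, by simp only [rAdd, addRTm, app_lam, eval_digits]; rfl, fun n => ?_⟩
    simp [diff, approx]
    ring
  rw [h]
  have h₁ := abs_approx_dig p m (fun n => by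
    have ha := abs_approx_S_add_five α n
    have hb := abs_approx_S_add_five β n
    rw [hd, hd]
    rw [abs_le] at ha hb ⊢
    constructor <;> linarith [ha.1, ha.2, hb.1, hb.2]) n
  have ha := abs_approx_add_five α n
  have hb := abs_approx_add_five β n
  rw [hd] at h₁
  rw [abs_le] at ha hb h₁ ⊢
  constructor <;> linarith [ha.1, ha.2, hb.1, hb.2, h₁.1, h₁.2]

theorem approx_rNeg (α : M.D .one) (n : M.D .nat) : |approx (rNeg α) n + approx α n| ≤ 2 := by
  obtain ⟨p, m, h, hd⟩ : ∃ p m, rNeg α = dig p m ∧ ∀ n, diff p m n = -approx α (n + 5) := by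
    refine ⟨_, _, by simp only [rNeg, negRTm, app_lam, eval_digits]; rfl, fun n => ?_⟩
    simp [diff, approx]
  rw [h]
  have h₁ := abs_approx_dig p m (fun n => by
    have ha := abs_approx_S_add_five α n
    rw [hd, hd]
    rw [abs_le] at ha ⊢
    constructor <;> linarith [ha.1, ha.2]) n
  have ha := abs_approx_add_five α n
  rw [hd] at h₁
  rw [abs_le] at ha h₁ ⊢
  constructor <;> linarith [ha.1, ha.2, h₁.1, h₁.2]

theorem approx_rMax (α β : M.D .one) (n : M.D .nat) :
    |approx (rMax α β) n - max (approx α n) (approx β n)| ≤ 3 := by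
  obtain ⟨p, m, h, hd⟩ : ∃ p m, rMax α β = dig p m ∧
      ∀ n, diff p m n = max (approx α (n + 5)) (approx β (n + 5)) := by
    refine ⟨_, _, by simp only [rMax, maxRTm, app_lam, eval_digits]; rfl, fun n => ?_⟩
    simp only [diff, approx, app_lam, eval_maxN, eval_add, eval_posPart, eval_negPart, toZ_maxN,
      Tm.eval_var, Interp.Env.cons_z, Interp.Env.cons_s, eval_num, Nat.cast_ofNat]
    rw [map_add, map_add, map_add, ← max_sub_sub_right]
    congr 1 <;> ring
  rw [h]
  have hmax : ∀ {a b a' b' c : M.Z}, |a - a'| ≤ c → |b - b'| ≤ c → |max a b - max a' b'| ≤ c :=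
    fun h h' => (abs_max_sub_max_le_max _ _ _ _).trans (max_le h h')
  have h₁ := abs_approx_dig p m (fun n => by
    have := hmax (abs_approx_S_add_five α n) (abs_approx_S_add_five β n)
    rw [← mul_max_of_nonneg _ _ (by norm_num : (0 : M.Z) ≤ 2)] at this
    rw [hd, hd]
    exact this.trans (by norm_num)) n
  have ha := hmax (abs_approx_add_five α n) (abs_approx_add_five β n)
  rw [← mul_max_of_nonneg _ _ (by norm_num : (0 : M.Z) ≤ 32)] at ha
  rw [hd] at h₁
  rw [abs_le] at ha h₁ ⊢
  constructor <;> linarith [ha.1, ha.2, h₁.1, h₁.2]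

theorem approx_rNat (k n : M.D .nat) : approx (rNat k) n = two n * toZ k := by
  have h0 : M.app (rNat k) 0 = 2 * (k - 0) + pre (2 * (0 - k)) := by
    rw [sub_eq_zero_of_le (m := 0) (by rw [map_zero]; exact toZ_nonneg k), mul_zero, pre_zero,
      add_zero, Model.sub_zero]
    simp [rNat, natRTm]
  have hS : ∀ n, M.app (rNat k) (S n) = 1 := by
    intro n
    simp [rNat, natRTm]
  have := induction (.eq (posPart (natR x1) x0) (pow2 x0 ⊠ x1 ⊹ negPart (natR x1) x0))
    (.cons k .nil)
  simp only [Fm.sat_eq, eval_add, eval_mul, eval_posPart, eval_negPart, eval_pow2, eval_natR,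
    Tm.eval_var, Interp.Env.cons_z, Interp.Env.cons_s] at this
  have key : ∀ n, pos (rNat k) n = pow n * k + neg (rNat k) n ↔
      approx (rNat k) n = two n * toZ k := by
    intro n
    rw [← toZ_injective.eq_iff, map_add, map_mul, approx, two]
    constructor <;> intro h <;> linear_combination h
  rw [← key]
  refine this ((key 0).2 ?_) (fun n hn => (key _).2 ?_) n
  · rw [approx_zero_of_code _ _ _ h0, two_zero, map_zero]
    ring
  · rw [approx_S, (key n).1 hn, hS, map_one, min_eq_left (by norm_num), two_S]
    ring

/-- The estimate is multiplied by `k + 1`, to stay within the integers of the model. The quotients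
of 2^(n+5) by `k + 1` nearly double from one place to the next, well within the bound 15 for `dig`.
-/
theorem approx_rInv (k n : M.D .nat) :
    |(toZ k + 1) * approx (rInv k) n - two n| ≤ toZ k + 1 := by
  have hk := toZ_nonneg k
  obtain ⟨p, m, h, hd⟩ : ∃ p m, rInv k = dig p m ∧
      ∀ n, diff p m n = toZ (quo (pow (n + 5)) (S k)) := by
    refine ⟨_, _, by simp only [rInv, invSuccTm, app_lam, eval_digits]; rfl, fun n => ?_⟩
    simp [diff]
  rw [h]
  have hq : ∀ n, diff p m n * (toZ k + 1) ≤ 32 * two n ∧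
      32 * two n < (diff p m n + 1) * (toZ k + 1) := by
    intro n
    have := quo_spec (pow (n + 5)) (S k) (by rw [toZ_S]; linarith)
    rw [← hd, toZ_S] at this
    have e := two_add n 5
    rw [two_five, two] at e
    rw [e] at this
    exact ⟨by linarith [this.1], by linarith [this.2]⟩
  have h₁ := abs_approx_dig p m (fun n => by
    have h₀ := hq n
    have h₁ := hq (S n)
    rw [two_S] at h₁
    have hlo : -1 ≤ diff p m (S n) - 2 * diff p m n := by
      by_contra hlt
      have := mul_le_mul_of_nonneg_right (add_one_le_of_lt (not_le.1 hlt))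
        (by linarith : 0 ≤ toZ k + 1)
      linarith [h₀.1, h₁.2]
    have hhi : diff p m (S n) - 2 * diff p m n ≤ 2 := by
      by_contra hlt
      have := mul_le_mul_of_nonneg_right (add_one_le_of_lt (not_le.1 hlt))
        (by linarith : 0 ≤ toZ k + 1)
      linarith [h₀.2, h₁.1]
    rw [abs_le]
    constructor <;> linarith) n
  have h₀ := hq n
  have h₂ : |32 * ((toZ k + 1) * approx (dig p m) n) - (toZ k + 1) * diff p m n| ≤
      (toZ k + 1) * 16 := by
    rw [show 32 * ((toZ k + 1) * approx (dig p m) n) - (toZ k + 1) * diff p m n =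
      (toZ k + 1) * (32 * approx (dig p m) n - diff p m n) by ring, abs_mul,
      abs_of_nonneg (by linarith : 0 ≤ toZ k + 1)]
    exact mul_le_mul_of_nonneg_left h₁ (by linarith)
  rw [abs_le] at h₂ ⊢
  constructor <;> linarith [h₀.1, h₀.2, h₂.1, h₂.2]

theorem abs_approx_zero_le (α : M.D .one) : |approx α 0| ≤ toZ (pos α 0) + toZ (neg α 0) := by
  have h₁ := toZ_nonneg (pos α 0)
  have h₂ := toZ_nonneg (neg α 0)
  rw [approx, abs_le]
  constructor <;> linarith

/-- Each factor at place n carries a factor 2^n, so the product of the approximations is compared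
with 2^n times that of `rMul α β`. Some constant `c` is enough, by `approx_le_of_bounded`. -/
theorem approx_rMul (α β : M.D .one) : ∃ c : M.Z, ∀ n,
    |two n * approx (rMul α β) n - approx α n * approx β n| ≤ c * two n := by
  obtain ⟨K, hK⟩ : ∃ K : M.D .nat, K = pos α 0 + neg α 0 + pos β 0 + neg β 0 + 3 := ⟨_, rfl⟩
  obtain ⟨p, m, h, hd⟩ : ∃ p m, rMul α β = dig p m ∧ ∀ n, diff p m n =
      toZ (quo (pos α (n + 5 + K) * pos β (n + 5 + K) + neg α (n + 5 + K) * neg β (n + 5 + K))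
        (pow (n + 5 + K + K))) -
      toZ (quo (pos α (n + 5 + K) * neg β (n + 5 + K) + neg α (n + 5 + K) * pos β (n + 5 + K))
        (pow (n + 5 + K + K))) := by
    refine ⟨_, _, by simp only [rMul, mulRTm, app_lam, eval_digits]; rfl, fun n => ?_⟩
    subst hK
    simp [diff, mulPrec, mulBound]
  have hKb : |approx α 0| + |approx β 0| + 3 ≤ toZ K := by
    have ha := abs_approx_zero_le α
    have hb := abs_approx_zero_le β
    rw [hK, map_add, map_add, map_add, map_add, map_ofNat]
    linarith
  have hK2 := toZ_lt_two K
  have hab : ∀ n, |approx α n| + |approx β n| ≤ two n * toZ K := by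
    intro n
    have ha := abs_approx_le α n
    have hb := abs_approx_le β n
    have := mul_le_mul_of_nonneg_left hKb (two_pos n).le
    linarith [two_pos n]
  have hP : ∀ n, |two (n + 5 + K + K) * diff p m n -
      approx α (n + 5 + K) * approx β (n + 5 + K)| ≤ two (n + 5 + K + K) := by
    intro n
    have h₁ := quo_spec (pos α (n + 5 + K) * pos β (n + 5 + K) +
      neg α (n + 5 + K) * neg β (n + 5 + K)) (pow (n + 5 + K + K)) (one_le_two _)
    have h₂ := quo_spec (pos α (n + 5 + K) * neg β (n + 5 + K) +
      neg α (n + 5 + K) * pos β (n + 5 + K)) (pow (n + 5 + K + K)) (one_le_two _)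
    simp only [map_add toZ (_ * _), map_mul] at h₁ h₂
    rw [hd, approx, approx, two, abs_le]
    constructor <;> linarith [h₁.1, h₁.2, h₂.1, h₂.2]
  rw [h]
  -- Write N = n + 5 + K and L = N + K. At the next place the factors are 2a + d and 2b + e with
  -- |d|, |e| ≤ 1, and the quotients have total error at most one unit, that is 2^L before division.
  -- So consecutive values double up to an error far below 15.
  have h₁ := abs_approx_dig p m fun n => by
    have h₀ := hP n
    have h₁ := hP (S n)
    simp only [S_add, two_S] at h₁
    obtain ⟨d, hd⟩ : ∃ d, d = approx α (S (n + 5 + K)) - 2 * approx α (n + 5 + K) := ⟨_, rfl⟩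
    obtain ⟨e, he⟩ : ∃ e, e = approx β (S (n + 5 + K)) - 2 * approx β (n + 5 + K) := ⟨_, rfl⟩
    have hd1 : |d| ≤ 1 := by rw [hd]; exact abs_approx_S α _
    have he1 : |e| ≤ 1 := by rw [he]; exact abs_approx_S β _
    have hda : approx α (S (n + 5 + K)) = 2 * approx α (n + 5 + K) + d := by rw [hd]; ring
    have heb : approx β (S (n + 5 + K)) = 2 * approx β (n + 5 + K) + e := by rw [he]; ring
    rw [hda, heb] at h₁
    -- This is the reason for the precision and the divisor: |a| + |b| ≤ 2^N K ≤ 2^(N+K).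
    have hL : |approx α (n + 5 + K)| + |approx β (n + 5 + K)| ≤ two (n + 5 + K + K) := by
      refine (hab _).trans ?_
      rw [two_add (n + 5 + K) K]
      exact mul_le_mul_of_nonneg_left hK2.le (two_pos _).le
    have hae : |approx α (n + 5 + K) * e| ≤ |approx α (n + 5 + K)| := by
      rw [abs_mul]
      exact mul_le_of_le_one_right (abs_nonneg _) he1
    have hbd : |approx β (n + 5 + K) * d| ≤ |approx β (n + 5 + K)| := by
      rw [abs_mul]
      exact mul_le_of_le_one_right (abs_nonneg _) hd1
    have hde : |d * e| ≤ 1 := by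
      rw [abs_mul]
      exact mul_le_one₀ hd1 (abs_nonneg _) he1
    have h2 := one_le_two (n + 5 + K + K)
    rw [abs_le] at h₀ h₁ hae hbd hde ⊢
    constructor
    · by_contra hlt
      have := mul_le_mul_of_nonneg_left (not_le.1 hlt).le (two_pos (n + 5 + K + K)).le
      linarith [h₀.1, h₀.2, h₁.1, h₁.2, hae.1, hae.2, hbd.1, hbd.2, hde.1, hde.2]
    · by_contra hlt
      have := mul_le_mul_of_nonneg_left (not_le.1 hlt).le (two_pos (n + 5 + K + K)).le
      linarith [h₀.1, h₀.2, h₁.1, h₁.2, hae.1, hae.2, hbd.1, hbd.2, hde.1, hde.2]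
  -- Of the constant, 16 comes from rounding, 1 from the quotients, 1 from the product of the two
  -- tails `d * e`, and `K` from |a| + |b| ≤ 2^n K.
  refine ⟨18 + toZ K, fun n => ?_⟩
  have hx := h₁ n
  have hp := hP n
  obtain ⟨T, hT⟩ : ∃ T, T = two (5 + K) := ⟨_, rfl⟩
  have hT0 : 1 ≤ T := hT ▸ one_le_two _
  have hT5 : T = 32 * two K := by rw [hT, two_add, two_five]
  have hL : two (n + 5 + K + K) = two n * T * two K := by
    rw [two_add, add_assoc n, two_add, hT]
  have ha := abs_approx_add α n (5 + K)
  have hb := abs_approx_add β n (5 + K)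
  rw [← add_assoc, ← hT] at ha hb
  rw [hL] at hp
  obtain ⟨d, hd⟩ : ∃ d, d = approx α (n + 5 + K) - T * approx α n := ⟨_, rfl⟩
  obtain ⟨e, he⟩ : ∃ e, e = approx β (n + 5 + K) - T * approx β n := ⟨_, rfl⟩
  rw [← hd] at ha
  rw [← he] at hb
  have hda : approx α (n + 5 + K) = T * approx α n + d := by rw [hd]; ring
  have heb : approx β (n + 5 + K) = T * approx β n + e := by rw [he]; ring
  rw [hda, heb] at hp
  have hda' : |d| ≤ T := by linarith
  have heb' : |e| ≤ T := by linarith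
  set a := approx α n
  set b := approx β n
  set X := approx (dig p m) n
  have h2n := one_le_two n
  have h2K := one_le_two K
  have e₁ : |two n * T * two K * (32 * X - diff p m n)| ≤ two n * T * two K * 16 := by
    rw [abs_mul, abs_of_nonneg (by positivity)]
    exact mul_le_mul_of_nonneg_left hx (by positivity)
  have e₂ : T ^ 2 * |two n * X - a * b| ≤ T ^ 2 * (17 * two n + (|a| + |b|) + 1) := by
    rw [← abs_of_nonneg (by positivity : 0 ≤ T ^ 2), ← abs_mul, abs_of_nonneg (by positivity : 0 ≤ T ^ 2)]
    have e₃ : T ^ 2 * (two n * X - a * b) = two n * T * two K * (32 * X - diff p m n) +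
        (two n * T * two K * diff p m n - (T * a + d) * (T * b + e)) + (T * (a * e) + T * (b * d) +
          d * e) := by
      have : T ^ 2 * (two n * X) = two n * T * two K * (32 * X) := by
        rw [pow_two]
        nth_rewrite 2 [hT5]
        ring
      rw [mul_sub, this]
      ring
    have e₄ : |T * (a * e) + T * (b * d) + d * e| ≤ T ^ 2 * (|a| + |b| + 1) := by
      have h₁ : |T * (a * e)| ≤ T ^ 2 * |a| := by
        rw [abs_mul, abs_mul, abs_of_nonneg (by linarith : 0 ≤ T)]
        have := mul_le_mul_of_nonneg_left heb' (mul_nonneg (by linarith : 0 ≤ T) (abs_nonneg a))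
        linarith
      have h₂ : |T * (b * d)| ≤ T ^ 2 * |b| := by
        rw [abs_mul, abs_mul, abs_of_nonneg (by linarith : 0 ≤ T)]
        have := mul_le_mul_of_nonneg_left hda' (mul_nonneg (by linarith : 0 ≤ T) (abs_nonneg b))
        linarith
      have h₃ : |d * e| ≤ T ^ 2 := by
        rw [abs_mul, pow_two]
        exact mul_le_mul hda' heb' (abs_nonneg _) (by linarith)
      refine (abs_add_le _ _).trans ?_
      have := abs_add_le (T * (a * e)) (T * (b * d))
      linarith
    rw [e₃]
    refine (abs_add_le _ _).trans ?_
    have := abs_add_le (two n * T * two K * (32 * X - diff p m n))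
      (two n * T * two K * diff p m n - (T * a + d) * (T * b + e))
    have h₅ : two n * T * two K ≤ T ^ 2 * two n := by
      have : two n * T * two K ≤ two n * T * T :=
        mul_le_mul_of_nonneg_left (by linarith) (by positivity)
      linarith
    linarith
  have e₃ := le_of_mul_le_mul_left e₂ (by positivity)
  have e₄ := hab n
  linarith

/-! ### The ordered ring of real numbers of the model -/

/-- The function `f / e`, with denominators `e`, approximates the real number `α` up to an error of
the order of `1 / 2 ^ n`. -/
def Rep (e : M.D .nat → M.Z) (α : M.D .one) (f : M.D .nat → M.Z) : Prop :=
  ∃ c, ∀ n, |e n * approx α n - f n| ≤ c * e n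

theorem rep_approx (α : M.D .one) : Rep (fun _ => 1) α (approx α) :=
  ⟨0, fun n => by simp⟩

section

variable {e e' f g : M.D .nat → M.Z} {α β : M.D .one}

theorem Rep.congr (h : Rep e α f) (he : ∀ n, e n = e' n) (hf : ∀ n, f n = g n) :
    Rep e' α g := by
  rwa [← funext he, ← funext hf]

theorem Rep.add (he : ∀ n, 0 < e n) (h : Rep e α f) (h' : Rep e β g) :
    Rep e (rAdd α β) fun n => f n + g n := by
  obtain ⟨c, hc⟩ := h
  obtain ⟨d, hd⟩ := h'
  refine ⟨c + d + 3, fun n => ?_⟩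
  have h₁ := mul_le_mul_of_nonneg_left (approx_rAdd α β n) (he n).le
  rw [← abs_of_pos (he n), ← abs_mul, abs_of_pos (he n)] at h₁
  have h₂ := hc n
  have h₃ := hd n
  rw [abs_le] at h₁ h₂ h₃ ⊢
  constructor <;> linarith [h₁.1, h₁.2, h₂.1, h₂.2, h₃.1, h₃.2]

theorem Rep.neg (he : ∀ n, 0 < e n) (h : Rep e α f) : Rep e (rNeg α) fun n => -f n := by
  obtain ⟨c, hc⟩ := h
  refine ⟨c + 2, fun n => ?_⟩
  have h₁ := mul_le_mul_of_nonneg_left (approx_rNeg α n) (he n).le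
  rw [← abs_of_pos (he n), ← abs_mul, abs_of_pos (he n)] at h₁
  have h₂ := hc n
  rw [abs_le] at h₁ h₂ ⊢
  constructor <;> linarith [h₁.1, h₁.2, h₂.1, h₂.2]

theorem Rep.scale (he' : ∀ n, 0 < e' n) (h : Rep e α f) :
    Rep (fun n => e n * e' n) α fun n => f n * e' n := by
  obtain ⟨c, hc⟩ := h
  refine ⟨c, fun n => ?_⟩
  have := mul_le_mul_of_nonneg_right (hc n) (he' n).le
  rw [← abs_of_pos (he' n), ← abs_mul, abs_of_pos (he' n)] at this
  rwa [← mul_assoc, show e n * e' n * approx α n - f n * e' n =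
    (e n * approx α n - f n) * e' n by ring]

/-- The extra denominator 2^n appears because both numerators are already scaled by 2^n. -/
theorem Rep.mul (he : ∀ n, 0 < e n) (he' : ∀ n, 0 < e' n) (h : Rep e α f) (h' : Rep e' β g) :
    Rep (fun n => e n * e' n * two n) (rMul α β) fun n => f n * g n := by
  obtain ⟨c, hc⟩ := h
  obtain ⟨d, hd⟩ := h'
  obtain ⟨r, hr⟩ := approx_rMul α β
  have hc0 : 0 ≤ c := by
    by_contra h
    have := (abs_nonneg _).trans (hc 0)
    nlinarith [he 0]
  have hd0 : 0 ≤ d := by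
    by_contra h
    have := (abs_nonneg _).trans (hd 0)
    nlinarith [he' 0]
  refine ⟨r + c * (|approx β 0| + 1) + (|approx α 0| + 1 + c) * d, fun n => ?_⟩
  have h2 := one_le_two n
  have hE := (mul_pos (he n) (he' n)).le
  have ha := abs_approx_le α n
  have hb := abs_approx_le β n
  have e₁ : |e n * e' n * (two n * approx (rMul α β) n - approx α n * approx β n)| ≤
      e n * e' n * (r * two n) := by
    rw [abs_mul, abs_of_nonneg hE]
    exact mul_le_mul_of_nonneg_left (hr n) hE
  have e₂ : |(e n * approx α n - f n) * (e' n * approx β n)| ≤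
      e n * e' n * two n * (c * (|approx β 0| + 1)) := by
    rw [abs_mul, abs_mul, abs_of_pos (he' n)]
    calc _ ≤ (c * e n) * (e' n * (two n * (|approx β 0| + 1))) :=
          mul_le_mul (hc n) (mul_le_mul_of_nonneg_left (by linarith) (he' n).le)
            (mul_nonneg (he' n).le (abs_nonneg _)) (mul_nonneg hc0 (he n).le)
      _ = _ := by ring
  have hf : |f n| ≤ e n * (two n * (|approx α 0| + 1 + c)) := by
    have h₁ := abs_sub_abs_le_abs_sub (f n) (e n * approx α n)
    rw [abs_sub_comm, abs_mul, abs_of_pos (he n)] at h₁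
    have h₂ := hc n
    have h₃ := mul_le_mul_of_nonneg_left ha (he n).le
    have h₄ : c * e n * 1 ≤ c * e n * two n :=
      mul_le_mul_of_nonneg_left h2 (mul_nonneg hc0 (he n).le)
    linarith [he n]
  have e₃ : |f n * (e' n * approx β n - g n)| ≤
      e n * e' n * two n * ((|approx α 0| + 1 + c) * d) := by
    rw [abs_mul]
    calc _ ≤ (e n * (two n * (|approx α 0| + 1 + c))) * (d * e' n) :=
          mul_le_mul hf (hd n) (abs_nonneg _) ((abs_nonneg _).trans hf)
      _ = _ := by ring
  have e₄ : e n * e' n * two n * approx (rMul α β) n - f n * g n =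
      e n * e' n * (two n * approx (rMul α β) n - approx α n * approx β n) +
      (e n * approx α n - f n) * (e' n * approx β n) + f n * (e' n * approx β n - g n) := by ring
  rw [e₄]
  refine (abs_add_le _ _).trans ?_
  have := abs_add_le (e n * e' n * (two n * approx (rMul α β) n - approx α n * approx β n))
    ((e n * approx α n - f n) * (e' n * approx β n))
  linarith

theorem Rep.approx_le (he : ∀ n, 0 < e n) (h : Rep e α f) (h' : Rep e β g)
    (hfg : ∀ n, f n ≤ g n) (n : M.D .nat) : approx α n ≤ approx β n + 2 := by
  obtain ⟨c, hc⟩ := h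
  obtain ⟨d, hd⟩ := h'
  refine approx_le_of_bounded (c := c + d) (fun n => ?_) n
  have h₁ := hc n
  have h₂ := hd n
  have h₃ := hfg n
  rw [abs_le] at h₁ h₂
  refine le_of_mul_le_mul_left ?_ (he n)
  linarith [h₁.2, h₂.1]

end

/-! ### The ring of real numbers as a quotient. -/

def realSetoid (M : Model) : Setoid (M.D .one) where
  r α β := ∀ n, |approx α n - approx β n| ≤ 2
  iseqv :=
    { refl := fun α n => by simp
      symm := fun h n => by rw [abs_sub_comm]; exact h n
      trans := fun {α β γ} h h' n => by
        have h₁ := approx_le_of_bounded (α := α) (β := γ) (c := 4) (fun n => by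
          have h₁ := (abs_le.1 (h n)).2
          have h₂ := (abs_le.1 (h' n)).2
          linarith) n
        have h₂ := approx_le_of_bounded (α := γ) (β := α) (c := 4) (fun n => by
          have h₁ := (abs_le.1 (h n)).1
          have h₂ := (abs_le.1 (h' n)).1
          linarith) n
        rw [abs_le]
        constructor <;> linarith }

variable (M) in
/-- The real numbers of the model, up to equality of real numbers. -/
def R : Type := Quotient (realSetoid M)

def rmk (α : M.D .one) : M.R := Quotient.mk (realSetoid M) α

theorem rmk_eq {α β : M.D .one} : rmk α = rmk β ↔ ∀ n, |approx α n - approx β n| ≤ 2 :=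
  Quotient.eq

theorem R.ind {P : M.R → Prop} (h : ∀ α, P (rmk α)) (x : M.R) : P x := Quotient.ind h x

/-- Reduces each ring axiom for real numbers to the same identity for the integer sequences that
represent both sides over a common denominator. -/
theorem rmk_eq_of_rep {e f g : M.D .nat → M.Z} {α β : M.D .one} (he : ∀ n, 0 < e n)
    (h : Rep e α f) (h' : Rep e β g) (hfg : ∀ n, f n = g n) : rmk α = rmk β := by
  rw [rmk_eq]
  intro n
  have h₁ := h.approx_le he h' (fun n => (hfg n).le) n
  have h₂ := h'.approx_le he h (fun n => (hfg n).ge) n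
  rw [abs_le]
  constructor <;> linarith

theorem rep_of_rmk_eq {α β : M.D .one} (h : rmk α = rmk β) : Rep (fun _ => 1) α (approx β) :=
  ⟨2, fun n => by simpa using rmk_eq.1 h n⟩

theorem one_pos' : ∀ _ : M.D .nat, (0 : M.Z) < 1 := fun _ => one_pos

theorem rep_rNat (k : M.D .nat) : Rep (fun _ => 1) (rNat k) fun n => two n * toZ k :=
  (rep_approx _).congr (fun _ => rfl) (approx_rNat k)

instance : Zero M.R := ⟨rmk (rNat 0)⟩
instance : One M.R := ⟨rmk (rNat 1)⟩

instance : Add M.R :=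
  ⟨Quotient.map₂ rAdd fun _ _ h _ _ h' => Quotient.exact <| rmk_eq_of_rep one_pos'
    ((rep_of_rmk_eq (Quotient.sound h)).add one_pos' (rep_of_rmk_eq (Quotient.sound h')))
    ((rep_approx _).add one_pos' (rep_approx _)) fun _ => rfl⟩

instance : Neg M.R :=
  ⟨Quotient.map rNeg fun _ _ h => Quotient.exact <| rmk_eq_of_rep one_pos'
    ((rep_of_rmk_eq (Quotient.sound h)).neg one_pos') ((rep_approx _).neg one_pos') fun _ => rfl⟩

theorem one_mul_two_pos (n : M.D .nat) : (0 : M.Z) < 1 * 1 * two n := by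
  simpa using two_pos n

instance : Mul M.R :=
  ⟨Quotient.map₂ rMul fun _ _ h _ _ h' => Quotient.exact <| rmk_eq_of_rep one_mul_two_pos
    ((rep_of_rmk_eq (Quotient.sound h)).mul one_pos' one_pos' (rep_of_rmk_eq (Quotient.sound h')))
    ((rep_approx _).mul one_pos' one_pos' (rep_approx _)) fun _ => rfl⟩

theorem rmk_rAdd (α β : M.D .one) : rmk (rAdd α β) = rmk α + rmk β := rfl
theorem rmk_rNeg (α : M.D .one) : rmk (rNeg α) = -rmk α := rfl
theorem rmk_rMul (α β : M.D .one) : rmk (rMul α β) = rmk α * rmk β := rfl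
theorem rmk_rNat_zero : rmk (rNat 0) = (0 : M.R) := rfl
theorem rmk_rNat_one : rmk (rNat 1) = (1 : M.R) := rfl

protected theorem R.mul_comm (x y : M.R) : x * y = y * x := by
  induction x using R.ind with | h α
  induction y using R.ind with | h β
  simp only [← rmk_rMul]
  exact rmk_eq_of_rep one_mul_two_pos ((rep_approx α).mul one_pos' one_pos' (rep_approx β))
    ((rep_approx β).mul one_pos' one_pos' (rep_approx α)) fun n => mul_comm _ _

protected theorem R.one_mul (x : M.R) : 1 * x = x := by
  induction x using R.ind with | h α
  rw [← rmk_rNat_one, ← rmk_rMul]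
  refine rmk_eq_of_rep (e := fun n => 1 * 1 * two n) one_mul_two_pos
    ((rep_rNat 1).mul one_pos' one_pos' (rep_approx α))
    (((rep_approx α).scale two_pos).congr (fun n => by ring) fun n => rfl) fun n => ?_
  rw [map_one]
  ring

protected theorem R.mul_add (x y z : M.R) : x * (y + z) = x * y + x * z := by
  induction x using R.ind with | h α
  induction y using R.ind with | h β
  induction z using R.ind with | h γ
  simp only [← rmk_rMul, ← rmk_rAdd]
  exact rmk_eq_of_rep one_mul_two_pos
    ((rep_approx α).mul one_pos' one_pos' ((rep_approx β).add one_pos' (rep_approx γ)))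
    (((rep_approx α).mul one_pos' one_pos' (rep_approx β)).add one_mul_two_pos
      ((rep_approx α).mul one_pos' one_pos' (rep_approx γ))) fun n => mul_add _ _ _

instance : CommRing M.R where
  add_assoc x y z := by
    induction x using R.ind with | h α
    induction y using R.ind with | h β
    induction z using R.ind with | h γ
    simp only [← rmk_rAdd]
    exact rmk_eq_of_rep one_pos'
      (((rep_approx α).add one_pos' (rep_approx β)).add one_pos' (rep_approx γ))
      ((rep_approx α).add one_pos' ((rep_approx β).add one_pos' (rep_approx γ)))
      fun n => add_assoc _ _ _
  zero_add x := by
    induction x using R.ind with | h α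
    rw [← rmk_rNat_zero, ← rmk_rAdd]
    exact rmk_eq_of_rep one_pos' ((rep_rNat 0).add one_pos' (rep_approx α)) (rep_approx α)
      fun n => by rw [map_zero]; ring
  add_zero x := by
    induction x using R.ind with | h α
    rw [← rmk_rNat_zero, ← rmk_rAdd]
    exact rmk_eq_of_rep one_pos' ((rep_approx α).add one_pos' (rep_rNat 0)) (rep_approx α)
      fun n => by rw [map_zero]; ring
  add_comm x y := by
    induction x using R.ind with | h α
    induction y using R.ind with | h β
    simp only [← rmk_rAdd]
    exact rmk_eq_of_rep one_pos' ((rep_approx α).add one_pos' (rep_approx β))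
      ((rep_approx β).add one_pos' (rep_approx α)) fun n => add_comm _ _
  neg_add_cancel x := by
    induction x using R.ind with | h α
    rw [← rmk_rNat_zero, ← rmk_rNeg, ← rmk_rAdd]
    exact rmk_eq_of_rep one_pos' (((rep_approx α).neg one_pos').add one_pos' (rep_approx α))
      (rep_rNat 0) fun n => by rw [map_zero]; ring
  mul_assoc x y z := by
    induction x using R.ind with | h α
    induction y using R.ind with | h β
    induction z using R.ind with | h γ
    simp only [← rmk_rMul]
    refine rmk_eq_of_rep (e := fun n => 1 * 1 * two n * 1 * two n)
      (fun n => mul_pos (by simpa using two_pos n) (two_pos n))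
      (((rep_approx α).mul one_pos' one_pos' (rep_approx β)).mul one_mul_two_pos one_pos'
        (rep_approx γ))
      (((rep_approx α).mul one_pos' one_mul_two_pos
        ((rep_approx β).mul one_pos' one_pos' (rep_approx γ))).congr (fun n => by ring)
        fun n => rfl) fun n => mul_assoc _ _ _
  mul_comm := R.mul_comm
  one_mul := R.one_mul
  mul_one x := by rw [R.mul_comm, R.one_mul]
  left_distrib := R.mul_add
  right_distrib x y z := by
    rw [R.mul_comm, R.mul_add, R.mul_comm z x, R.mul_comm z y]
  zero_mul x := by
    induction x using R.ind with | h α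
    rw [← rmk_rNat_zero, ← rmk_rMul]
    exact rmk_eq_of_rep one_mul_two_pos ((rep_rNat 0).mul one_pos' one_pos' (rep_approx α))
      (((rep_rNat 0).scale two_pos).congr (fun n => by ring) fun n => rfl)
      fun n => by rw [map_zero]; ring
  mul_zero x := by
    induction x using R.ind with | h α
    rw [← rmk_rNat_zero, ← rmk_rMul]
    exact rmk_eq_of_rep one_mul_two_pos ((rep_approx α).mul one_pos' one_pos' (rep_rNat 0))
      (((rep_rNat 0).scale two_pos).congr (fun n => by ring) fun n => rfl)
      fun n => by rw [map_zero]; ring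
  nsmul := nsmulRec
  zsmul := zsmulRec

/-! ### The order of the real numbers. -/

instance : LE M.R :=
  ⟨Quotient.lift₂ (fun α β => ∀ n, approx α n ≤ approx β n + 2) <| by
    have key : ∀ α β α' β' : M.D .one, rmk α = rmk α' → rmk β = rmk β' →
        (∀ n, approx α n ≤ approx β n + 2) → ∀ n, approx α' n ≤ approx β' n + 2 := by
      intro α β α' β' h h' hab n
      refine approx_le_of_bounded (c := 6) (fun n => ?_) n
      have h₁ := abs_le.1 (rmk_eq.1 h n)
      have h₂ := abs_le.1 (rmk_eq.1 h' n)
      linarith [h₁.1, h₂.2, hab n]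
    intro α β α' β' h h'
    exact propext ⟨key _ _ _ _ (Quotient.sound h) (Quotient.sound h'),
      key _ _ _ _ (Quotient.sound h).symm (Quotient.sound h').symm⟩⟩

theorem rmk_le {α β : M.D .one} : rmk α ≤ rmk β ↔ ∀ n, approx α n ≤ approx β n + 2 := Iff.rfl

theorem not_rmk_le {α β : M.D .one} :
    ¬ rmk α ≤ rmk β ↔ ∃ n, approx β n + 2 < approx α n := by
  rw [rmk_le]
  push Not
  rfl

noncomputable instance : LinearOrder M.R where
  le_refl x := by
    induction x using R.ind with | h α
    exact fun n => by linarith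
  le_trans x y z := by
    induction x using R.ind with | h α
    induction y using R.ind with | h β
    induction z using R.ind with | h γ
    exact fun h h' => approx_le_of_bounded (c := 4) fun n => by linarith [h n, h' n]
  le_antisymm x y := by
    induction x using R.ind with | h α
    induction y using R.ind with | h β
    refine fun h h' => rmk_eq.2 fun n => ?_
    have h₁ := rmk_le.1 h n
    have h₂ := rmk_le.1 h' n
    rw [abs_le]
    constructor <;> linarith
  le_total x y := by
    induction x using R.ind with | h α
    induction y using R.ind with | h β
    by_cases h : rmk α ≤ rmk β
    · exact .inl h
    · obtain ⟨n, hn⟩ := not_rmk_le.1 h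
      exact .inr (rmk_le.2 fun m => approx_le_of_lt hn m)
  toDecidableLE := Classical.decRel _

theorem rmk_lt {α β : M.D .one} : rmk α < rmk β ↔ ∃ n, approx α n + 2 < approx β n := by
  rw [← not_le, not_rmk_le]

instance : IsOrderedAddMonoid M.R where
  add_le_add_left x y h z := by
    induction x using R.ind with | h α
    induction y using R.ind with | h β
    induction z using R.ind with | h γ
    simp only [← rmk_rAdd]
    refine rmk_le.2 (approx_le_of_bounded (c := 8) fun n => ?_)
    have h₁ := abs_le.1 (approx_rAdd α γ n)
    have h₂ := abs_le.1 (approx_rAdd β γ n)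
    linarith [h₁.2, h₂.1, rmk_le.1 h n]

theorem rmk_rNat_nonneg (k : M.D .nat) : 0 ≤ rmk (rNat k) := by
  rw [← rmk_rNat_zero]
  refine rmk_le.2 fun n => ?_
  rw [approx_rNat, approx_rNat, map_zero, mul_zero]
  have := mul_nonneg (two_pos n).le (toZ_nonneg k)
  linarith

instance : ZeroLEOneClass M.R := ⟨rmk_rNat_nonneg 1⟩

instance : Nontrivial M.R := by
  -- At place 0 equality tolerates a difference of 2, so 3 is the least number separated from 0
  -- there.
  refine ⟨rmk (rNat 0), rmk (rNat 3), fun h => ?_⟩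
  have := rmk_eq.1 h 0
  rw [approx_rNat, approx_rNat, map_zero, two_zero, map_ofNat, mul_zero, one_mul, zero_sub,
    abs_neg, abs_of_pos (by norm_num)] at this
  norm_num at this

theorem rmk_pos {α : M.D .one} : 0 < rmk α ↔ ∃ n, 3 ≤ approx α n := by
  rw [← rmk_rNat_zero, rmk_lt]
  refine exists_congr fun n => ?_
  rw [approx_rNat, map_zero, mul_zero, zero_add]
  refine ⟨fun h => ?_, fun h => by linarith⟩
  have := add_one_le_of_lt h
  linarith

instance : IsStrictOrderedRing M.R := .of_mul_pos fun x y hx hy => by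
  induction x using R.ind with | h α
  induction y using R.ind with | h β
  rw [← rmk_rMul]
  obtain ⟨n, hn⟩ := rmk_pos.1 hx
  obtain ⟨m, hm⟩ := rmk_pos.1 hy
  obtain ⟨c, hc⟩ := approx_rMul α β
  -- At place n + m + k both factors are at least 2^k, so the scaled product is at least 2^(2k) -
  -- c·2^(n+m+k). This choice makes it at least 3·2^(n+m+k).
  obtain ⟨k, hk⟩ := exists_lt_two ((c + 3) * two (n + m))
  have ha : two k ≤ approx α (n + m + k) := by
    have h₁ := abs_le.1 (abs_approx_add α n (m + k))
    have h₂ := mul_le_mul_of_nonneg_left hn (two_pos (m + k)).le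
    have h₃ : 1 * two k ≤ two m * two k :=
      mul_le_mul_of_nonneg_right (one_le_two m) (two_pos k).le
    rw [← two_add] at h₃
    rw [add_assoc]
    linarith [h₁.1, two_pos (m + k)]
  have hb : two k ≤ approx β (n + m + k) := by
    have h₁ := abs_le.1 (abs_approx_add β m (n + k))
    have h₂ := mul_le_mul_of_nonneg_left hm (two_pos (n + k)).le
    have h₃ : 1 * two k ≤ two n * two k :=
      mul_le_mul_of_nonneg_right (one_le_two n) (two_pos k).le
    rw [← two_add] at h₃
    rw [add_comm n m, add_assoc]
    linarith [h₁.1, two_pos (n + k)]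
  refine rmk_pos.2 ⟨n + m + k, ?_⟩
  have h₁ := (abs_le.1 (hc (n + m + k))).1
  have h₂ := mul_le_mul ha hb (two_pos k).le ((two_pos k).le.trans ha)
  have h₃ := mul_le_mul_of_nonneg_right hk.le (two_pos k).le
  rw [two_add] at h₁
  refine le_of_mul_le_mul_left ?_ (mul_pos (two_pos (n + m)) (two_pos k))
  linarith

/-- By totality one argument is the larger; the place-by-place maximum differs from it by a bounded
amount. -/
theorem rmk_rMax (α β : M.D .one) : rmk (rMax α β) = max (rmk α) (rmk β) := by
  have key : ∀ α β γ : M.D .one, (∀ n, |approx γ n - max (approx α n) (approx β n)| ≤ 3) →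
      rmk α ≤ rmk β → rmk γ = rmk β := by
    intro α β γ h h'
    have hb : ∀ n, |approx γ n - approx β n| ≤ 5 := by
      intro n
      have h₁ := abs_le.1 (h n)
      have h₂ := rmk_le.1 h' n
      have h₃ := le_max_right (approx α n) (approx β n)
      have h₄ : max (approx α n) (approx β n) ≤ approx β n + 2 := max_le h₂ (by linarith)
      rw [abs_le]
      constructor <;> linarith [h₁.1, h₁.2]
    apply le_antisymm
    · exact rmk_le.2 (approx_le_of_bounded (c := 5) fun n => by linarith [(abs_le.1 (hb n)).2])
    · exact rmk_le.2 (approx_le_of_bounded (c := 5) fun n => by linarith [(abs_le.1 (hb n)).1])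
  rcases le_total (rmk α) (rmk β) with h | h
  · rw [max_eq_right h]
    exact key α β _ (approx_rMax α β) h
  · rw [max_eq_left h]
    refine key β α _ (fun n => ?_) h
    rw [max_comm]
    exact approx_rMax α β n

/-- The embedding of the natural numbers into the real numbers. -/
def nat : M.D .nat →+* M.R where
  toFun k := rmk (rNat k)
  map_zero' := rfl
  map_one' := rfl
  map_add' m n := by
    rw [← rmk_rAdd]
    exact rmk_eq_of_rep one_pos' (rep_rNat _) ((rep_rNat m).add one_pos' (rep_rNat n))
      fun k => by rw [map_add]; ring
  map_mul' m n := by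
    rw [← rmk_rMul]
    exact rmk_eq_of_rep one_mul_two_pos
      (((rep_rNat _).scale two_pos).congr (fun n => by ring) fun n => rfl)
      ((rep_rNat m).mul one_pos' one_pos' (rep_rNat n)) fun k => by rw [map_mul]; ring

theorem rmk_rNat (k : M.D .nat) : rmk (rNat k) = nat k := rfl

theorem nat_nonneg (k : M.D .nat) : 0 ≤ nat k := rmk_rNat_nonneg k

theorem nat_S (k : M.D .nat) : nat (S k) = nat k + 1 := by rw [S_eq, map_add, map_one]

/-- The only inverses that the argument needs; elsewhere denominators are cleared and `R` is used
just as an ordered ring. -/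
theorem rmk_rInv_mul (k : M.D .nat) : (nat k + 1) * rmk (rInv k) = 1 := by
  rw [← nat_S, ← rmk_rNat, ← rmk_rMul, ← rmk_rNat_one]
  refine rmk_eq_of_rep (e := fun n => 1 * 1 * two n) one_mul_two_pos
    (f := fun n => two n * two n) ?_
    (((rep_rNat 1).scale two_pos).congr (fun n => by ring) fun n => by rw [map_one, mul_one])
    fun n => rfl
  obtain ⟨c, hc⟩ := approx_rMul (rNat (S k)) (rInv k)
  refine ⟨c + toZ k + 1, fun n => ?_⟩
  have h₁ := hc n
  rw [approx_rNat, toZ_S] at h₁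
  have h₂ := mul_le_mul_of_nonneg_left (approx_rInv k n) (two_pos n).le
  rw [← abs_of_pos (two_pos n), ← abs_mul, abs_of_pos (two_pos n)] at h₂
  rw [abs_le] at h₁ h₂ ⊢
  constructor <;> linarith [h₁.1, h₁.2, h₂.1, h₂.2]

theorem rmk_rInv_pos (k : M.D .nat) : 0 < rmk (rInv k) := by
  have h := rmk_rInv_mul k
  have h' : 0 < (nat k + 1) * rmk (rInv k) := by rw [h]; exact one_pos
  exact (mul_pos_iff_of_pos_left (by linarith [nat_nonneg k])).1 h'

@[simp] theorem sat_leR_iff (ρ : M.Env Γ) (s t : Tm Γ .one) :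
    (leR s t).Sat ρ ↔ rmk (s.eval ρ) ≤ rmk (t.eval ρ) := sat_leR ρ s t

@[simp] theorem sat_ltR_iff (ρ : M.Env Γ) (s t : Tm Γ .one) :
    (ltR s t).Sat ρ ↔ rmk (s.eval ρ) < rmk (t.eval ρ) := (sat_ltR ρ s t).trans rmk_lt.symm

@[simp] theorem sat_eqR_iff (ρ : M.Env Γ) (s t : Tm Γ .one) :
    (eqR s t).Sat ρ ↔ rmk (s.eval ρ) = rmk (t.eval ρ) := (sat_eqR ρ s t).trans rmk_eq.symm

/-! ### The inner product space of the model -/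

theorem rmk_abs (α : M.D .one) : rmk (rMax α (rNeg α)) = |rmk α| := by
  rw [rmk_rMax, rmk_rNeg, abs]

theorem sat_ax {A : Fm Γ} (h : AxTB A) (ρ : M.Env Γ) : A.Sat ρ := M.isModel.sat ρ h

def xZero : M.D .X := M.con .zeroX
def xAdd (x y : M.D .X) : M.D .X := M.app (M.app (M.con .addX) x) y
def xNeg (x : M.D .X) : M.D .X := M.app (M.con .negX) x
def xSmul (α : M.D .one) (x : M.D .X) : M.D .X := M.app (M.app (M.con .smulX) α) x
def xNorm (x : M.D .X) : M.R := rmk (M.app (M.con .norm) x)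
def xU (x : M.D .X) : M.D .X := M.app (M.con .U) x

section

variable (ρ : M.Env Γ) (x y : Tm Γ .X) (α : Tm Γ .one)

@[simp] theorem eval_zeroX : (zeroX : Tm Γ .X).eval ρ = xZero := rfl
@[simp] theorem eval_addX : (addX x y).eval ρ = xAdd (x.eval ρ) (y.eval ρ) := rfl
@[simp] theorem eval_negX : (negX x).eval ρ = xNeg (x.eval ρ) := rfl
@[simp] theorem eval_subX : (subX x y).eval ρ = xAdd (x.eval ρ) (xNeg (y.eval ρ)) := rfl
@[simp] theorem eval_smulX : (smulX α x).eval ρ = xSmul (α.eval ρ) (x.eval ρ) := rfl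
@[simp] theorem eval_U : (U x).eval ρ = xU (x.eval ρ) := rfl

@[simp] theorem rmk_eval_norm : rmk ((norm x).eval ρ) = xNorm (x.eval ρ) := rfl

@[simp] theorem rmk_eval_dist :
    rmk ((dist x y).eval ρ) = xNorm (xAdd (x.eval ρ) (xNeg (y.eval ρ))) := rfl

@[simp] theorem rmk_eval_normSq : rmk ((normSq x).eval ρ) = xNorm (x.eval ρ) ^ 2 := by
  rw [normSq, eval_mulR, rmk_rMul, rmk_eval_norm, sq]

@[simp] theorem sat_eqX :
    (eqX x y).Sat ρ ↔ xNorm (xAdd (x.eval ρ) (xNeg (y.eval ρ))) = 0 := by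
  simp [eqX, rmk_rNat]

end

section

variable (x y z w : M.D .X)

theorem xNorm_sub_self : xNorm (xAdd x (xNeg x)) = 0 := by
  simpa [rmk_rNat] using sat_ax (.dist_self x0) (.cons x .nil)

theorem xNorm_sub_comm : xNorm (xAdd x (xNeg y)) = xNorm (xAdd y (xNeg x)) := by
  simpa using sat_ax (.dist_comm x0 x1) (.cons x (.cons y .nil))

theorem xNorm_triangle :
    xNorm (xAdd x (xNeg z)) ≤ xNorm (xAdd x (xNeg y)) + xNorm (xAdd y (xNeg z)) := by
  simpa [rmk_rAdd] using sat_ax (.dist_triangle x0 x1 x2) (.cons x (.cons y (.cons z .nil)))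

theorem xNorm_sub_nonneg : 0 ≤ xNorm (xAdd x (xNeg y)) := by
  have := xNorm_triangle x y x
  rw [xNorm_sub_self, xNorm_sub_comm y x] at this
  linarith

theorem xNorm_add_sub_add : xNorm (xAdd (xAdd x y) (xNeg (xAdd z w))) ≤
    xNorm (xAdd x (xNeg z)) + xNorm (xAdd y (xNeg w)) := by
  simpa [rmk_rAdd] using
    sat_ax (.dist_add x0 x1 x2 x3) (.cons x (.cons y (.cons z (.cons w .nil))))

theorem xNorm_neg_sub_neg :
    xNorm (xAdd (xNeg x) (xNeg (xNeg y))) = xNorm (xAdd x (xNeg y)) := by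
  simpa using sat_ax (.dist_neg x0 x1) (.cons x (.cons y .nil))

theorem abs_xNorm_sub_le : |xNorm x - xNorm y| ≤ xNorm (xAdd x (xNeg y)) := by
  simpa [rmk_abs, rmk_rAdd, rmk_rNeg, sub_eq_add_neg] using
    sat_ax (.norm_sub x0 x1) (.cons x (.cons y .nil))

theorem xNorm_smul_sub (α : M.D .one) : xNorm (xAdd (xSmul α x) (xNeg (xSmul α y))) =
    |rmk α| * xNorm (xAdd x (xNeg y)) := by
  simpa [rmk_abs, rmk_rMul] using
    sat_ax (.dist_smul x2 x0 x1) (.cons x (.cons y (.cons α .nil)))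

theorem xNorm_smul_sub_smul (α β : M.D .one) : xNorm (xAdd (xSmul α x) (xNeg (xSmul β x))) =
    |rmk α - rmk β| * xNorm x := by
  simpa [rmk_abs, rmk_rMul, rmk_rAdd, rmk_rNeg, sub_eq_add_neg] using
    sat_ax (.dist_smul_smul x1 x2 x0) (.cons x (.cons α (.cons β .nil)))

theorem xNorm_U_sub_U_le : xNorm (xAdd (xU x) (xNeg (xU y))) ≤ xNorm (xAdd x (xNeg y)) := by
  simpa using sat_ax (.U_nonexpansive x0 x1) (.cons x (.cons y .nil))

end

/-! ### The vectors modulo equality in the space. -/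

def vecSetoid (M : Model) : Setoid (M.D .X) where
  r x y := xNorm (xAdd x (xNeg y)) = 0
  iseqv :=
    { refl := xNorm_sub_self
      symm := fun {x y} h => by rwa [xNorm_sub_comm]
      trans := fun {x y z} h h' => by
        have := xNorm_triangle x y z
        rw [h, h'] at this
        exact le_antisymm (by linarith) (xNorm_sub_nonneg _ _) }

variable (M) in
/-- The vectors of the model, up to equality in the space. -/
def V : Type := Quotient (vecSetoid M)

def vmk (x : M.D .X) : M.V := Quotient.mk (vecSetoid M) x

theorem V.ind {P : M.V → Prop} (h : ∀ x, P (vmk x)) (v : M.V) : P v := Quotient.ind h v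

theorem vmk_eq {x y : M.D .X} : vmk x = vmk y ↔ xNorm (xAdd x (xNeg y)) = 0 := Quotient.eq

instance : Zero M.V := ⟨vmk xZero⟩

instance : Add M.V :=
  ⟨Quotient.map₂ xAdd fun x x' h y y' h' => by
    have := xNorm_add_sub_add x y x' y'
    rw [show xNorm _ = 0 from h, show xNorm _ = 0 from h'] at this
    exact le_antisymm (by linarith) (xNorm_sub_nonneg _ _)⟩

instance : Neg M.V :=
  ⟨Quotient.map xNeg fun x y h => (xNorm_neg_sub_neg x y).trans h⟩

theorem vmk_xAdd (x y : M.D .X) : vmk (xAdd x y) = vmk x + vmk y := rfl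
theorem vmk_xNeg (x : M.D .X) : vmk (xNeg x) = -vmk x := rfl

protected theorem V.add_comm (v w : M.V) : v + w = w + v := by
  induction v using V.ind with | h x
  induction w using V.ind with | h y
  rw [← vmk_xAdd, ← vmk_xAdd, vmk_eq]
  simpa using sat_ax (.add_comm x0 x1) (.cons x (.cons y .nil))

protected theorem V.add_zero (v : M.V) : v + 0 = v := by
  induction v using V.ind with | h x
  refine vmk_eq.2 ?_
  simpa using sat_ax (.add_zero x0) (.cons x .nil)

instance : AddCommGroup M.V where
  add_assoc u v w := by
    induction u using V.ind with | h x
    induction v using V.ind with | h y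
    induction w using V.ind with | h z
    simp only [← vmk_xAdd]
    rw [vmk_eq]
    simpa using sat_ax (.add_assoc x0 x1 x2) (.cons x (.cons y (.cons z .nil)))
  add_comm := V.add_comm
  add_zero := V.add_zero
  zero_add v := by rw [V.add_comm, V.add_zero]
  neg_add_cancel v := by
    rw [V.add_comm]
    induction v using V.ind with | h x
    rw [← vmk_xNeg, ← vmk_xAdd]
    refine vmk_eq.2 ?_
    simpa using sat_ax (.add_neg x0) (.cons x .nil)
  nsmul := nsmulRec
  zsmul := zsmulRec

theorem vmk_xSub (x y : M.D .X) : vmk (xAdd x (xNeg y)) = vmk x - vmk y := by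
  rw [vmk_xAdd, vmk_xNeg, sub_eq_add_neg]

/-- Well defined by passing from `α x` through `α y` to `β y`: one norm axiom changes the vector,
another the scalar. -/
instance : SMul M.R M.V :=
  ⟨Quotient.map₂ xSmul fun α β h x y h' => by
    have h₁ := xNorm_triangle (xSmul α x) (xSmul α y) (xSmul β y)
    rw [xNorm_smul_sub, xNorm_smul_sub_smul, show xNorm (xAdd x (xNeg y)) = 0 from h',
      show rmk α = rmk β from Quotient.sound h, sub_self, abs_zero, mul_zero, zero_mul,
      add_zero] at h₁
    exact le_antisymm h₁ (xNorm_sub_nonneg _ _)⟩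

theorem vmk_xSmul (α : M.D .one) (x : M.D .X) : vmk (xSmul α x) = rmk α • vmk x := rfl

instance : Module M.R M.V :=
  .ofMinimalAxioms
    (fun r v w => by
      induction r using R.ind with | h α
      induction v using V.ind with | h x
      induction w using V.ind with | h y
      simp only [← vmk_xAdd, ← vmk_xSmul]
      rw [vmk_eq]
      simpa using sat_ax (.smul_add x0 x1 x2) (.cons α (.cons x (.cons y .nil))))
    (fun r s v => by
      induction r using R.ind with | h α
      induction s using R.ind with | h β
      induction v using V.ind with | h x
      simp only [← rmk_rAdd, ← vmk_xAdd, ← vmk_xSmul]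
      rw [vmk_eq]
      simpa using sat_ax (.add_smul x0 x1 x2) (.cons α (.cons β (.cons x .nil))))
    (fun r s v => by
      induction r using R.ind with | h α
      induction s using R.ind with | h β
      induction v using V.ind with | h x
      simp only [← rmk_rMul, ← vmk_xSmul]
      rw [vmk_eq]
      simpa using sat_ax (.mul_smul x0 x1 x2) (.cons α (.cons β (.cons x .nil))))
    (fun v => by
      induction v using V.ind with | h x
      rw [← rmk_rNat_one, ← vmk_xSmul, vmk_eq]
      simpa using sat_ax (.one_smul x0) (.cons x .nil))

/-- The norm. -/
def nrm : M.V → M.R :=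
  Quotient.lift xNorm fun x y h => by
    have := abs_xNorm_sub_le x y
    rw [show xNorm _ = 0 from h] at this
    exact sub_eq_zero.1 (abs_nonpos_iff.1 this)

theorem nrm_vmk (x : M.D .X) : nrm (vmk x) = xNorm x := rfl

/-! ### The norm and consequences of the parallelogram law. -/

theorem nrm_zero : nrm (0 : M.V) = 0 := by
  have := xNorm_sub_self (xZero : M.D .X)
  rwa [← nrm_vmk, vmk_xSub, sub_self] at this

theorem nrm_nonneg (v : M.V) : 0 ≤ nrm v := by
  induction v using V.ind with | h x
  have := xNorm_sub_nonneg x xZero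
  rwa [← nrm_vmk, vmk_xSub, show vmk xZero = (0 : M.V) from rfl, sub_zero] at this

theorem nrm_smul (r : M.R) (v : M.V) : nrm (r • v) = |r| * nrm v := by
  induction r using R.ind with | h α
  induction v using V.ind with | h x
  -- Homogeneity is the case β = 0 of the axiom on ‖αx - βx‖.
  have := xNorm_smul_sub_smul x α (rNat 0)
  rw [← nrm_vmk, ← nrm_vmk, vmk_xSub, vmk_xSmul, vmk_xSmul, rmk_rNat_zero, zero_smul, sub_zero,
    sub_zero] at this
  exact this

theorem nrm_parallelogram (v w : M.V) :
    nrm (v + w) ^ 2 + nrm (v - w) ^ 2 = 2 * (nrm v ^ 2 + nrm w ^ 2) := by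
  induction v using V.ind with | h x
  induction w using V.ind with | h y
  rw [← vmk_xSub, ← vmk_xAdd]
  simp only [nrm_vmk]
  simpa [rmk_rAdd, rmk_rMul, rmk_rNat, show nat (2 : M.D .nat) = 2 from map_ofNat nat 2] using
    sat_ax (.parallelogram x0 x1) (.cons x (.cons y .nil))

/-- The identity of Jordan and von Neumann: it expresses additivity of the bilinear form given by ‖v
+ w‖² - ‖v‖² - ‖w‖², and follows from four parallelograms. -/
theorem nrm_add_add_sq (u v w : M.V) : nrm (u + v + w) ^ 2 =
    nrm (u + v) ^ 2 + nrm (u + w) ^ 2 + nrm (v + w) ^ 2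
      - nrm u ^ 2 - nrm v ^ 2 - nrm w ^ 2 := by
  have h₁ := nrm_parallelogram (u + v) w
  have h₂ := nrm_parallelogram u (v - w)
  have h₃ := nrm_parallelogram (u + w) v
  have h₄ := nrm_parallelogram v w
  rw [show u + (v - w) = u + v - w by abel, show u - (v - w) = u + w - v by abel] at h₂
  rw [show u + w + v = u + v + w by abel] at h₃
  linarith

/-- The last bracket stands for 2⟨v, w⟩; no inner product is constructed. Additivity gives the
induction step, with `n w` and `w` as the last two vectors. -/
theorem nrm_add_nat_smul_sq (v w : M.V) (n : M.D .nat) : nrm (v + nat n • w) ^ 2 =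
    nrm v ^ 2 + nat n * nat n * nrm w ^ 2 + nat n * (nrm (v + w) ^ 2 - nrm v ^ 2 - nrm w ^ 2) := by
  induction v using V.ind with | h x
  induction w using V.ind with | h y
  have key := induction (M := M)
    (eqR (normSq (addX x1 (smulX (natR x0) x2)))
      (addR (addR (normSq x1) (mulR (mulR (natR x0) (natR x0)) (normSq x2)))
        (mulR (natR x0) (subR (subR (normSq (addX x1 x2)) (normSq x1)) (normSq x2)))))
    (.cons x (.cons y .nil))
  simp only [sat_eqR_iff, rmk_eval_normSq, eval_addX, eval_smulX, eval_natR, eval_addR, eval_subR,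
    eval_mulR, rmk_rAdd, rmk_rMul, rmk_rNeg, Tm.eval_var, Interp.Env.cons_z, Interp.Env.cons_s,
    ← nrm_vmk, vmk_xAdd, vmk_xSmul, rmk_rNat, ← sub_eq_add_neg] at key
  refine key (by simp) (fun n hn => ?_) n
  have h := nrm_add_add_sq (vmk x) (nat n • vmk y) (vmk y)
  have e₁ : nat n • vmk y + vmk y = (nat n + 1) • vmk y := by module
  rw [add_assoc, e₁, hn, nrm_smul, nrm_smul, mul_pow, mul_pow, sq_abs, sq_abs] at h
  rw [nat_S, h]
  ring

/-- The usual expansion of the square, with 2⟨v, w⟩ written as ‖v‖² + ‖w‖² - ‖v - w‖². Natural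
coefficients suffice once denominators are cleared. -/
theorem nrm_nat_smul_sub_sq (v w : M.V) (m n : M.D .nat) : nrm (nat m • v - nat n • w) ^ 2 =
    nat m * (nat m - nat n) * nrm v ^ 2 + nat n * (nat n - nat m) * nrm w ^ 2 +
      nat m * nat n * nrm (v - w) ^ 2 := by
  have h₁ := nrm_parallelogram (nat m • v) (nat n • w)
  have h₂ := nrm_add_nat_smul_sq (nat m • v) w n
  have h₃ := nrm_add_nat_smul_sq w v m
  have h₄ := nrm_parallelogram v w
  rw [add_comm w (nat m • v), add_comm w v] at h₃
  rw [nrm_smul, nrm_smul, mul_pow, mul_pow, sq_abs, sq_abs] at h₁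
  rw [nrm_smul, mul_pow, sq_abs, h₃] at h₂
  rw [h₂] at h₁
  linear_combination h₁ - nat m * nat n * h₄

/-! ### Browder's sequence -/

/-- Put A = (a + 1)(a + c) and B = (a + c + 1) a, so A - B = c. The hypothesis becomes (AB - a²(a +
c)²) D + c² P ≤ c B (Q - P). Since AB - cB = B² ≥ a²(a + c)², the left side is at least c B D, and c
B > 0 is cancelled. -/
theorem browder_inequality {R : Type*} [CommRing R] [LinearOrder R] [IsStrictOrderedRing R]
    {a c D P Q : R} (ha : 0 < a) (hc : 0 < c) (hD : 0 ≤ D) (hP : 0 ≤ P)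
    (h : (a + 1) * (a + c) * ((a + 1) * (a + c) - (a + c + 1) * a) * P +
      (a + c + 1) * a * ((a + c + 1) * a - (a + 1) * (a + c)) * Q +
      (a + 1) * (a + c) * ((a + c + 1) * a) * D ≤ (a * (a + c)) ^ 2 * D) : D ≤ Q - P := by
  have h₁ : 0 ≤ a * (2 * a * a + 2 * a * c + a) * D := by positivity
  have h₂ : 0 ≤ c * c * P := by positivity
  have h₃ : c * ((a + c + 1) * a) * D ≤ c * ((a + c + 1) * a) * (Q - P) := by linarith
  exact le_of_mul_le_mul_left h₃ (by positivity)

def xu (n : M.D .nat) : M.D .X := M.app (M.con .u) n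

variable (M) in
def xv₀ : M.D .X := M.con .v₀

@[simp] theorem eval_u (ρ : M.Env Γ) (n : Tm Γ .nat) : (u n).eval ρ = xu (n.eval ρ) := rfl
@[simp] theorem eval_v₀ (ρ : M.Env Γ) : (v₀ : Tm Γ .X).eval ρ = xv₀ M := rfl

/-- The sequence `u n - v₀`. -/
def seq (n : M.D .nat) : M.V := vmk (xu n) - vmk (xv₀ M)

theorem nrm_seq_le (n : M.D .nat) : nrm (seq n) ≤ nat (M.con .b) := by
  have h := sat_ax (.diam (u x0) v₀) (.cons n .nil)
    ⟨sat_ax (.u_mem x0) (.cons n .nil), sat_ax .v₀_mem (.cons n .nil)⟩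
  rw [sat_leR_iff, rmk_eval_dist, ← nrm_vmk, vmk_xSub, eval_natR, rmk_rNat] at h
  exact h

/-- The fixed point equation, with v₀ subtracted and multiplied by n + 1. For n = 0 it only says u₀
= v₀. -/
theorem seq_fixed (n : M.D .nat) :
    nat n • (vmk (xU (xu n)) - vmk (xv₀ M)) = (nat n + 1) • seq n := by
  have h := sat_ax (.u_fixed x0) (.cons n .nil)
  simp only [segment, sat_eqX, ← vmk_eq, eval_addX, eval_smulX, eval_subR, eval_natR,
    eval_invSucc, eval_U, eval_u, eval_v₀, Tm.eval_var, Interp.Env.cons_z, vmk_xAdd,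
    vmk_xSmul, rmk_rAdd, rmk_rNeg, eval_num, Nat.cast_one, rmk_rNat_one] at h
  have e := rmk_rInv_mul n
  rw [seq, ← h]
  have e' : nat n = (nat n + 1) * (1 + -rmk (rInv n)) := by
    rw [mul_add, mul_neg, e]; ring
  have h₂ : (nat n + 1) • ((1 + -rmk (rInv n)) • vmk (xU (xu n)) +
      rmk (rInv n) • vmk (xv₀ M) - vmk (xv₀ M)) =
      ((nat n + 1) * (1 + -rmk (rInv n))) • (vmk (xU (xu n)) - vmk (xv₀ M)) := by module
  rw [h₂, ← e']

/-- The core of the argument. Indices start at `S n` because U u₀ is not controlled by `seq_fixed`;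
equal indices are treated apart, as `browder_inequality` needs c > 0. -/
theorem nrm_seq_sub_seq_sq_le (n k : M.D .nat) : nrm (seq (S n) - seq (S n + k)) ^ 2 ≤
    nrm (seq (S n + k)) ^ 2 - nrm (seq (S n)) ^ 2 := by
  rcases eq_zero_or_S k with rfl | ⟨k, rfl⟩
  · simp [nrm_zero]
  have hU : nrm (vmk (xU (xu (S n))) - vmk (xU (xu (S n + S k)))) ≤
      nrm (seq (S n) - seq (S n + S k)) := by
    have := xNorm_U_sub_U_le (xu (S n)) (xu (S n + S k))
    rw [← nrm_vmk, ← nrm_vmk, vmk_xSub, vmk_xSub] at this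
    rwa [seq, seq, sub_sub_sub_cancel_right]
  have hU := pow_le_pow_left₀ (nrm_nonneg _) hU 2
  have hn := seq_fixed (S n)
  have hm := seq_fixed (S n + S k)
  have hN : 0 < nat (S n) := by linarith [nat_S n, nat_nonneg n]
  have hK : 0 < nat (S k) := by linarith [nat_S k, nat_nonneg k]
  have hM : nat (S n + S k) = nat (S n) + nat (S k) := map_add _ _ _
  generalize S n = n at *
  generalize S k = k at *
  -- With m = n + k the coefficients are n m (1 + 1/n) and n m (1 + 1/m), so the vector is n m (U uₙ
  -- - U uₘ) and nonexpansiveness applies.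
  have h := nrm_nat_smul_sub_sq (seq n) (seq (n + k)) ((n + 1) * (n + k)) ((n + k + 1) * n)
  have e : nat ((n + 1) * (n + k)) • seq n - nat ((n + k + 1) * n) • seq (n + k) =
      (nat n * nat (n + k)) • (vmk (xU (xu n)) - vmk (xU (xu (n + k)))) := by
    have e₁ : nat ((n + 1) * (n + k)) • seq n = nat (n + k) • ((nat n + 1) • seq n) := by
      rw [smul_smul, map_mul, map_add, map_one, mul_comm]
    have e₂ : nat ((n + k + 1) * n) • seq (n + k) =
        nat n • ((nat (n + k) + 1) • seq (n + k)) := by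
      rw [smul_smul, map_mul, map_add, map_one, mul_comm]
    rw [e₁, e₂, ← hn, ← hm]
    module
  rw [e, nrm_smul, mul_pow, sq_abs] at h
  have h₁ := mul_le_mul_of_nonneg_left hU (sq_nonneg (nat n * nat (n + k)))
  rw [h] at h₁
  simp only [map_mul, map_add, map_one] at h₁
  exact browder_inequality hN hK (sq_nonneg _) (sq_nonneg _) h₁

/-- `‖seq (n + 1)‖ ^ 2` cannot increase by `1 / (k + 1) ^ 2` infinitely often, as it is bounded. -/
theorem exists_nrm_seq_sq_lt (k : M.D .nat) : ∃ n : M.D .nat, ∀ i,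
    nrm (seq (S n + i)) ^ 2 < nrm (seq (S n)) ^ 2 + rmk (rInv k) ^ 2 := by
  by_contra! hc
  -- Induction on J for: some n has J/(k+1)² ≤ ‖xₙ₊₁‖². The negated claim supplies one more
  -- increment at each step.
  have key := induction (M := M)
    (.ex .nat (leR (mulR (natR x1) (mulR (invSucc x2) (invSucc x2)))
      (normSq (subX (u (succ x0)) v₀)))) (.cons k .nil)
  simp only [Fm.sat_ex, sat_leR_iff, rmk_eval_normSq, eval_subX, eval_u, eval_v₀, eval_succ,
    eval_natR, eval_mulR, eval_invSucc, rmk_rMul, Tm.eval_var, Interp.Env.cons_z,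
    Interp.Env.cons_s, ← nrm_vmk, vmk_xSub, rmk_rNat, ← sq] at key
  obtain ⟨n, hn⟩ := key ⟨0, by rw [map_zero, zero_mul]; exact sq_nonneg _⟩
    (fun J ⟨n, hn⟩ => by
      obtain ⟨i, hi⟩ := hc n
      refine ⟨n + i, ?_⟩
      rw [S_add] at hi
      rw [nat_S, add_mul, one_mul]
      exact (add_le_add_left hn _).trans hi)
    -- For J = b²(k+1)² + 1 the lower bound is b² + 1/(k+1)², beyond the bound b² on the squared
    -- norms.
    (M.con .b * M.con .b * (S k * S k) + 1)
  have h₁ := pow_le_pow_left₀ (nrm_nonneg _) (nrm_seq_le (S n)) 2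
  have h₂ := hn.trans h₁
  rw [map_add, map_one, map_mul, map_mul, map_mul, nat_S] at h₂
  have h₃ := rmk_rInv_mul k
  have h₄ := pow_pos (rmk_rInv_pos k) 2
  have h₅ : (nat (M.con .b) * nat (M.con .b) * ((nat k + 1) * (nat k + 1)) + 1) *
      rmk (rInv k) ^ 2 = nat (M.con .b) ^ 2 * ((nat k + 1) * rmk (rInv k)) ^ 2 +
        rmk (rInv k) ^ 2 := by ring
  rw [h₅, h₃] at h₂
  linarith

/-- From the chosen index on, squared norms are at least the first one and exceed it by less than
ε². The core inequality then bounds every squared distance by less than ε². -/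
theorem exists_nrm_seq_sub_lt (k : M.D .nat) : ∃ n : M.D .nat, ∀ i j,
    nrm (seq (n + i) - seq (n + j)) < rmk (rInv k) := by
  obtain ⟨n, hn⟩ := exists_nrm_seq_sq_lt k
  have key : ∀ i j, nrm (seq (S n + i) - seq (S n + i + j)) < rmk (rInv k) := by
    intro i j
    refine lt_of_pow_lt_pow_left₀ 2 (rmk_rInv_pos k).le ?_
    have h₁ := nrm_seq_sub_seq_sq_le n i
    have h₂ := nrm_seq_sub_seq_sq_le (n + i) j
    have h₃ := hn (i + j)
    rw [← S_add] at h₂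
    rw [← add_assoc] at h₃
    linarith [sq_nonneg (nrm (seq (S n) - seq (S n + i)))]
  refine ⟨S n, fun i j => ?_⟩
  rcases exists_add_or i j with ⟨l, rfl⟩ | ⟨l, rfl⟩
  · rw [← add_assoc]
    exact key i l
  · have h := key j l
    rw [← neg_sub, ← neg_one_smul M.R, nrm_smul, abs_neg, abs_one, one_mul] at h
    rwa [← add_assoc]

theorem sat_cauchy : cauchy.Sat (.nil : M.Env []) := by
  simp only [cauchy, Fm.sat_all, Fm.sat_ex, Fm.sat_imp, Fm.sat_and, sat_le, sat_ltR_iff,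
    rmk_eval_dist, eval_u, eval_invSucc, Tm.eval_var, Interp.Env.cons_z, Interp.Env.cons_s,
    ← nrm_vmk, vmk_xSub]
  intro k
  obtain ⟨n, hn⟩ := exists_nrm_seq_sub_lt k
  refine ⟨n, fun m i j ⟨⟨hi, _⟩, hj, _⟩ => ?_⟩
  obtain ⟨i, rfl⟩ := toZ_le_iff.1 hi
  obtain ⟨j, rfl⟩ := toZ_le_iff.1 hj
  simpa [seq] using hn i j

end Model

end Browder

theorem theorem2p3 : Browder.TBPlusProves Browder.cauchy :=
  (Browder.derives_of_forall_model _ fun M hM =>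
    Browder.Model.sat_cauchy (M := ⟨M, hM⟩)).mono_ax .base
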